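/- **Conventions.** For a multiplicative function $f:\mathbb N\to\mathbb C$ with Dirichlet series $F(s)=\sum_{n\ge1} f(n)n^{-s}$, let $\Lambda_f$ be the arithmetic function given by the coefficients of $-F'(s)/F(s)=\sum_{n}\Lambda_f(n)n^{-s}$, that is, $\Lambda_f*f=f\log$ (Dirichlet convolution). Let $\mathcal C$ be the class of multiplicative $f$ with $|\Lambda_f(n)|\le\Lambda(n)$ for all $n\ge1$, where $\Lambda$ is the von Mangoldt function. For $f\in\mathcal C$ let $g$ be its Dirichlet convolution inverse: $(f*g)(1)=1$ and $(f*g)(n)=0$ for $n>1$ (equivalently $F(s)G(s)=1$; one has $g\in\mathcal C$). For a finite set $\Xi$ of primitive Dirichlet characters let $\Xi_q$ be the set of characters mod $q$ induced by the characters in $\Xi$. For an arithmetic function $h$, real $X>0$, $q\ge1$ and $(a,q)=1$, put $$\Delta_\Xi(h,X;q,a)=\sum_{\substack{n\le X\\ n\equiv a\,(\mathrm{mod}\,q)}}h(n)-\frac1{\varphi(q)}\sum_{\chi\in\Xi_q}\chi(a)\sum_{n\le X}h(n)\overline{\chi}(n).$$ Let $\mathcal P$ be the set of primes, and let $h\cdot1_{\mathcal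 P}$ be the function $h$ restricted to the primes. **Theorem 2.3.** Fix $A,C\ge0$ and $\varepsilon>0$. Let $x$ be sufficiently large (in terms of $A,C,\varepsilon$), let $f\in\mathcal C$ with convolution inverse $g$, let $2\le Q\le x^{1/2}/(\log x)^{5A/2+C/4+7/2}$, and let $\Xi$ be a set of at most $(\log x)^C$ primitive characters. Suppose that, for both $h=f$ and $h=g$: (i) $\displaystyle \Delta_\Xi(h,X;q,a)\ll\frac{X}{(\log x)^{14A+28}}$ for all $q\ge1$, all $a$ with $(a,q)=1$, and all $X$ with $x^{0.4}\le X\le x$; (ii) $\displaystyle \sum_{q\le Q}\ \max_{a:(a,q)=1}|\Delta_\Xi(h,X;q,a)|\ll\frac{X}{(\log x)^{A+\varepsilon}}$ for all $X$ with $x/(\log x)^{6A+C+10}\le X\le x$. Then $$\sum_{q\le Q}\ \max_{a:(a,q)=1}|\Delta_\Xi(f\cdot1_{\mathcal P},x;q,a)|\ll\frac{x}{(\log x)^A},$$ and the same holds with $f\cdot1_{\mathcal P}$ replaced by $g\cdot1_{\mathcal P}$. The implied constant in the conclusion depends only on $A$, $C$, $\varepsilon$ and the implied constants in (i) and (ii).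 -/

import Mathlib

open scoped ArithmeticFunction ComplexConjugate

/-- `Lam` is the arithmetic function `Λ_f`, the coefficients of `-F'/F`, where `F` is the Dirichlet
series of `f`. Since `-F'` has the coefficients `f(n) log n`, this says `Λ_f * f = f · log`
(Dirichlet convolution); it determines `Λ_f` as soon as `f(1) ≠ 0`. -/
def IsLogDerivCoeff (f Lam : ArithmeticFunction ℂ) : Prop :=
  ∀ n : ℕ, (Lam * f) n = f n * (Real.log n : ℂ)

/-- The class `𝒞`: multiplicative functions `f` with `|Λ_f(n)| ≤ Λ(n)` for all `n`. -/
def ClassC (f : ArithmeticFunction ℂ) : Prop :=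
  f.IsMultiplicative ∧
    ∃ Lam : ArithmeticFunction ℂ, IsLogDerivCoeff f Lam ∧
      ∀ n : ℕ, ‖Lam n‖ ≤ ArithmeticFunction.vonMangoldt n

/-- A finite set of Dirichlet characters, of arbitrary (varying) moduli. -/
abbrev CharSet : Type := Finset (Σ r : ℕ, DirichletCharacter ℂ r)

/-- All members of `Ξ` are primitive characters, of positive modulus. -/
def CharSet.AllPrimitive (Ξ : CharSet) : Prop :=
  ∀ ξ ∈ Ξ, 0 < ξ.1 ∧ ξ.2.IsPrimitive

open Classical in
/-- `Ξ_q`, the set of characters mod `q` that are induced by the characters in `Ξ`. -/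
noncomputable def CharSet.induced (Ξ : CharSet) (q : ℕ) : Finset (DirichletCharacter ℂ q) :=
  Ξ.biUnion fun ξ => if h : ξ.1 ∣ q then {DirichletCharacter.changeLevel h ξ.2} else ∅

theorem CharSet.mem_induced (Ξ : CharSet) (q : ℕ) (χ : DirichletCharacter ℂ q) :
    χ ∈ Ξ.induced q ↔ ∃ ξ ∈ Ξ, ∃ h : ξ.1 ∣ q, χ = DirichletCharacter.changeLevel h ξ.2 := by
  classical
  simp only [CharSet.induced, Finset.mem_biUnion]
  refine exists_congr fun ξ => and_congr_right fun _ => ?_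
  by_cases h : ξ.1 ∣ q <;> simp [h]

/-- `S_f(X, χ) = ∑_{n ≤ X} f(n) \bar χ(n)`. -/
noncomputable def charSum (f : ℕ → ℂ) (X : ℝ) {q : ℕ} (χ : DirichletCharacter ℂ q) : ℂ :=
  ∑ n ∈ Finset.Icc 1 ⌊X⌋₊, f n * conj (χ (n : ZMod q))

/-- `Δ_Ξ(f, X; q, a)`, for a reduced residue class `a` mod `q`. -/
noncomputable def deltaXi (Ξ : CharSet) (f : ℕ → ℂ) (X : ℝ) (q : ℕ) (a : (ZMod q)ˣ) : ℂ :=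
  (∑ n ∈ Finset.Icc 1 ⌊X⌋₊ with ((n : ℕ) : ZMod q) = (a : ZMod q), f n) -
    1 / (Nat.totient q : ℂ) * ∑ χ ∈ Ξ.induced q, χ (a : ZMod q) * charSum f X χ

/-- `∑_{q ≤ Q} max_{(a,q)=1} |Δ_Ξ(f, X; q, a)|`. For `q ≥ 1` the supremum is over a finite
nonempty set, hence is a maximum. -/
noncomputable def sumMaxDelta (Ξ : CharSet) (f : ℕ → ℂ) (X Q : ℝ) : ℝ :=
  ∑ q ∈ Finset.Icc 1 ⌊Q⌋₊, ⨆ a : (ZMod q)ˣ, ‖deltaXi Ξ f X q a‖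

/-- `f · 1_𝒫`, the restriction of `f` to the primes. -/
def onPrimes (f : ℕ → ℂ) (n : ℕ) : ℂ := if n.Prime then f n else 0

/-! The relation `Λ_f * f = f log` is a differential equation for `f`. With `|Λ_f| ≤ Λ` it forces
`|f| ≤ 1`. Differentiating `f * g = 1` gives `Λ_g = -Λ_f`, so `f` and `g` play symmetric roles and
`|g| ≤ 1` too. It then suffices to bound the sum of maxima for `Λ_f` over `n ≤ N`, uniformly for
`x/(log x)^(A+C+2) ≤ N ≤ x`, by `x (log x)^(1-A)`. Proper prime powers are negligible, and partial
summation removes the weight `log p`.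

Vaughan's identity (`LogDerivBounded.vaughan`), with `g` in the role of the Möbius function and both
cuts at `U = (log x)^(2A+4)`, splits `Λ_f` into a short sum, two type I convolutions with `f log`
and with `f`, and the type II convolution of `g` beyond `U` with `(Λ_f beyond U) * f`. For type I,
multiplication by `m` permutes the reduced classes, so `Δ` of a convolution is a combination of
values of `Δ` at `N/m` (`sumMaxDelta_mul_le`). As `m` is at most a power of `log x`, hypothesis (ii)
applies to every `N/m`. The sum of `1/m` costs only `log log x`, which the `ε` in (ii) pays for.

For type II, `Δ` is expanded in the characters outside `Ξ_q`. Each is induced by a primitive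
character mod `r` outside `Ξ`, with `q = rs`, which leaves sums over integers coprime to `s` and a
harmless factor from `∑ 1/φ(s)` (`sumMaxDelta_le_sum_outerPrimitiveChars`). If `r > (log x)^(A+2)`,
the large sieve and Cauchy–Schwarz suffice. The condition `mn ≤ N` is handled by cutting the region
under the hyperbola into dyadic rectangles and staircases (`sum_primitiveChars_bilinear_le`).

If `r ≤ (log x)^(A+2)`, hypothesis (i) makes the sums of `f` and `g` against the character small.
Coprimality to `s` is imposed by convolving with the inverse function on integers composed of primes
of `s` (`restrict_coprime_eq`), whose tail is small by Rankin's trick. Dirichlet's hyperbola method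
then bounds the bilinear sum. No information on `Λ_f` itself is needed there, because the part
beyond the cut, convolved with `f`, is `f log` minus a type I sum. -/

/-! ### Additive characters of the reals and geometric sums -/

/-- The additive character `t ↦ e^{2πit}` of the reals. -/
noncomputable def expTwoPi (t : ℝ) : ℂ := Complex.exp ((2 * Real.pi * t : ℝ) * Complex.I)

theorem expTwoPi_add (s t : ℝ) : expTwoPi (s + t) = expTwoPi s * expTwoPi t := by
  unfold expTwoPi
  rw [← Complex.exp_add]
  congr 1
  push_cast
  ring

theorem expTwoPi_zero : expTwoPi 0 = 1 := by simp [expTwoPi]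

theorem norm_expTwoPi (t : ℝ) : ‖expTwoPi t‖ = 1 := by
  unfold expTwoPi
  exact Complex.norm_exp_ofReal_mul_I _

theorem conj_expTwoPi (t : ℝ) : conj (expTwoPi t) = expTwoPi (-t) := by
  unfold expTwoPi
  rw [← Complex.exp_conj]
  congr 1
  rw [map_mul, Complex.conj_ofReal, Complex.conj_I]
  push_cast
  ring

theorem expTwoPi_nat_mul (n : ℕ) (t : ℝ) : expTwoPi (n * t) = expTwoPi t ^ n := by
  unfold expTwoPi
  rw [← Complex.exp_nat_mul]
  congr 1
  push_cast
  ring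

theorem expTwoPi_add_int (t : ℝ) (k : ℤ) : expTwoPi (t + k) = expTwoPi t := by
  unfold expTwoPi
  rw [← Complex.exp_periodic.int_mul k ((2 * Real.pi * t : ℝ) * Complex.I)]
  congr 1
  push_cast
  ring

theorem expTwoPi_fract (t : ℝ) : expTwoPi (Int.fract t) = expTwoPi t := by
  conv_rhs => rw [← Int.fract_add_floor t]
  rw [expTwoPi_add_int]

theorem norm_expTwoPi_sub_one (t : ℝ) : ‖expTwoPi t - 1‖ = 2 * |Real.sin (Real.pi * t)| := by
  unfold expTwoPi
  rw [mul_comm, Complex.norm_exp_I_mul_ofReal_sub_one, norm_mul, Real.norm_eq_abs, Real.norm_eq_abs]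
  congr 2
  · norm_num
  · ring_nf

/-- Jordan's inequality `sin u ≥ 2u/π` on `[0, π/2]`, applied to `πt` or to `π(1 - t)`. -/
theorem four_mul_min_le_norm_expTwoPi_sub_one {t : ℝ} (h0 : 0 ≤ t) (h1 : t ≤ 1) :
    4 * min t (1 - t) ≤ ‖expTwoPi t - 1‖ := by
  rw [norm_expTwoPi_sub_one]
  have hpi := Real.pi_pos
  rcases le_total t (1 / 2) with h | h
  · have h2 := Real.mul_le_sin (x := Real.pi * t) (by positivity) (by nlinarith)
    have h3 : 2 / Real.pi * (Real.pi * t) = 2 * t := by field_simp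
    rw [h3] at h2
    have h4 := le_abs_self (Real.sin (Real.pi * t))
    have h5 := min_le_left t (1 - t)
    linarith
  · have h2 := Real.mul_le_sin (x := Real.pi * (1 - t)) (by nlinarith) (by nlinarith)
    have h3 : 2 / Real.pi * (Real.pi * (1 - t)) = 2 * (1 - t) := by field_simp
    rw [h3, show Real.pi * (1 - t) = Real.pi - Real.pi * t by ring, Real.sin_pi_sub] at h2
    have h4 := le_abs_self (Real.sin (Real.pi * t))
    have h5 := min_le_right t (1 - t)
    linarith

theorem Int.fract_neg_add_fract {t : ℝ} (h0 : 0 < Int.fract t) :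
    Int.fract (-t) = 1 - Int.fract t := Int.fract_neg h0.ne'

/-- The geometric sum `∑_{h < H} e(ht)` is small unless `t` is close to an integer. -/
theorem norm_sq_sum_expTwoPi_le (H : ℕ) (t : ℝ) (h0 : 0 < Int.fract t) :
    ‖∑ h ∈ Finset.range H, expTwoPi (h * t)‖ ^ 2 ≤
      1 / 4 * (1 / Int.fract t ^ 2 + 1 / Int.fract (-t) ^ 2) := by
  have h1 := Int.fract_lt_one t
  have hne : expTwoPi t - 1 ≠ 0 := by
    have := four_mul_min_le_norm_expTwoPi_sub_one h0.le h1.le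
    rw [expTwoPi_fract] at this
    have h2 : 0 < min (Int.fract t) (1 - Int.fract t) := lt_min h0 (by linarith)
    rw [← norm_pos_iff]
    linarith
  have hsum : ‖∑ h ∈ Finset.range H, expTwoPi (h * t)‖ * ‖expTwoPi t - 1‖ ≤ 2 := by
    rw [← norm_mul]
    simp_rw [expTwoPi_nat_mul]
    rw [geom_sum_mul]
    refine (norm_sub_le _ _).trans ?_
    rw [norm_pow, norm_expTwoPi]
    norm_num
  have hlow := four_mul_min_le_norm_expTwoPi_sub_one h0.le h1.le
  rw [expTwoPi_fract] at hlow
  rw [Int.fract_neg_add_fract h0]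
  set S := ‖∑ h ∈ Finset.range H, expTwoPi (h * t)‖
  have hS : 0 ≤ S := norm_nonneg _
  have h2 : 0 < 1 - Int.fract t := by linarith
  have key : ∀ m : ℝ, 0 < m → 4 * m ≤ ‖expTwoPi t - 1‖ → S ^ 2 ≤ 1 / 4 * (1 / m ^ 2) := by
    intro m hm hle
    have h3 : S * (4 * m) ≤ 2 := (mul_le_mul_of_nonneg_left hle hS).trans hsum
    have h4 : S ≤ 1 / (2 * m) := by
      rw [le_div_iff₀ (by positivity)]
      linarith
    calc S ^ 2 ≤ (1 / (2 * m)) ^ 2 := by gcongr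
      _ = _ := by field_simp; norm_num
  -- Only the term of the smaller fractional part is needed. The sum of both is stated so that
  -- points can be counted separately on the two sides, for `α` and for `-α`.
  rcases le_total (Int.fract t) (1 - Int.fract t) with h | h
  · rw [min_eq_left h] at hlow
    refine (key _ h0 hlow).trans ?_
    have : 0 ≤ 1 / (1 - Int.fract t) ^ 2 := by positivity
    linarith
  · rw [min_eq_right h] at hlow
    refine (key _ h2 hlow).trans ?_
    have : 0 ≤ 1 / (Int.fract t) ^ 2 := by positivity
    linarith

/-! ### The additive large sieve -/

/-- Points that are `1/P`-spaced modulo one. -/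
def SpacedModOne {ι : Type*} (s : Finset ι) (α : ι → ℝ) (P : ℕ) : Prop :=
  ∀ i ∈ s, ∀ j ∈ s, i ≠ j → ∀ k : ℤ, 1 / (P : ℝ) ≤ |α i - α j - k|

theorem sum_inv_sq_le_two (T : Finset ℕ) (hT : ∀ k ∈ T, 1 ≤ k) :
    ∑ k ∈ T, 1 / (k : ℝ) ^ 2 ≤ 2 := by
  have hsub : T ⊆ Finset.Ioo 0 (T.sup id + 1) := by
    intro k hk
    rw [Finset.mem_Ioo]
    exact ⟨hT k hk, Nat.lt_succ_of_le (Finset.le_sup (f := id) hk)⟩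
  calc (∑ k ∈ T, 1 / (k : ℝ) ^ 2 : ℝ)
      ≤ (∑ k ∈ Finset.Ioo 0 (T.sup id + 1), 1 / (k : ℝ) ^ 2 : ℝ) :=
        Finset.sum_le_sum_of_subset_of_nonneg hsub fun _ _ _ => by positivity
    _ ≤ 2 / ((0 : ℕ) + 1) := by
        simp_rw [one_div]
        exact_mod_cast sum_Ioo_inv_sq_le (α := ℝ) 0 (T.sup id + 1)
    _ = 2 := by norm_num

theorem SpacedModOne.one_div_le_fract {ι : Type*} {s : Finset ι} {α : ι → ℝ} {P : ℕ}
    (hs : SpacedModOne s α P) {i j : ι} (hi : i ∈ s) (hj : j ∈ s) (hij : i ≠ j) :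
    1 / (P : ℝ) ≤ Int.fract (α i - α j) := by
  have h := hs i hi j hj hij ⌊α i - α j⌋
  rwa [Int.self_sub_floor, abs_of_nonneg (Int.fract_nonneg _)] at h

theorem SpacedModOne.neg {ι : Type*} {s : Finset ι} {α : ι → ℝ} {P : ℕ}
    (hs : SpacedModOne s α P) : SpacedModOne s (fun i => -α i) P := by
  intro i hi j hj hij k
  have h := hs j hj i hi hij.symm k
  rwa [show -α i - -α j - k = α j - α i - k by ring]

/-- The integers `⌊P · fract (α i - α j)⌋` are at least one and pairwise distinct: two points with
the same value would be closer than `1/P` modulo one. Hence the sum is at most `P²` times a sum of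
distinct `1/k²`. -/
theorem SpacedModOne.sum_inv_sq_fract_le {ι : Type*} [DecidableEq ι] {s : Finset ι} {α : ι → ℝ}
    {P : ℕ} (hP : 0 < P) (hs : SpacedModOne s α P) {i : ι} (hi : i ∈ s) :
    ∑ j ∈ s.erase i, 1 / Int.fract (α i - α j) ^ 2 ≤ 2 * (P : ℝ) ^ 2 := by
  have hP' : (0 : ℝ) < P := by exact_mod_cast hP
  set κ : ι → ℕ := fun j => ⌊P * Int.fract (α i - α j)⌋₊ with hκ
  have hfr : ∀ j ∈ s.erase i, 1 / (P : ℝ) ≤ Int.fract (α i - α j) := fun j hj =>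
    hs.one_div_le_fract hi (Finset.mem_of_mem_erase hj) (Finset.ne_of_mem_erase hj).symm
  have hκ1 : ∀ j ∈ s.erase i, 1 ≤ κ j := by
    intro j hj
    refine Nat.le_floor ?_
    have := mul_le_mul_of_nonneg_left (hfr j hj) hP'.le
    rw [mul_one_div_cancel hP'.ne'] at this
    exact_mod_cast this
  have hκle : ∀ j, (κ j : ℝ) ≤ P * Int.fract (α i - α j) := fun j =>
    Nat.floor_le (mul_nonneg hP'.le (Int.fract_nonneg _))
  have hκlt : ∀ j, P * Int.fract (α i - α j) < κ j + 1 := fun j => Nat.lt_floor_add_one _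
  have hinj : Set.InjOn κ (s.erase i) := by
    intro j hj l hl hjl
    by_contra hne
    -- The integer shift is the difference of the two floors, which turns `α l - α j` into a
    -- difference of fractional parts.
    have h := hs l (Finset.mem_of_mem_erase hl) j (Finset.mem_of_mem_erase hj) (Ne.symm hne)
      (⌊α i - α j⌋ - ⌊α i - α l⌋)
    have e : α l - α j - ((⌊α i - α j⌋ - ⌊α i - α l⌋ : ℤ) : ℝ)
        = Int.fract (α i - α j) - Int.fract (α i - α l) := by
      rw [Int.fract, Int.fract]
      push_cast
      ring
    rw [e, div_le_iff₀ hP', mul_comm] at h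
    nth_rewrite 1 [← abs_of_pos hP'] at h
    rw [← abs_mul, mul_sub] at h
    have h1 := hκle j
    have h2 := hκlt j
    have h3 := hκle l
    have h4 := hκlt l
    rw [hjl] at h1 h2
    have : |P * Int.fract (α i - α j) - P * Int.fract (α i - α l)| < 1 := by
      rw [abs_lt]
      constructor <;> linarith
    linarith
  have hterm : ∀ j ∈ s.erase i, 1 / Int.fract (α i - α j) ^ 2 ≤ (P : ℝ) ^ 2 * (1 / (κ j : ℝ) ^ 2) := by
    intro j hj
    have h1 : (0 : ℝ) < κ j := by exact_mod_cast hκ1 j hj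
    have h2 : 0 < Int.fract (α i - α j) := lt_of_lt_of_le (by positivity) (hfr j hj)
    rw [mul_one_div, div_le_div_iff₀ (by positivity) (by positivity), one_mul, ← mul_pow]
    exact pow_le_pow_left₀ h1.le (hκle j) 2
  calc ∑ j ∈ s.erase i, 1 / Int.fract (α i - α j) ^ 2
      ≤ ∑ j ∈ s.erase i, (P : ℝ) ^ 2 * (1 / (κ j : ℝ) ^ 2) := Finset.sum_le_sum hterm
    _ = (P : ℝ) ^ 2 * ∑ k ∈ (s.erase i).image κ, 1 / (k : ℝ) ^ 2 := by
        rw [← Finset.mul_sum, Finset.sum_image hinj]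
    _ ≤ (P : ℝ) ^ 2 * 2 := by
        gcongr
        refine sum_inv_sq_le_two _ fun k hk => ?_
        obtain ⟨j, hj, rfl⟩ := Finset.mem_image.1 hk
        exact hκ1 j hj
    _ = 2 * (P : ℝ) ^ 2 := mul_comm _ _

/-- The diagonal gives `H²`. Off the diagonal the two one-sided sums are at most `2P²` each and
carry the weight `1/4`. -/
theorem SpacedModOne.sum_kernel_le {ι : Type*} [DecidableEq ι] {s : Finset ι} {α : ι → ℝ}
    {P : ℕ} (hP : 0 < P) (hs : SpacedModOne s α P) (H : ℕ) {i : ι} (hi : i ∈ s) :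
    ∑ j ∈ s, ‖∑ h ∈ Finset.range H, expTwoPi (h * (α i - α j))‖ ^ 2 ≤ (H : ℝ) ^ 2 + P ^ 2 := by
  have hP' : (0 : ℝ) < P := by exact_mod_cast hP
  rw [← Finset.add_sum_erase _ _ hi]
  have h0 : ‖∑ h ∈ Finset.range H, expTwoPi (h * (α i - α i))‖ ^ 2 = (H : ℝ) ^ 2 := by
    simp [expTwoPi_zero]
  have hfr : ∀ j ∈ s.erase i, 0 < Int.fract (α i - α j) := fun j hj =>
    lt_of_lt_of_le (by positivity) (hs.one_div_le_fract hi (Finset.mem_of_mem_erase hj)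
      (Finset.ne_of_mem_erase hj).symm)
  have h1 := hs.sum_inv_sq_fract_le hP hi
  have h2 := hs.neg.sum_inv_sq_fract_le hP hi
  have h3 : ∑ j ∈ s.erase i, ‖∑ h ∈ Finset.range H, expTwoPi (h * (α i - α j))‖ ^ 2 ≤
      ∑ j ∈ s.erase i, 1 / 4 * (1 / Int.fract (α i - α j) ^ 2 +
        1 / Int.fract (-α i - -α j) ^ 2) := by
    refine Finset.sum_le_sum fun j hj => ?_
    have := norm_sq_sum_expTwoPi_le H (α i - α j) (hfr j hj)
    rwa [show -(α i - α j) = -α i - -α j by ring] at this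
  rw [← Finset.mul_sum, Finset.sum_add_distrib] at h3
  rw [h0]
  linarith

theorem sum_comm_pairs {ι κ M : Type*} [AddCommMonoid M] (S T : Finset ι) (U V : Finset κ)
    (F : ι → ι → κ → κ → M) :
    ∑ h ∈ S, ∑ h' ∈ T, ∑ i ∈ U, ∑ j ∈ V, F h h' i j =
      ∑ i ∈ U, ∑ j ∈ V, ∑ h ∈ S, ∑ h' ∈ T, F h h' i j := by
  have h1 : ∀ h, ∑ h' ∈ T, ∑ i ∈ U, ∑ j ∈ V, F h h' i j =
      ∑ i ∈ U, ∑ j ∈ V, ∑ h' ∈ T, F h h' i j := fun h => by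
    rw [Finset.sum_comm]
    exact Finset.sum_congr rfl fun i _ => Finset.sum_comm
  simp_rw [h1]
  rw [Finset.sum_comm]
  exact Finset.sum_congr rfl fun i _ => Finset.sum_comm

/-- Weighting a frequency by its number of representations as `h + h'` makes the kernel the square
of a geometric sum. Such a Fejér-type kernel decays quadratically, so its sum over spaced points
loses no logarithm. -/
theorem sum_norm_sq_trigSum_eq {ι : Type*} (s : Finset ι) (α : ι → ℝ) (c : ι → ℂ) (H : ℕ) :
    (((∑ h ∈ Finset.range H, ∑ h' ∈ Finset.range H,
        ‖∑ i ∈ s, c i * expTwoPi (((h + h' : ℕ) : ℝ) * α i)‖ ^ 2 : ℝ)) : ℂ) =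
      ∑ i ∈ s, ∑ j ∈ s, c i * conj (c j) *
        (∑ h ∈ Finset.range H, expTwoPi (h * (α i - α j))) ^ 2 := by
  have hterm : ∀ n : ℕ, ((‖∑ i ∈ s, c i * expTwoPi ((n : ℝ) * α i)‖ ^ 2 : ℝ) : ℂ) =
      ∑ i ∈ s, ∑ j ∈ s, c i * conj (c j) * expTwoPi (n * (α i - α j)) := by
    intro n
    rw [Complex.ofReal_pow, ← Complex.mul_conj', map_sum, Finset.sum_mul_sum]
    refine Finset.sum_congr rfl fun i _ => Finset.sum_congr rfl fun j _ => ?_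
    rw [map_mul, conj_expTwoPi, show (n : ℝ) * (α i - α j) = n * α i + -(n * α j) by ring,
      expTwoPi_add]
    ring
  rw [Complex.ofReal_sum]
  simp_rw [Complex.ofReal_sum, hterm]
  simp_rw [sq, Finset.sum_mul_sum, Finset.mul_sum]
  have e : ∀ h h' : ℕ, ∀ i j : ι, c i * conj (c j) * expTwoPi ((h + h' : ℕ) * (α i - α j)) =
      c i * conj (c j) * (expTwoPi (h * (α i - α j)) * expTwoPi (h' * (α i - α j))) := by
    intro h h' i j
    rw [← expTwoPi_add]
    push_cast
    ring_nf
  simp_rw [e]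
  exact sum_comm_pairs _ _ _ _ _

/-- Schur's test: `|c i c j|` is at most the mean of the squares, the kernel is symmetric, and its
row sums are bounded. -/
theorem SpacedModOne.sum_norm_sq_trigSum_le {ι : Type*} [DecidableEq ι] {s : Finset ι} {α : ι → ℝ}
    {P : ℕ} (hP : 0 < P) (hs : SpacedModOne s α P) (c : ι → ℂ) (H : ℕ) :
    ∑ h ∈ Finset.range H, ∑ h' ∈ Finset.range H,
        ‖∑ i ∈ s, c i * expTwoPi (((h + h' : ℕ) : ℝ) * α i)‖ ^ 2 ≤
      ((H : ℝ) ^ 2 + P ^ 2) * ∑ i ∈ s, ‖c i‖ ^ 2 := by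
  set X := ∑ h ∈ Finset.range H, ∑ h' ∈ Finset.range H,
        ‖∑ i ∈ s, c i * expTwoPi (((h + h' : ℕ) : ℝ) * α i)‖ ^ 2
  set κ : ι → ι → ℝ := fun i j => ‖∑ h ∈ Finset.range H, expTwoPi (h * (α i - α j))‖ ^ 2 with hκ
  have hsymm : ∀ i j, κ i j = κ j i := by
    intro i j
    simp only [hκ]
    rw [← Complex.norm_conj, map_sum]
    simp_rw [conj_expTwoPi]
    refine congrArg (fun z : ℂ => ‖z‖ ^ 2) (Finset.sum_congr rfl fun h _ => ?_)
    ring_nf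
  have hX : X ≤ ∑ i ∈ s, ∑ j ∈ s, ‖c i‖ * ‖c j‖ * κ i j := by
    have h0 : 0 ≤ X := by positivity
    have h1 : X = ‖(X : ℂ)‖ := by rw [Complex.norm_real, Real.norm_eq_abs, abs_of_nonneg h0]
    rw [h1, sum_norm_sq_trigSum_eq]
    refine (norm_sum_le _ _).trans (Finset.sum_le_sum fun i _ => ?_)
    refine (norm_sum_le _ _).trans (Finset.sum_le_sum fun j _ => ?_)
    rw [norm_mul, norm_mul, norm_pow, Complex.norm_conj]
  have hrow : ∀ i ∈ s, ∑ j ∈ s, κ i j ≤ (H : ℝ) ^ 2 + P ^ 2 := fun i hi => hs.sum_kernel_le hP H hi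
  have hκ0 : ∀ i j, 0 ≤ κ i j := fun i j => by positivity
  have h2 : ∑ i ∈ s, ∑ j ∈ s, ‖c i‖ * ‖c j‖ * κ i j ≤
      ∑ i ∈ s, ∑ j ∈ s, (1 / 2 * (‖c i‖ ^ 2 * κ i j) + 1 / 2 * (‖c j‖ ^ 2 * κ j i)) := by
    refine Finset.sum_le_sum fun i _ => Finset.sum_le_sum fun j _ => ?_
    rw [hsymm j i]
    nlinarith [mul_nonneg (sq_nonneg (‖c i‖ - ‖c j‖)) (hκ0 i j)]
  have h3 : ∑ i ∈ s, ∑ j ∈ s, ‖c i‖ ^ 2 * κ i j ≤ ((H : ℝ) ^ 2 + P ^ 2) * ∑ i ∈ s, ‖c i‖ ^ 2 := by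
    rw [Finset.mul_sum]
    refine Finset.sum_le_sum fun i hi => ?_
    rw [← Finset.mul_sum, mul_comm]
    exact mul_le_mul_of_nonneg_right (hrow i hi) (by positivity)
  have h4 : ∑ i ∈ s, ∑ j ∈ s, ‖c j‖ ^ 2 * κ j i = ∑ i ∈ s, ∑ j ∈ s, ‖c i‖ ^ 2 * κ i j :=
    Finset.sum_comm
  simp_rw [Finset.sum_add_distrib, ← Finset.mul_sum] at h2
  simp_rw [← Finset.mul_sum] at h3 h4
  linarith

theorem SpacedModOne.dual_large_sieve {ι : Type*} [DecidableEq ι] {s : Finset ι} {α : ι → ℝ}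
    {P : ℕ} (hP : 0 < P) (hs : SpacedModOne s α P) (c : ι → ℂ) (M N : ℕ) :
    ∑ n ∈ Finset.Ioc M (M + N), ‖∑ i ∈ s, c i * expTwoPi (n * α i)‖ ^ 2 ≤
      5 * ((N : ℝ) + P) * ∑ i ∈ s, ‖c i‖ ^ 2 := by
  -- The interval is moved to `[G, G + N)`, where every integer has at least `G` representations as
  -- `h + h'` with both parts below `G + N`. Dividing by `G` then balances `N` and `P`.
  set G := N + P with hG
  have hGpos : (0 : ℝ) < G := by
    have : 0 < G := by omega
    exact_mod_cast this
  -- The unimodular twist effects the translation from `M + 1` to `G` without changing the norms of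
  -- the coefficients.
  set c' : ι → ℂ := fun i => c i * expTwoPi (((M : ℝ) + 1 - G) * α i) with hc'
  have hc'n : ∀ i, ‖c' i‖ = ‖c i‖ := fun i => by rw [hc', norm_mul, norm_expTwoPi, mul_one]
  set F : ℕ → ℝ := fun u => ‖∑ i ∈ s, c' i * expTwoPi ((u : ℝ) * α i)‖ ^ 2 with hF
  have hshift : ∑ n ∈ Finset.Ioc M (M + N), ‖∑ i ∈ s, c i * expTwoPi (n * α i)‖ ^ 2 =
      ∑ v ∈ Finset.range N, F (G + v) := by
    refine Finset.sum_nbij' (fun n => n - (M + 1)) (fun v => M + 1 + v) ?_ ?_ ?_ ?_ ?_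
    · intro n hn
      simp only [Finset.mem_Ioc, Finset.mem_range] at hn ⊢
      omega
    · intro v hv
      simp only [Finset.mem_Ioc, Finset.mem_range] at hv ⊢
      omega
    · intro n hn
      simp only [Finset.mem_Ioc] at hn
      omega
    · intro v _
      omega
    · intro n hn
      obtain ⟨v, rfl⟩ : ∃ v, n = M + 1 + v := ⟨n - (M + 1), by
        simp only [Finset.mem_Ioc] at hn
        omega⟩
      rw [Nat.add_sub_cancel_left]
      simp only [hF, hc']
      congr 2
      refine Finset.sum_congr rfl fun i _ => ?_
      rw [mul_assoc, ← expTwoPi_add]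
      congr 2
      push_cast
      ring
  -- The representations used are `(G + v - b) + b` with `b < G`.
  have hcount : (G : ℝ) * ∑ v ∈ Finset.range N, F (G + v) ≤
      ∑ h ∈ Finset.range (G + N), ∑ h' ∈ Finset.range (G + N), F (h + h') := by
    have h1 : (G : ℝ) * ∑ v ∈ Finset.range N, F (G + v) =
        ∑ p ∈ Finset.range N ×ˢ Finset.range G, F (G + p.1) := by
      rw [Finset.sum_product]
      simp [Finset.mul_sum]
    rw [h1, ← Finset.sum_product']
    have hinj : Set.InjOn (fun p : ℕ × ℕ => (G + p.1 - p.2, p.2))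
        (Finset.range N ×ˢ Finset.range G : Finset (ℕ × ℕ)) := by
      rintro ⟨a, b⟩ h ⟨a', b'⟩ h' e
      simp only [Finset.coe_product, Finset.coe_range, Set.mem_prod, Set.mem_Iio] at h h'
      simp only [Prod.mk.injEq] at e ⊢
      omega
    calc ∑ p ∈ Finset.range N ×ˢ Finset.range G, F (G + p.1)
        = ∑ p ∈ Finset.range N ×ˢ Finset.range G, F ((G + p.1 - p.2) + p.2) := by
          refine Finset.sum_congr rfl fun p hp => ?_
          simp only [Finset.mem_product, Finset.mem_range] at hp
          rw [Nat.sub_add_cancel (by omega)]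
      _ = ∑ p ∈ (Finset.range N ×ˢ Finset.range G).image
            (fun p : ℕ × ℕ => (G + p.1 - p.2, p.2)), F (p.1 + p.2) := by
          rw [Finset.sum_image hinj]
      _ ≤ _ := by
          refine Finset.sum_le_sum_of_subset_of_nonneg ?_ fun _ _ _ => by positivity
          intro p hp
          obtain ⟨⟨a, b⟩, hab, rfl⟩ := Finset.mem_image.1 hp
          simp only [Finset.mem_product, Finset.mem_range] at hab ⊢
          omega
  have hbound := hs.sum_norm_sq_trigSum_le hP c' (G + N)
  simp_rw [hc'n] at hbound
  rw [hshift]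
  have hS : 0 ≤ ∑ i ∈ s, ‖c i‖ ^ 2 := by positivity
  have hle : ((G + N : ℕ) : ℝ) ^ 2 + (P : ℝ) ^ 2 ≤ 5 * (G : ℝ) * G := by
    rw [hG]
    push_cast
    have hN : (0 : ℝ) ≤ N := by positivity
    have hP' : (0 : ℝ) ≤ P := by positivity
    nlinarith [mul_nonneg hN hP', sq_nonneg (N : ℝ), sq_nonneg (P : ℝ)]
  have h5 : (G : ℝ) * ∑ v ∈ Finset.range N, F (G + v) ≤
      (G : ℝ) * (5 * (G : ℝ) * ∑ i ∈ s, ‖c i‖ ^ 2) := by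
    refine (hcount.trans hbound).trans ?_
    calc _ ≤ (5 * (G : ℝ) * G) * ∑ i ∈ s, ‖c i‖ ^ 2 := mul_le_mul_of_nonneg_right hle hS
      _ = _ := by ring
  have := le_of_mul_le_mul_left h5 hGpos
  rwa [hG, Nat.cast_add] at this

/-- The additive large sieve inequality. -/
theorem SpacedModOne.large_sieve {ι : Type*} [DecidableEq ι] {s : Finset ι} {α : ι → ℝ}
    {P : ℕ} (hP : 0 < P) (hs : SpacedModOne s α P) (a : ℕ → ℂ) (M N : ℕ) :
    ∑ i ∈ s, ‖∑ n ∈ Finset.Ioc M (M + N), a n * expTwoPi (n * α i)‖ ^ 2 ≤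
      5 * ((N : ℝ) + P) * ∑ n ∈ Finset.Ioc M (M + N), ‖a n‖ ^ 2 := by
  set S : ι → ℂ := fun i => ∑ n ∈ Finset.Ioc M (M + N), a n * expTwoPi (n * α i) with hS
  set T := ∑ i ∈ s, ‖S i‖ ^ 2 with hT
  set B := 5 * ((N : ℝ) + P) with hB
  -- Duality: the left side is `T = ∑ a n · W n`, and the dual inequality bounds `∑ |W n|²` by `B
  -- T`. After Cauchy–Schwarz one factor `T` cancels.
  set W : ℕ → ℂ := fun n => ∑ i ∈ s, conj (S i) * expTwoPi (n * α i) with hW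
  have hT0 : 0 ≤ T := by positivity
  have hdual : ∑ n ∈ Finset.Ioc M (M + N), ‖W n‖ ^ 2 ≤ B * T := by
    have := hs.dual_large_sieve hP (fun i => conj (S i)) M N
    simpa [Complex.norm_conj] using this
  have hTW : (T : ℂ) = ∑ n ∈ Finset.Ioc M (M + N), a n * W n := by
    rw [hT, Complex.ofReal_sum]
    simp_rw [hW, Finset.mul_sum]
    rw [Finset.sum_comm]
    refine Finset.sum_congr rfl fun i _ => ?_
    rw [Complex.ofReal_pow, ← Complex.conj_mul']
    conv_lhs => rw [hS]
    simp only
    rw [Finset.mul_sum]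
    refine Finset.sum_congr rfl fun n _ => ?_
    ring
  have hT1 : T ≤ ∑ n ∈ Finset.Ioc M (M + N), ‖a n‖ * ‖W n‖ := by
    have h1 : T = ‖(T : ℂ)‖ := by rw [Complex.norm_real, Real.norm_eq_abs, abs_of_nonneg hT0]
    rw [h1, hTW]
    refine (norm_sum_le _ _).trans (Finset.sum_le_sum fun n _ => (norm_mul _ _).le)
  have hCS := Finset.sum_mul_sq_le_sq_mul_sq (Finset.Ioc M (M + N)) (fun n => ‖a n‖)
    (fun n => ‖W n‖)
  have hT2 : T ^ 2 ≤ (∑ n ∈ Finset.Ioc M (M + N), ‖a n‖ ^ 2) * (B * T) :=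
    ((pow_le_pow_left₀ hT0 hT1 2).trans hCS).trans
      (mul_le_mul_of_nonneg_left hdual (by positivity))
  rcases hT0.eq_or_lt with h | h
  · rw [← h]
    positivity
  · refine le_of_mul_le_mul_right ?_ h
    calc T * T = T ^ 2 := by ring
      _ ≤ _ := hT2
      _ = _ := by ring

/-! ### Character orthogonality, Gauss sums and the multiplicative large sieve -/

theorem DirichletCharacter.conj_apply {q : ℕ} [NeZero q] (χ : DirichletCharacter ℂ q) (a : ZMod q) :
    conj (χ a) = χ⁻¹ a := MulChar.star_apply' χ a

theorem DirichletCharacter.sum_mul_conj {q : ℕ} [NeZero q] (a b : ZMod q) :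
    ∑ χ : DirichletCharacter ℂ q, χ a * conj (χ b) =
      if IsUnit b ∧ a = b then (q.totient : ℂ) else 0 := by
  by_cases hb : IsUnit b
  · have h := DirichletCharacter.sum_char_inv_mul_char_eq ℂ hb a
    have e : ∀ χ : DirichletCharacter ℂ q, χ a * conj (χ b) = χ b⁻¹ * χ a := by
      intro χ
      obtain ⟨u, rfl⟩ := hb
      rw [DirichletCharacter.conj_apply, MulChar.inv_apply, Ring.inverse_unit, ZMod.inv_coe_unit,
        mul_comm]
    simp_rw [e, h]
    simp [hb, eq_comm]
  · simp [hb, MulChar.map_nonunit _ hb]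

/-- Parseval's identity for the characters modulo `q`. -/
theorem DirichletCharacter.sum_norm_sq_sum_mul {q : ℕ} [NeZero q] (F : ZMod q → ℂ) :
    ∑ χ : DirichletCharacter ℂ q, ‖∑ b, χ b * F b‖ ^ 2 =
      q.totient * ∑ b : ZMod q with IsUnit b, ‖F b‖ ^ 2 := by
  apply Complex.ofReal_injective
  rw [Complex.ofReal_sum, Complex.ofReal_mul, Complex.ofReal_sum]
  have h : ∀ χ : DirichletCharacter ℂ q, ((‖∑ b, χ b * F b‖ ^ 2 : ℝ) : ℂ) =
      ∑ b, ∑ c, F b * conj (F c) * (χ b * conj (χ c)) := by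
    intro χ
    rw [Complex.ofReal_pow, ← Complex.mul_conj', map_sum, Finset.sum_mul_sum]
    refine Finset.sum_congr rfl fun b _ => Finset.sum_congr rfl fun c _ => ?_
    rw [map_mul]
    ring
  simp_rw [h]
  rw [Finset.sum_comm, Finset.sum_congr rfl fun b _ => Finset.sum_comm]
  simp_rw [← Finset.mul_sum, DirichletCharacter.sum_mul_conj]
  rw [Finset.mul_sum, Finset.sum_filter]
  refine Finset.sum_congr rfl fun b _ => ?_
  rw [Finset.sum_eq_single b]
  · by_cases hb : IsUnit b
    · simp only [hb, true_and, if_true]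
      rw [Complex.mul_conj']
      push_cast
      ring
    · simp [hb]
  · intro c _ hc
    simp [hc.symm]
  · simp

theorem AddChar.conj_stdAddChar {q : ℕ} [NeZero q] (a : ZMod q) :
    conj (ZMod.stdAddChar a) = ZMod.stdAddChar (-a) := by
  rw [AddChar.map_neg_eq_conj]

theorem sum_norm_sq_sum_stdAddChar {q : ℕ} [NeZero q] (F : ZMod q → ℂ) :
    ∑ n : ZMod q, ‖∑ b, F b * ZMod.stdAddChar (n * b)‖ ^ 2 = q * ∑ b, ‖F b‖ ^ 2 := by
  apply Complex.ofReal_injective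
  rw [Complex.ofReal_sum, Complex.ofReal_mul, Complex.ofReal_sum]
  have h : ∀ n : ZMod q, ((‖∑ b, F b * ZMod.stdAddChar (n * b)‖ ^ 2 : ℝ) : ℂ) =
      ∑ b, ∑ c, F b * conj (F c) * ZMod.stdAddChar (n * (b - c)) := by
    intro χ
    rw [Complex.ofReal_pow, ← Complex.mul_conj', map_sum, Finset.sum_mul_sum]
    refine Finset.sum_congr rfl fun b _ => Finset.sum_congr rfl fun c _ => ?_
    rw [RingHom.map_mul, AddChar.conj_stdAddChar, mul_sub, sub_eq_add_neg, AddChar.map_add_eq_mul]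
    ring
  simp_rw [h]
  rw [Finset.sum_comm, Finset.sum_congr rfl fun b _ => Finset.sum_comm]
  simp_rw [← Finset.mul_sum, AddChar.sum_mulShift _ (ZMod.isPrimitive_stdAddChar q)]
  rw [Finset.mul_sum]
  refine Finset.sum_congr rfl fun b _ => ?_
  rw [Finset.sum_eq_single b]
  · simp only [sub_self, if_true, ZMod.card]
    rw [Complex.mul_conj']
    push_cast
    ring
  · intro c _ hc
    simp [sub_eq_zero, hc.symm]
  · simp

theorem DirichletCharacter.sum_norm_sq {q : ℕ} [NeZero q] (χ : DirichletCharacter ℂ q) :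
    ∑ b : ZMod q, ‖χ b‖ ^ 2 = q.totient := by
  classical
  have h : ∀ b : ZMod q, ‖χ b‖ ^ 2 = if IsUnit b then 1 else 0 := by
    intro b
    split_ifs with hb
    · obtain ⟨u, rfl⟩ := hb
      rw [DirichletCharacter.unit_norm_eq_one, one_pow]
    · rw [MulChar.map_nonunit _ hb, norm_zero, sq, zero_mul]
  simp_rw [h]
  rw [Finset.sum_boole, ← ZMod.card_units_eq_totient]
  norm_cast
  rw [← Fintype.card_subtype]
  exact Fintype.card_congr (Equiv.ofBijective (fun u : (ZMod q)ˣ => (⟨u, u.isUnit⟩ :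
    {b : ZMod q // IsUnit b})) ⟨fun u v h => Units.ext (congrArg Subtype.val h),
      fun b => ⟨b.2.unit, rfl⟩⟩).symm

theorem sum_mul_stdAddChar_of_isPrimitive {q : ℕ} [NeZero q] {χ : DirichletCharacter ℂ q}
    (hχ : χ.IsPrimitive) (n : ZMod q) :
    ∑ b, χ b * ZMod.stdAddChar (n * b) = χ⁻¹ n * gaussSum χ ZMod.stdAddChar := by
  rw [← gaussSum_mulShift_of_isPrimitive _ hχ, gaussSum]
  simp_rw [AddChar.mulShift_apply]

/-- Parseval for the additive characters, applied to `χ`. Its Fourier transform is the Gauss sum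
times `χ⁻¹`, so both sides carry the factor `φ(q)`, which cancels. -/
theorem norm_sq_gaussSum_of_isPrimitive {q : ℕ} [NeZero q] {χ : DirichletCharacter ℂ q}
    (hχ : χ.IsPrimitive) : ‖gaussSum χ ZMod.stdAddChar‖ ^ 2 = q := by
  have h := sum_norm_sq_sum_stdAddChar χ
  simp_rw [sum_mul_stdAddChar_of_isPrimitive hχ, norm_mul, mul_pow] at h
  rw [← Finset.sum_mul, DirichletCharacter.sum_norm_sq, DirichletCharacter.sum_norm_sq,
    mul_comm] at h
  have hφ : (q.totient : ℝ) ≠ 0 := by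
    exact_mod_cast (Nat.totient_pos.2 (NeZero.pos q)).ne'
  exact mul_right_cancel₀ hφ h

/-- For primitive `χ` the Gauss sum times `conj (χ n)` is the additive transform of `χ` at `n`. The
character sum is thereby a coefficient of the exponential sum as a function of `b`. Parseval over
all characters, with the imprimitive ones dropped by positivity, gives the bound. -/
theorem sum_isPrimitive_norm_sq_le {q : ℕ} [NeZero q] (a : ℕ → ℂ) (I : Finset ℕ)
    [DecidablePred fun χ : DirichletCharacter ℂ q => χ.IsPrimitive] :
    (q : ℝ) / q.totient * ∑ χ : DirichletCharacter ℂ q with χ.IsPrimitive,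
        ‖∑ n ∈ I, a n * conj (χ (n : ZMod q))‖ ^ 2 ≤
      ∑ b : ZMod q with IsUnit b, ‖∑ n ∈ I, a n * ZMod.stdAddChar ((n : ZMod q) * b)‖ ^ 2 := by
  have hφ : (0 : ℝ) < q.totient := by
    exact_mod_cast Nat.totient_pos.2 (NeZero.pos q)
  have h := DirichletCharacter.sum_norm_sq_sum_mul
    (fun b : ZMod q => ∑ n ∈ I, a n * ZMod.stdAddChar ((n : ZMod q) * b))
  rw [div_mul_eq_mul_div, div_le_iff₀ hφ, mul_comm _ (q.totient : ℝ), ← h, Finset.mul_sum]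
  refine (Finset.sum_le_sum fun χ hχ => ?_).trans
    (Finset.sum_le_sum_of_subset_of_nonneg (Finset.filter_subset _ _) fun _ _ _ => by positivity)
  have hp := (Finset.mem_filter.1 hχ).2
  rw [← norm_sq_gaussSum_of_isPrimitive hp, ← mul_pow, ← norm_mul]
  refine le_of_eq (congrArg (fun z : ℂ => ‖z‖ ^ 2) ?_)
  simp_rw [Finset.mul_sum]
  rw [Finset.sum_comm]
  refine Finset.sum_congr rfl fun n _ => ?_
  rw [DirichletCharacter.conj_apply, mul_left_comm, mul_comm (gaussSum _ _),
    ← sum_mul_stdAddChar_of_isPrimitive hp, Finset.mul_sum]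
  exact Finset.sum_congr rfl fun b _ => by ring

/-- The reduced fractions in `[0, 1)` with denominator at most `D`. -/
def fareyFractions (D : ℕ) : Finset (Σ _ : ℕ, ℕ) :=
  (Finset.Icc 1 D).sigma fun r => (Finset.range r).filter fun b => b.Coprime r

/-- The difference, even after an integer shift, is an integer over `r r' ≤ D²`. That integer is
nonzero because reduced fractions in `[0, 1)` are distinct modulo one. -/
theorem spacedModOne_fareyFractions (D : ℕ) :
    SpacedModOne (fareyFractions D) (fun p => (p.2 : ℝ) / p.1) (D ^ 2) := by
  rintro ⟨r, b⟩ hi ⟨r', b'⟩ hj hij k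
  simp only [fareyFractions, Finset.mem_sigma, Finset.mem_Icc, Finset.mem_filter,
    Finset.mem_range] at hi hj
  obtain ⟨⟨hr1, hrD⟩, hb, hc⟩ := hi
  obtain ⟨⟨hr1', hrD'⟩, hb', hc'⟩ := hj
  have hr : (0 : ℝ) < r := by exact_mod_cast hr1
  have hr' : (0 : ℝ) < r' := by exact_mod_cast hr1'
  have e : (b : ℝ) / r - (b' : ℝ) / r' - k =
      ((b * r' - b' * r - k * r * r' : ℤ) : ℝ) / (r * r') := by
    push_cast
    field_simp
  simp only
  rw [e, abs_div, abs_of_pos (mul_pos hr hr'), ← Int.cast_abs]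
  have hne : (b * r' - b' * r - k * r * r' : ℤ) ≠ 0 := by
    intro h0
    have hk : k = 0 := by
      have h1 : ((b : ℝ) / r - (b' : ℝ) / r') = k := by
        rw [h0] at e
        simp only [Int.cast_zero, zero_div] at e
        linarith
      have h2 : (b : ℝ) / r < 1 := (div_lt_one hr).2 (by exact_mod_cast hb)
      have h3 : (b' : ℝ) / r' < 1 := (div_lt_one hr').2 (by exact_mod_cast hb')
      have h4 : 0 ≤ (b : ℝ) / r := by positivity
      have h5 : 0 ≤ (b' : ℝ) / r' := by positivity
      have h6 : (k : ℝ) < 1 := by linarith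
      have h7 : (-1 : ℝ) < k := by linarith
      have h8 : k < 1 := by exact_mod_cast h6
      have h9 : -1 < k := by exact_mod_cast h7
      omega
    rw [hk] at h0
    have h1 : b * r' = b' * r := by
      have : (b * r' : ℤ) = b' * r := by linarith
      exact_mod_cast this
    have hd : r ∣ r' := (hc.symm).dvd_of_dvd_mul_left ⟨b', by rw [h1]; ring⟩
    have hd' : r' ∣ r := (hc'.symm).dvd_of_dvd_mul_left ⟨b, by rw [← h1]; ring⟩
    have hrr := Nat.dvd_antisymm hd hd'
    subst hrr
    have : b = b' := Nat.eq_of_mul_eq_mul_right (by omega) h1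
    subst this
    exact hij rfl
  have h1 : (1 : ℝ) ≤ ((|(b * r' - b' * r - k * r * r' : ℤ)| : ℤ) : ℝ) := by
    exact_mod_cast Int.one_le_abs hne
  have hrr : (r : ℝ) * r' ≤ (D : ℝ) ^ 2 := by
    rw [sq]
    gcongr
  push_cast at h1 ⊢
  calc 1 / (D : ℝ) ^ 2 ≤ 1 / (r * r') := one_div_le_one_div_of_le (mul_pos hr hr') hrr
    _ ≤ _ := by gcongr

theorem stdAddChar_mul_eq_expTwoPi {q : ℕ} [NeZero q] (n : ℕ) (b : ZMod q) :
    ZMod.stdAddChar ((n : ZMod q) * b) = expTwoPi (n * ((b.val : ℝ) / q)) := by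
  have h : (n : ZMod q) * b = (((n * b.val : ℕ) : ℤ) : ZMod q) := by
    push_cast
    rw [ZMod.natCast_zmod_val]
  rw [h, ZMod.stdAddChar_coe, expTwoPi]
  congr 1
  push_cast
  ring

theorem sum_isUnit_zmod_eq {q : ℕ} [NeZero q] (F : ℕ → ℝ) :
    ∑ b : ZMod q with IsUnit b, F b.val = ∑ k ∈ Finset.range q with k.Coprime q, F k := by
  refine Finset.sum_nbij ZMod.val ?_ ?_ ?_ fun _ _ => rfl
  · intro b hb
    simp only [Finset.mem_filter, Finset.mem_univ, true_and, Finset.mem_range] at hb ⊢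
    refine ⟨ZMod.val_lt b, ?_⟩
    rwa [← ZMod.isUnit_iff_coprime, ZMod.natCast_zmod_val]
  · exact (ZMod.val_injective q).injOn
  · intro k hk
    simp only [Finset.coe_filter, Finset.mem_range, Set.mem_ofPred_eq] at hk
    refine ⟨(k : ZMod q), ?_, ZMod.val_cast_of_lt hk.1⟩
    simpa using (ZMod.isUnit_iff_coprime k q).2 hk.2

/-- The primitive characters modulo `r`. -/
noncomputable def primitiveChars (r : ℕ) : Finset (DirichletCharacter ℂ r) :=
  open Classical in Finset.univ.filter fun χ => χ.IsPrimitive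

theorem mem_primitiveChars {r : ℕ} {χ : DirichletCharacter ℂ r} :
    χ ∈ primitiveChars r ↔ χ.IsPrimitive := by
  classical
  simp [primitiveChars]

/-- The multiplicative large sieve inequality. -/
theorem multiplicative_large_sieve {D : ℕ} (hD : 0 < D) (a : ℕ → ℂ) (M N : ℕ) :
    ∑ r ∈ Finset.Icc 1 D, (r : ℝ) / r.totient * ∑ χ ∈ primitiveChars r,
        ‖∑ n ∈ Finset.Ioc M (M + N), a n * conj (χ (n : ZMod r))‖ ^ 2 ≤
      5 * ((N : ℝ) + (D : ℝ) ^ 2) * ∑ n ∈ Finset.Ioc M (M + N), ‖a n‖ ^ 2 := by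
  classical
  have h := (spacedModOne_fareyFractions D).large_sieve (by positivity) a M N
  rw [fareyFractions, Finset.sum_sigma] at h
  push_cast at h
  refine le_trans (Finset.sum_le_sum fun r hr => ?_) h
  have : NeZero r := ⟨by have := (Finset.mem_Icc.1 hr).1; omega⟩
  refine (sum_isPrimitive_norm_sq_le a (Finset.Ioc M (M + N))).trans (le_of_eq ?_)
  rw [← sum_isUnit_zmod_eq
    (fun k => ‖∑ n ∈ Finset.Ioc M (M + N), a n * expTwoPi (n * ((k : ℝ) / r))‖ ^ 2)]
  simp_rw [stdAddChar_mul_eq_expTwoPi]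

/-! ### Bilinear forms under a hyperbola -/

/-- A weighted finite family of functions satisfying a large sieve inequality on intervals. -/
def IsLargeSieveFamily {ι : Type*} (s : Finset ι) (w : ι → ℝ) (ψ : ι → ℕ → ℂ) (κ δ : ℝ) : Prop :=
  ∀ (a : ℕ → ℂ) (M N : ℕ), ∑ i ∈ s, w i * ‖∑ n ∈ Finset.Ioc M (M + N), a n * ψ i n‖ ^ 2 ≤
    κ * ((N : ℝ) + δ ^ 2) * ∑ n ∈ Finset.Ioc M (M + N), ‖a n‖ ^ 2

/-- The quantity bounding a bilinear form over an `u²` by `v²` rectangle. -/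
def rectBound (δ u v : ℝ) : ℝ := u ^ 2 * v ^ 2 + δ * (u ^ 2 * v + v ^ 2 * u) + δ ^ 2 * (u * v)

/-- Side lengths are written as squares so that the root from Cauchy–Schwarz becomes polynomial:
`√((t² + δ²) t²) ≤ (t + δ) t`. -/
theorem sqrt_mul_sqrt_le_rectBound {δ u v : ℝ} (hδ : 0 ≤ δ) (hu : 0 ≤ u) (hv : 0 ≤ v) :
    Real.sqrt ((u ^ 2 + δ ^ 2) * u ^ 2) * Real.sqrt ((v ^ 2 + δ ^ 2) * v ^ 2) ≤
      rectBound δ u v := by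
  have h : ∀ t : ℝ, 0 ≤ t → Real.sqrt ((t ^ 2 + δ ^ 2) * t ^ 2) ≤ (t + δ) * t := by
    intro t ht
    refine Real.sqrt_le_iff.2 ⟨by positivity, ?_⟩
    rw [mul_pow]
    refine mul_le_mul_of_nonneg_right ?_ (by positivity)
    nlinarith [mul_nonneg ht hδ]
  calc _ ≤ ((u + δ) * u) * ((v + δ) * v) :=
        mul_le_mul (h u hu) (h v hv) (Real.sqrt_nonneg _) (by positivity)
    _ = rectBound δ u v := by
        unfold rectBound
        ring

namespace IsLargeSieveFamily

variable {ι : Type*} {s : Finset ι} {w : ι → ℝ} {ψ : ι → ℕ → ℂ} {κ δ : ℝ}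

theorem sum_Ioc_le (h : IsLargeSieveFamily s w ψ κ δ) (hκ : 0 ≤ κ) {a : ℕ → ℂ}
    {A : ℝ} {M M' : ℕ} (hM : M ≤ M') (ha : ∀ n ∈ Finset.Ioc M M', ‖a n‖ ≤ A) {u : ℝ}
    (hu : ((M' - M : ℕ) : ℝ) = u ^ 2) :
    ∑ i ∈ s, w i * ‖∑ n ∈ Finset.Ioc M M', a n * ψ i n‖ ^ 2 ≤
      κ * A ^ 2 * ((u ^ 2 + δ ^ 2) * u ^ 2) := by
  have h1 := h a M (M' - M)
  rw [Nat.add_sub_cancel' hM, hu] at h1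
  have h2 : ∑ n ∈ Finset.Ioc M M', ‖a n‖ ^ 2 ≤ u ^ 2 * A ^ 2 := by
    rw [← hu]
    refine (Finset.sum_le_card_nsmul _ _ (A ^ 2) fun n hn => ?_).trans ?_
    · exact pow_le_pow_left₀ (norm_nonneg _) (ha n hn) 2
    · rw [Nat.card_Ioc, nsmul_eq_mul]
  refine h1.trans ((mul_le_mul_of_nonneg_left h2 (by positivity)).trans (le_of_eq ?_))
  ring

/-- Over a full rectangle the two variables separate: Cauchy–Schwarz over the weighted family, then
the large sieve in each variable. -/
theorem bilinear_rect_le (h : IsLargeSieveFamily s w ψ κ δ) (hκ : 0 ≤ κ) (hδ : 0 ≤ δ)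
    (hw : ∀ i ∈ s, 0 ≤ w i) {a b : ℕ → ℂ} {A B : ℝ} (hA : 0 ≤ A) (hB : 0 ≤ B)
    {M M' L L' : ℕ} (hM : M ≤ M') (hL : L ≤ L') (ha : ∀ n ∈ Finset.Ioc M M', ‖a n‖ ≤ A)
    (hb : ∀ n ∈ Finset.Ioc L L', ‖b n‖ ≤ B) {u v : ℝ} (hu0 : 0 ≤ u) (hv0 : 0 ≤ v)
    (hu : ((M' - M : ℕ) : ℝ) = u ^ 2) (hv : ((L' - L : ℕ) : ℝ) = v ^ 2) :
    ∑ i ∈ s, w i * ‖(∑ m ∈ Finset.Ioc M M', a m * ψ i m) * ∑ n ∈ Finset.Ioc L L', b n * ψ i n‖ ≤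
      κ * A * B * rectBound δ u v := by
  set X : ι → ℝ := fun i => ‖∑ m ∈ Finset.Ioc M M', a m * ψ i m‖
  set Y : ι → ℝ := fun i => ‖∑ n ∈ Finset.Ioc L L', b n * ψ i n‖
  have hX := h.sum_Ioc_le hκ hM ha hu
  have hY := h.sum_Ioc_le hκ hL hb hv
  have hCS := Finset.sum_mul_sq_le_sq_mul_sq s (fun i => Real.sqrt (w i) * X i)
    (fun i => Real.sqrt (w i) * Y i)
  have e1 : ∑ i ∈ s, (Real.sqrt (w i) * X i) * (Real.sqrt (w i) * Y i) =
      ∑ i ∈ s, w i * (X i * Y i) := by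
    refine Finset.sum_congr rfl fun i hi => ?_
    rw [mul_mul_mul_comm, Real.mul_self_sqrt (hw i hi)]
  have e2 : ∀ Z : ι → ℝ, ∑ i ∈ s, (Real.sqrt (w i) * Z i) ^ 2 = ∑ i ∈ s, w i * Z i ^ 2 := by
    intro Z
    refine Finset.sum_congr rfl fun i hi => ?_
    rw [mul_pow, Real.sq_sqrt (hw i hi)]
  rw [e1, e2, e2] at hCS
  have hbound : (∑ i ∈ s, w i * (X i * Y i)) ^ 2 ≤
      (κ * A * B * (Real.sqrt ((u ^ 2 + δ ^ 2) * u ^ 2) *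
        Real.sqrt ((v ^ 2 + δ ^ 2) * v ^ 2))) ^ 2 := by
    refine hCS.trans ((mul_le_mul hX hY ?_ (by positivity)).trans (le_of_eq ?_))
    · exact Finset.sum_nonneg fun i hi => mul_nonneg (hw i hi) (sq_nonneg _)
    · rw [mul_pow, mul_pow (Real.sqrt _), Real.sq_sqrt (by positivity),
        Real.sq_sqrt (by positivity)]
      ring
  have h3 := (abs_le_of_sq_le_sq' hbound (by positivity)).2
  simp_rw [norm_mul]
  refine h3.trans (mul_le_mul_of_nonneg_left (sqrt_mul_sqrt_le_rectBound hδ hu0 hv0) ?_)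
  positivity

theorem bilinear_rect_Ico_le (h : IsLargeSieveFamily s w ψ κ δ) (hκ : 0 ≤ κ) (hδ : 0 ≤ δ)
    (hw : ∀ i ∈ s, 0 ≤ w i) {a b : ℕ → ℂ} {A B : ℝ} (hA : 0 ≤ A) (hB : 0 ≤ B)
    (ha : ∀ n, ‖a n‖ ≤ A) {m k L L' : ℕ} (hm : 1 ≤ m) (hL : L ≤ L')
    (hb : ∀ n ∈ Finset.Ioc L L', ‖b n‖ ≤ B) {u v : ℝ} (hu0 : 0 ≤ u) (hv0 : 0 ≤ v)
    (hu : (k : ℝ) = u ^ 2) (hv : ((L' - L : ℕ) : ℝ) = v ^ 2) :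
    ∑ i ∈ s, w i * ‖(∑ m ∈ Finset.Ico m (m + k), a m * ψ i m) *
        ∑ n ∈ Finset.Ioc L L', b n * ψ i n‖ ≤
      κ * A * B * rectBound δ u v := by
  have e : Finset.Ico m (m + k) = Finset.Ioc (m - 1) (m - 1 + k) := by
    ext n
    simp only [Finset.mem_Ico, Finset.mem_Ioc]
    omega
  rw [e]
  refine h.bilinear_rect_le hκ hδ hw hA hB (by omega) hL (fun n _ => ha n) hb hu0 hv0 ?_ hv
  rw [Nat.add_sub_cancel_left, hu]

/-- The bound for a bilinear form over a staircase of width `u² = 2^j` and height `v²`. -/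
def stairBound (δ u v : ℝ) (j : ℕ) : ℝ :=
  u ^ 2 * v ^ 2 + 3 * δ * (u ^ 2 * v + v ^ 2 * u) + (j + 1) * δ ^ 2 * (u * v)

/-- The induction step for doubling the width of a staircase. Since `vL + vR ≤ √2 v`, the two middle
terms gain enough when `u²` doubles that the coefficient `3` also absorbs the rectangle. The last
term has no such room, because `u (vL + vR) ≤ √2 u v` may be sharp. It grows by one at each level,
hence the factor `j + 1`. -/
theorem rectBound_add_stairBound_le {δ u v vL vR : ℝ} (j : ℕ) (hδ : 0 ≤ δ) (hu : 0 ≤ u)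
    (hv : 0 ≤ v) (hvL : 0 ≤ vL) (h : v ^ 2 = vL ^ 2 + vR ^ 2) :
    rectBound δ u vR + stairBound δ u vL j + stairBound δ u vR j ≤
      stairBound δ (Real.sqrt 2 * u) v (j + 1) := by
  set r := Real.sqrt 2 with hr
  have hr2 : r ^ 2 = 2 := Real.sq_sqrt (by norm_num)
  have hr0 : 0 ≤ r := Real.sqrt_nonneg _
  have hr1 : 1.4 ≤ r := by
    rw [hr]
    exact Real.le_sqrt_of_sq_le (by norm_num)
  have hr1' : r ≤ 1.42 := by
    rw [hr]
    exact Real.sqrt_le_iff.2 ⟨by norm_num, by norm_num⟩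
  have hsum : vL + vR ≤ r * v := by
    refine abs_le_of_sq_le_sq' ?_ (by positivity) |>.2
    rw [mul_pow, hr2, h]
    nlinarith [sq_nonneg (vL - vR)]
  have hR : vR ≤ v := by
    refine abs_le_of_sq_le_sq' ?_ hv |>.2
    nlinarith [sq_nonneg vL]
  have t1 : u ^ 2 * vR ^ 2 + u ^ 2 * vL ^ 2 + u ^ 2 * vR ^ 2 ≤ (r * u) ^ 2 * v ^ 2 := by
    rw [mul_pow, hr2, h]
    nlinarith [mul_nonneg (sq_nonneg u) (sq_nonneg vL)]
  have t2 : u ^ 2 * vR + 3 * (u ^ 2 * vL) + 3 * (u ^ 2 * vR) ≤ 3 * ((r * u) ^ 2 * v) := by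
    rw [mul_pow, hr2]
    have h1 : vR + 3 * (vL + vR) ≤ 6 * v := by nlinarith
    nlinarith [mul_le_mul_of_nonneg_left h1 (sq_nonneg u)]
  have t3 : vR ^ 2 * u + 3 * (vL ^ 2 * u) + 3 * (vR ^ 2 * u) ≤ 3 * (v ^ 2 * (r * u)) := by
    have h1 : vR ^ 2 + 3 * (vL ^ 2 + vR ^ 2) ≤ 3 * r * v ^ 2 := by
      have h2 : vR ^ 2 ≤ v ^ 2 := by nlinarith [sq_nonneg vL]
      rw [← h]
      nlinarith [sq_nonneg v]
    nlinarith [mul_le_mul_of_nonneg_right h1 hu]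
  have t4 : u * vR + (j + 1) * (u * vL) + (j + 1) * (u * vR) ≤ (j + 1 + 1) * ((r * u) * v) := by
    have hj : (0 : ℝ) ≤ j := Nat.cast_nonneg j
    have h1 : vR ≤ r * v := by nlinarith
    have h2 : vR + (j + 1) * (vL + vR) ≤ (j + 1 + 1) * (r * v) := by
      have := mul_le_mul_of_nonneg_left hsum (by positivity : (0 : ℝ) ≤ j + 1)
      linarith
    nlinarith [mul_le_mul_of_nonneg_left h2 hu]
  have t23 := mul_le_mul_of_nonneg_left (add_le_add t2 t3) hδ
  have t4' := mul_le_mul_of_nonneg_left t4 (sq_nonneg δ)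
  unfold rectBound stairBound
  push_cast
  linarith

/-- Bilinear forms over the staircase region between `y (m + 2^j)` and an antitone `y`. -/
theorem bilinear_stair_le (h : IsLargeSieveFamily s w ψ κ δ) (hκ : 0 ≤ κ) (hδ : 0 ≤ δ)
    (hw : ∀ i ∈ s, 0 ≤ w i) {a b : ℕ → ℂ} {A B : ℝ} (hA : 0 ≤ A) (hB : 0 ≤ B)
    (ha : ∀ n, ‖a n‖ ≤ A) {y : ℕ → ℕ} (hy : ∀ m n, 1 ≤ m → m ≤ n → y n ≤ y m)
    {Y : ℕ} (hyY : ∀ m, y m ≤ Y) (hb : ∀ n ≤ Y, ‖b n‖ ≤ B) (j : ℕ) :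
    ∀ (m₀ : ℕ), 1 ≤ m₀ → ∀ v : ℝ, 0 ≤ v → ((y m₀ - y (m₀ + 2 ^ j) : ℕ) : ℝ) = v ^ 2 →
    ∑ i ∈ s, w i * ‖∑ m ∈ Finset.Ico m₀ (m₀ + 2 ^ j), a m * ψ i m *
        ∑ n ∈ Finset.Ioc (y (m₀ + 2 ^ j)) (y m), b n * ψ i n‖ ≤
      κ * A * B * stairBound δ (Real.sqrt 2 ^ j) v j := by
  induction j with
  | zero =>
    intro m₀ hm₀ v hv0 hv
    have h1 := h.bilinear_rect_Ico_le hκ hδ hw hA hB ha hm₀ (k := 1) (u := 1)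
      (hy m₀ (m₀ + 1) hm₀ (by omega))
      (fun n hn => hb n ((Finset.mem_Ioc.1 hn).2.trans (hyY _))) (by norm_num) hv0 (by norm_num)
      hv
    simp only [pow_zero, Nat.Ico_succ_singleton, Finset.sum_singleton] at h1 ⊢
    refine h1.trans (mul_le_mul_of_nonneg_left ?_ (by positivity))
    unfold rectBound stairBound
    have : 0 ≤ δ * (1 ^ 2 * v + v ^ 2 * 1) := by positivity
    push_cast
    linarith
  | succ j ih =>
    intro m₀ hm₀ v hv0 hv
    have e2 : m₀ + 2 ^ (j + 1) = m₀ + 2 ^ j + 2 ^ j := by ring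
    have hpow : 0 < 2 ^ j := by positivity
    have hyR : y (m₀ + 2 ^ j + 2 ^ j) ≤ y (m₀ + 2 ^ j) := hy _ _ (by omega) (by omega)
    have hyL : y (m₀ + 2 ^ j) ≤ y m₀ := hy _ _ (by omega) (by omega)
    rw [e2] at hv ⊢
    set vL := Real.sqrt ((y m₀ - y (m₀ + 2 ^ j) : ℕ) : ℝ) with hvL
    set vR := Real.sqrt ((y (m₀ + 2 ^ j) - y (m₀ + 2 ^ j + 2 ^ j) : ℕ) : ℝ) with hvR
    have hvL2 : ((y m₀ - y (m₀ + 2 ^ j) : ℕ) : ℝ) = vL ^ 2 :=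
      (Real.sq_sqrt (Nat.cast_nonneg _)).symm
    have hvR2 : ((y (m₀ + 2 ^ j) - y (m₀ + 2 ^ j + 2 ^ j) : ℕ) : ℝ) = vR ^ 2 :=
      (Real.sq_sqrt (Nat.cast_nonneg _)).symm
    have hvv : v ^ 2 = vL ^ 2 + vR ^ 2 := by
      rw [← hv, ← hvL2, ← hvR2, ← Nat.cast_add]
      congr 1
      omega
    have hrect := h.bilinear_rect_Ico_le hκ hδ hw hA hB ha hm₀ (k := 2 ^ j) (u := Real.sqrt 2 ^ j)
      hyR (fun n hn => hb n ((Finset.mem_Ioc.1 hn).2.trans (hyY _))) (by positivity)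
      (Real.sqrt_nonneg _)
      (by rw [← pow_mul, mul_comm, pow_mul, Real.sq_sqrt (by norm_num)]; push_cast; rfl) hvR2
    have hL := ih m₀ hm₀ vL (Real.sqrt_nonneg _) hvL2
    have hR := ih (m₀ + 2 ^ j) (by omega) vR (Real.sqrt_nonneg _) hvR2
    -- As `y` is antitone, every column of the left half is full up to height `y (m₀ + 2 ^ j)`,
    -- which gives a rectangle. Above it sits a staircase over the left half. The right half is a
    -- staircase over the old base.
    have hsplit : ∀ i, (∑ m ∈ Finset.Ico m₀ (m₀ + 2 ^ j + 2 ^ j), a m * ψ i m *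
        ∑ n ∈ Finset.Ioc (y (m₀ + 2 ^ j + 2 ^ j)) (y m), b n * ψ i n) =
        (∑ m ∈ Finset.Ico m₀ (m₀ + 2 ^ j), a m * ψ i m) *
          (∑ n ∈ Finset.Ioc (y (m₀ + 2 ^ j + 2 ^ j)) (y (m₀ + 2 ^ j)), b n * ψ i n) +
        (∑ m ∈ Finset.Ico m₀ (m₀ + 2 ^ j), a m * ψ i m *
          ∑ n ∈ Finset.Ioc (y (m₀ + 2 ^ j)) (y m), b n * ψ i n) +
        (∑ m ∈ Finset.Ico (m₀ + 2 ^ j) (m₀ + 2 ^ j + 2 ^ j), a m * ψ i m *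
          ∑ n ∈ Finset.Ioc (y (m₀ + 2 ^ j + 2 ^ j)) (y m), b n * ψ i n) := by
      intro i
      rw [← Finset.sum_Ico_consecutive _ (Nat.le_add_right m₀ (2 ^ j))
        (Nat.le_add_right (m₀ + 2 ^ j) (2 ^ j)), Finset.sum_mul, ← Finset.sum_add_distrib]
      congr 1
      refine Finset.sum_congr rfl fun m hm => ?_
      rw [← mul_add, Finset.sum_Ioc_consecutive _ hyR]
      have := Finset.mem_Ico.1 hm
      exact hy _ _ (by omega) (by omega)
    have htri : ∀ i ∈ s, w i * ‖∑ m ∈ Finset.Ico m₀ (m₀ + 2 ^ j + 2 ^ j), a m * ψ i m *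
        ∑ n ∈ Finset.Ioc (y (m₀ + 2 ^ j + 2 ^ j)) (y m), b n * ψ i n‖ ≤
        w i * ‖(∑ m ∈ Finset.Ico m₀ (m₀ + 2 ^ j), a m * ψ i m) *
          (∑ n ∈ Finset.Ioc (y (m₀ + 2 ^ j + 2 ^ j)) (y (m₀ + 2 ^ j)), b n * ψ i n)‖ +
        w i * ‖∑ m ∈ Finset.Ico m₀ (m₀ + 2 ^ j), a m * ψ i m *
          ∑ n ∈ Finset.Ioc (y (m₀ + 2 ^ j)) (y m), b n * ψ i n‖ +
        w i * ‖∑ m ∈ Finset.Ico (m₀ + 2 ^ j) (m₀ + 2 ^ j + 2 ^ j), a m * ψ i m *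
          ∑ n ∈ Finset.Ioc (y (m₀ + 2 ^ j + 2 ^ j)) (y m), b n * ψ i n‖ := by
      intro i hi
      rw [hsplit, ← mul_add, ← mul_add]
      exact mul_le_mul_of_nonneg_left norm_add₃_le (hw i hi)
    refine (Finset.sum_le_sum htri).trans ?_
    rw [Finset.sum_add_distrib, Finset.sum_add_distrib]
    refine (add_le_add (add_le_add hrect hL) hR).trans ?_
    rw [← mul_add, ← mul_add, pow_succ']
    exact mul_le_mul_of_nonneg_left (rectBound_add_stairBound_le j hδ (by positivity) hv0
      (Real.sqrt_nonneg _) hvv) (by positivity)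

theorem rectBound_mono {δ u v v' : ℝ} (hδ : 0 ≤ δ) (hu : 0 ≤ u) (hv : 0 ≤ v) (h : v ≤ v') :
    rectBound δ u v ≤ rectBound δ u v' := by
  unfold rectBound
  gcongr

theorem stairBound_mono {δ u v v' : ℝ} (j : ℕ) (hδ : 0 ≤ δ) (hu : 0 ≤ u) (hv : 0 ≤ v)
    (h : v ≤ v') : stairBound δ u v j ≤ stairBound δ u v' j := by
  unfold stairBound
  gcongr

/-- Bilinear forms over the part of the hyperbolic region `mn ≤ N` with `2^i ≤ m < 2^(i+1)`. -/
theorem bilinear_dyadic_le (h : IsLargeSieveFamily s w ψ κ δ) (hκ : 0 ≤ κ) (hδ : 0 ≤ δ)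
    (hw : ∀ i ∈ s, 0 ≤ w i) {a b : ℕ → ℂ} {A B : ℝ} (hA : 0 ≤ A) (hB : 0 ≤ B)
    (ha : ∀ n, ‖a n‖ ≤ A) {N : ℕ} (hb : ∀ n ≤ N, ‖b n‖ ≤ B) (j : ℕ) :
    ∑ i ∈ s, w i * ‖∑ m ∈ Finset.Ico (2 ^ j) (2 ^ (j + 1)), a m * ψ i m *
        ∑ n ∈ Finset.Ioc 0 (N / m), b n * ψ i n‖ ≤
      κ * A * B * (2 * N + 4 * δ * (Real.sqrt 2 ^ j * Real.sqrt N + N / Real.sqrt 2 ^ j) +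
        (j + 2) * δ ^ 2 * Real.sqrt N) := by
  set r := Real.sqrt 2 with hr
  have hr2 : r ^ 2 = 2 := Real.sq_sqrt (by norm_num)
  have hr0 : 0 < r := by positivity
  have hy : ∀ m n, 1 ≤ m → m ≤ n → N / n ≤ N / m := fun m n hm hmn =>
    Nat.div_le_div_left hmn hm
  have e2 : 2 ^ (j + 1) = 2 ^ j + 2 ^ j := by ring
  rw [e2]
  have hpos : 1 ≤ 2 ^ j := Nat.one_le_two_pow
  have hrj : (r ^ j) ^ 2 = 2 ^ j := by rw [← pow_mul, mul_comm, pow_mul, hr2]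
  -- Here `v² = N / 2^j` dominates both the height of the rectangle below and that of the staircase.
  set v := Real.sqrt N / r ^ j with hv
  have hv2 : v ^ 2 = N / 2 ^ j := by
    rw [hv, div_pow, hrj, Real.sq_sqrt (Nat.cast_nonneg N)]
  set v1 := Real.sqrt ((N / (2 ^ j + 2 ^ j) - 0 : ℕ) : ℝ) with hv1
  set v2 := Real.sqrt ((N / 2 ^ j - N / (2 ^ j + 2 ^ j) : ℕ) : ℝ) with hv2'
  have hdiv : ((N / 2 ^ j : ℕ) : ℝ) ≤ N / 2 ^ j := by
    have := Nat.cast_div_le (α := ℝ) (m := N) (n := 2 ^ j)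
    push_cast at this
    exact this
  have hv0 : 0 ≤ v := by positivity
  have hv1v : v1 ≤ v := by
    refine Real.sqrt_le_iff.2 ⟨hv0, ?_⟩
    rw [hv2]
    refine le_trans ?_ hdiv
    rw [Nat.sub_zero]
    exact_mod_cast hy _ _ hpos (by omega)
  have hv2v : v2 ≤ v := by
    refine Real.sqrt_le_iff.2 ⟨hv0, ?_⟩
    rw [hv2]
    refine le_trans ?_ hdiv
    exact_mod_cast Nat.sub_le _ _
  have hrect := h.bilinear_rect_Ico_le hκ hδ hw hA hB ha hpos (k := 2 ^ j) (u := r ^ j)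
    (Nat.zero_le (N / (2 ^ j + 2 ^ j)))
    (fun n hn => hb n ((Finset.mem_Ioc.1 hn).2.trans (Nat.div_le_self _ _))) (by positivity)
    (Real.sqrt_nonneg _) (by rw [hrj]; push_cast; rfl) (Real.sq_sqrt (Nat.cast_nonneg _)).symm
  have hstair := h.bilinear_stair_le hκ hδ hw hA hB ha hy (Y := N) (fun m => Nat.div_le_self _ _)
    hb j (2 ^ j) hpos v2 (Real.sqrt_nonneg _) (Real.sq_sqrt (Nat.cast_nonneg _)).symm
  -- The block is cut at height `N / 2^(j+1)`: a full rectangle below, a staircase above.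
  have htri : ∀ i ∈ s, w i * ‖∑ m ∈ Finset.Ico (2 ^ j) (2 ^ j + 2 ^ j), a m * ψ i m *
        ∑ n ∈ Finset.Ioc 0 (N / m), b n * ψ i n‖ ≤
      w i * ‖(∑ m ∈ Finset.Ico (2 ^ j) (2 ^ j + 2 ^ j), a m * ψ i m) *
        ∑ n ∈ Finset.Ioc 0 (N / (2 ^ j + 2 ^ j)), b n * ψ i n‖ +
      w i * ‖∑ m ∈ Finset.Ico (2 ^ j) (2 ^ j + 2 ^ j), a m * ψ i m *
        ∑ n ∈ Finset.Ioc (N / (2 ^ j + 2 ^ j)) (N / m), b n * ψ i n‖ := by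
    intro i hi
    rw [← mul_add]
    refine mul_le_mul_of_nonneg_left (le_trans (le_of_eq ?_) (norm_add_le _ _)) (hw i hi)
    rw [Finset.sum_mul, ← Finset.sum_add_distrib]
    refine congrArg _ (Finset.sum_congr rfl fun m hm => ?_)
    have := Finset.mem_Ico.1 hm
    rw [← mul_add, Finset.sum_Ioc_consecutive _ (Nat.zero_le _) (hy _ _ (by omega) (by omega))]
  refine (Finset.sum_le_sum htri).trans ?_
  rw [Finset.sum_add_distrib]
  refine (add_le_add hrect hstair).trans ?_
  rw [← mul_add]
  refine mul_le_mul_of_nonneg_left ?_ (by positivity)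
  refine (add_le_add (rectBound_mono hδ (by positivity) (Real.sqrt_nonneg _) hv1v)
    (stairBound_mono j hδ (by positivity) (Real.sqrt_nonneg _) hv2v)).trans (le_of_eq ?_)
  have f1 : (r ^ j) ^ 2 * v ^ 2 = N := by
    rw [hv, div_pow, mul_div_cancel₀ _ (by positivity), Real.sq_sqrt (Nat.cast_nonneg N)]
  have f2 : (r ^ j) ^ 2 * v = r ^ j * Real.sqrt N := by
    rw [hv]
    field_simp
  have f3 : v ^ 2 * r ^ j = N / r ^ j := by
    rw [hv, div_pow, Real.sq_sqrt (Nat.cast_nonneg N)]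
    field_simp
  have f4 : r ^ j * v = Real.sqrt N := by
    rw [hv]
    field_simp
  unfold rectBound stairBound
  rw [f1, f2, f3, f4]
  ring

end IsLargeSieveFamily

theorem sum_pow_le_of_forall_pow_le {r Z : ℝ} (hr : 1 < r) (hZ : 0 ≤ Z) (S : Finset ℕ)
    (hS : ∀ i ∈ S, r ^ i ≤ Z) : ∑ i ∈ S, r ^ i ≤ r / (r - 1) * Z := by
  rcases S.eq_empty_or_nonempty with rfl | hne
  · have : 0 < r - 1 := by linarith
    simp only [Finset.sum_empty]
    positivity
  · have hk := hS _ (S.max'_mem hne)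
    set k := S.max' hne
    have hsub : S ⊆ Finset.range (k + 1) := fun i hi =>
      Finset.mem_range.2 (Nat.lt_succ_of_le (S.le_max' i hi))
    have hr1 : 0 < r - 1 := by linarith
    have h1 : ∑ i ∈ S, r ^ i ≤ ∑ i ∈ Finset.range (k + 1), r ^ i :=
      Finset.sum_le_sum_of_subset_of_nonneg hsub fun _ _ _ => by positivity
    rw [geom_sum_eq hr.ne'] at h1
    refine h1.trans ?_
    rw [div_mul_eq_mul_div]
    refine div_le_div_of_nonneg_right ?_ hr1.le
    rw [pow_succ']
    nlinarith

theorem sum_inv_pow_le_of_forall_inv_pow_le {r Z : ℝ} (hr : 1 < r) (hZ : 0 ≤ Z) (S : Finset ℕ)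
    (hS : ∀ i ∈ S, 1 / r ^ i ≤ Z) : ∑ i ∈ S, 1 / r ^ i ≤ r / (r - 1) * Z := by
  set k := S.sup id with hk
  have hle : ∀ i ∈ S, i ≤ k := fun i hi => Finset.le_sup (f := id) hi
  have hr0 : 0 < r := by linarith
  have hterm : ∀ i ∈ S, 1 / r ^ i = r ^ (k - i) / r ^ k := by
    intro i hi
    rw [div_eq_div_iff (by positivity) (by positivity), one_mul, ← pow_add,
      Nat.sub_add_cancel (hle i hi)]
  have hinj : Set.InjOn (fun i => k - i) S := by
    intro i hi j hj hij
    have := hle i hi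
    have := hle j hj
    simp only at hij
    omega
  have h1 := sum_pow_le_of_forall_pow_le hr (Z := Z * r ^ k) (by positivity)
    (S.image fun i => k - i) (by
      intro l hl
      obtain ⟨i, hi, rfl⟩ := Finset.mem_image.1 hl
      have := hS i hi
      rw [hterm i hi, div_le_iff₀ (by positivity)] at this
      exact this)
  rw [Finset.sum_image hinj] at h1
  rw [Finset.sum_congr rfl hterm, ← Finset.sum_div, div_le_iff₀ (by positivity)]
  linarith

theorem sum_Ico_two_pow {M : Type*} [AddCommMonoid M] (F : ℕ → M) (K : ℕ) :
    ∑ m ∈ Finset.Ico 1 (2 ^ K), F m =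
      ∑ j ∈ Finset.range K, ∑ m ∈ Finset.Ico (2 ^ j) (2 ^ (j + 1)), F m := by
  induction K with
  | zero => simp
  | succ K ih =>
    rw [Finset.sum_range_succ, ← ih, Finset.sum_Ico_consecutive _ Nat.one_le_two_pow
      (Nat.pow_le_pow_right (by norm_num) (Nat.le_succ K))]

/-- The dyadic bounds are summed over `j`. The main term is the same for every block and costs the
factor `K`. The terms in `2^(±j/2)` form geometric sums governed by the extreme blocks, and the
supports beyond `U` and `V` limit these, whence the savings `1/√U` and `1/√V`. -/
theorem IsLargeSieveFamily.bilinear_hyperbola_le {ι : Type*} {s : Finset ι} {w : ι → ℝ}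
    {ψ : ι → ℕ → ℂ} {κ δ : ℝ} (h : IsLargeSieveFamily s w ψ κ δ) (hκ : 0 ≤ κ) (hδ : 0 ≤ δ)
    (hw : ∀ i ∈ s, 0 ≤ w i) {a b : ℕ → ℂ} {A B : ℝ} (hA : 0 ≤ A) (hB : 0 ≤ B)
    (ha : ∀ n, ‖a n‖ ≤ A) {N : ℕ} (hb : ∀ n ≤ N, ‖b n‖ ≤ B) {U V : ℝ} (hU : 0 < U) (hV : 0 < V)
    (haU : ∀ m : ℕ, (m : ℝ) ≤ U → a m = 0) (hbV : ∀ n : ℕ, (n : ℝ) ≤ V → b n = 0) {K : ℕ}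
    (hK : K = Nat.log 2 N + 1) :
    ∑ i ∈ s, w i * ‖∑ m ∈ Finset.Ioc 0 N, a m * ψ i m * ∑ n ∈ Finset.Ioc 0 (N / m), b n * ψ i n‖ ≤
      κ * A * B * (2 * N * K + 20 * δ * N * (1 / Real.sqrt U + 1 / Real.sqrt V) +
        2 * K ^ 2 * δ ^ 2 * Real.sqrt N) := by
  classical
  set r := Real.sqrt 2 with hr
  have hr2 : r ^ 2 = 2 := Real.sq_sqrt (by norm_num)
  have hr1 : 1.41 ≤ r := by
    rw [hr]
    exact Real.le_sqrt_of_sq_le (by norm_num)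
  have hr1' : r ≤ 1.42 := by
    rw [hr]
    exact Real.sqrt_le_iff.2 ⟨by norm_num, by norm_num⟩
  have hr0 : 0 < r := by linarith
  have hrr : r / (r - 1) ≤ 3.5 := by
    rw [div_le_iff₀ (by linarith)]
    linarith
  have hrj : ∀ j : ℕ, (r ^ j) ^ 2 = 2 ^ j := fun j => by rw [← pow_mul, mul_comm, pow_mul, hr2]
  have hNK : N < 2 ^ K := by
    rw [hK]
    exact Nat.lt_pow_succ_log_self (by norm_num) N
  set G : ι → ℕ → ℂ := fun i m => a m * ψ i m * ∑ n ∈ Finset.Ioc 0 (N / m), b n * ψ i n with hG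
  have hext : ∀ i, ∑ m ∈ Finset.Ioc 0 N, G i m = ∑ m ∈ Finset.Ico 1 (2 ^ K), G i m := by
    intro i
    refine Finset.sum_subset ?_ ?_
    · intro m hm
      have := Finset.mem_Ioc.1 hm
      exact Finset.mem_Ico.2 ⟨by omega, by omega⟩
    · intro m hm hm'
      have h1 := Finset.mem_Ico.1 hm
      have h2 : N < m := by
        by_contra hc
        exact hm' (Finset.mem_Ioc.2 ⟨by omega, by omega⟩)
      simp [hG, Nat.div_eq_of_lt h2]
  -- The blocks that can be nonzero: some `m` of the block exceeds `U`, and the longest inner sum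
  -- reaches past `V`.
  set S := (Finset.range K).filter fun j => U < 2 ^ (j + 1) ∧ V < N / 2 ^ j with hS
  have hzero : ∀ j ∈ Finset.range K, j ∉ S → ∀ i,
      ∑ m ∈ Finset.Ico (2 ^ j) (2 ^ (j + 1)), G i m = 0 := by
    intro j hj hjS i
    refine Finset.sum_eq_zero fun m hm => ?_
    have hm' := Finset.mem_Ico.1 hm
    have hc : ¬ (U < 2 ^ (j + 1) ∧ V < N / 2 ^ j) := fun hc =>
      hjS (Finset.mem_filter.2 ⟨hj, hc⟩)
    rw [not_and_or, not_lt, not_lt] at hc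
    rcases hc with hc | hc
    · have : a m = 0 := haU m (le_trans (by exact_mod_cast hm'.2.le) hc)
      simp [hG, this]
    · have : ∑ n ∈ Finset.Ioc 0 (N / m), b n * ψ i n = 0 := by
        refine Finset.sum_eq_zero fun n hn => ?_
        have h1 := (Finset.mem_Ioc.1 hn).2
        rw [hbV n, zero_mul]
        refine le_trans ?_ hc
        have h2 : n ≤ N / 2 ^ j := h1.trans (Nat.div_le_div_left hm'.1 (by positivity))
        calc (n : ℝ) ≤ ((N / 2 ^ j : ℕ) : ℝ) := by exact_mod_cast h2
          _ ≤ (N : ℝ) / ((2 ^ j : ℕ) : ℝ) := Nat.cast_div_le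
          _ = N / 2 ^ j := by push_cast; rfl
      simp [hG, this]
  have hsplit : ∀ i, ∑ m ∈ Finset.Ioc 0 N, G i m =
      ∑ j ∈ S, ∑ m ∈ Finset.Ico (2 ^ j) (2 ^ (j + 1)), G i m := by
    intro i
    rw [hext, sum_Ico_two_pow]
    exact (Finset.sum_subset (Finset.filter_subset _ _) fun j hj hjS => hzero j hj hjS i).symm
  have hmain : ∑ i ∈ s, w i * ‖∑ m ∈ Finset.Ioc 0 N, G i m‖ ≤
      ∑ j ∈ S, κ * A * B * (2 * N + 4 * δ * (r ^ j * Real.sqrt N + N / r ^ j) +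
        (j + 2) * δ ^ 2 * Real.sqrt N) := by
    calc _ ≤ ∑ i ∈ s, ∑ j ∈ S, w i * ‖∑ m ∈ Finset.Ico (2 ^ j) (2 ^ (j + 1)), G i m‖ := by
          refine Finset.sum_le_sum fun i hi => ?_
          rw [hsplit, ← Finset.mul_sum]
          exact mul_le_mul_of_nonneg_left (norm_sum_le _ _) (hw i hi)
      _ ≤ _ := by
          rw [Finset.sum_comm]
          exact Finset.sum_le_sum fun j _ => h.bilinear_dyadic_le hκ hδ hw hA hB ha hb j
  refine hmain.trans ?_
  rw [← Finset.mul_sum]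
  refine mul_le_mul_of_nonneg_left ?_ (by positivity)
  have hsN : 0 ≤ Real.sqrt N := Real.sqrt_nonneg _
  have g1 : ∑ j ∈ S, r ^ j ≤ 3.5 * (Real.sqrt N / Real.sqrt V) := by
    refine (sum_pow_le_of_forall_pow_le (Z := Real.sqrt N / Real.sqrt V) (by linarith)
      (by positivity) S fun j hj => ?_).trans (mul_le_mul_of_nonneg_right hrr (by positivity))
    have h1 := (Finset.mem_filter.1 hj).2.2
    rw [← Real.sqrt_div' _ hV.le]
    refine Real.le_sqrt_of_sq_le ?_
    rw [hrj, le_div_iff₀ hV]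
    rw [lt_div_iff₀ (by positivity)] at h1
    linarith
  have g2 : ∑ j ∈ S, 1 / r ^ j ≤ 3.5 * (r / Real.sqrt U) := by
    refine (sum_inv_pow_le_of_forall_inv_pow_le (Z := r / Real.sqrt U) (by linarith)
      (by positivity) S fun j hj => ?_).trans (mul_le_mul_of_nonneg_right hrr (by positivity))
    have h1 := (Finset.mem_filter.1 hj).2.1
    rw [div_le_div_iff₀ (by positivity) (by positivity), one_mul, ← pow_succ']
    refine Real.sqrt_le_iff.2 ⟨by positivity, ?_⟩
    rw [hrj]
    exact h1.le
  have hcard : (S.card : ℝ) ≤ K := by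
    exact_mod_cast (Finset.card_filter_le _ _).trans (Finset.card_range K).le
  have g3 : ∑ j ∈ S, ((j : ℝ) + 2) ≤ 2 * K ^ 2 := by
    have hK1 : (1 : ℝ) ≤ K := by
      have : 1 ≤ K := by omega
      exact_mod_cast this
    calc ∑ j ∈ S, ((j : ℝ) + 2) ≤ ∑ j ∈ S, (2 * K : ℝ) := by
          refine Finset.sum_le_sum fun j hj => ?_
          have : j + 1 ≤ K := Finset.mem_range.1 (Finset.mem_filter.1 hj).1
          have : (j : ℝ) + 1 ≤ K := by exact_mod_cast this
          linarith
      _ = S.card * (2 * K) := by rw [Finset.sum_const, nsmul_eq_mul]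
      _ ≤ K * (2 * K) := by gcongr
      _ = _ := by ring
  have e : ∑ j ∈ S, (2 * N + 4 * δ * (r ^ j * Real.sqrt N + N / r ^ j) +
        (j + 2) * δ ^ 2 * Real.sqrt N) =
      2 * N * S.card + 4 * δ * ((∑ j ∈ S, r ^ j) * Real.sqrt N + N * ∑ j ∈ S, 1 / r ^ j) +
        (∑ j ∈ S, ((j : ℝ) + 2)) * (δ ^ 2 * Real.sqrt N) := by
    rw [Finset.sum_add_distrib, Finset.sum_add_distrib, Finset.sum_const, nsmul_eq_mul,
      ← Finset.mul_sum, Finset.sum_add_distrib, Finset.sum_mul, Finset.mul_sum, Finset.sum_mul]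
    congr 1
    · congr 1
      · ring
      · congr 2
        exact Finset.sum_congr rfl fun j _ => by ring
    · exact Finset.sum_congr rfl fun j _ => by ring
  rw [e]
  have hN : (0 : ℝ) ≤ N := Nat.cast_nonneg N
  have k1 : 2 * (N : ℝ) * S.card ≤ 2 * N * K := by gcongr
  have k2 : (∑ j ∈ S, r ^ j) * Real.sqrt N + N * ∑ j ∈ S, 1 / r ^ j ≤
      5 * N * (1 / Real.sqrt U + 1 / Real.sqrt V) := by
    have hVN : (∑ j ∈ S, r ^ j) * Real.sqrt N ≤ 3.5 * N * (1 / Real.sqrt V) := by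
      refine (mul_le_mul_of_nonneg_right g1 hsN).trans (le_of_eq ?_)
      rw [mul_assoc, div_mul_eq_mul_div, Real.mul_self_sqrt hN]
      ring
    have hUN : N * ∑ j ∈ S, 1 / r ^ j ≤ 5 * N * (1 / Real.sqrt U) := by
      refine (mul_le_mul_of_nonneg_left g2 hN).trans ?_
      have h1 : (N : ℝ) * (3.5 * (r / Real.sqrt U)) = (3.5 * r) * (N * (1 / Real.sqrt U)) := by ring
      have h2 : 5 * (N : ℝ) * (1 / Real.sqrt U) = 5 * (N * (1 / Real.sqrt U)) := by ring
      rw [h1, h2]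
      exact mul_le_mul_of_nonneg_right (by linarith) (by positivity)
    have : 0 ≤ (N : ℝ) * (1 / Real.sqrt V) := by positivity
    nlinarith
  have k2' := mul_le_mul_of_nonneg_left k2 (by positivity : 0 ≤ 4 * δ)
  have k3 := mul_le_mul_of_nonneg_right g3 (by positivity : 0 ≤ δ ^ 2 * Real.sqrt N)
  linarith

theorem isLargeSieveFamily_primitiveChars {D : ℕ} (hD : 0 < D) (T : Finset ℕ)
    (hT : T ⊆ Finset.Icc 1 D) :
    IsLargeSieveFamily (T.sigma primitiveChars) (fun p => (p.1 : ℝ) / p.1.totient)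
      (fun p n => conj (p.2 (n : ZMod p.1))) 5 D := by
  intro a M N
  refine le_trans ?_ (multiplicative_large_sieve hD a M N)
  rw [Finset.sum_sigma]
  simp only
  simp_rw [← Finset.mul_sum]
  exact Finset.sum_le_sum_of_subset_of_nonneg hT fun _ _ _ => by positivity

/-- Bilinear forms twisted by primitive characters of conductor larger than `R`, on average. -/
theorem sum_primitiveChars_bilinear_le {a b : ℕ → ℂ} {A B : ℝ} (hA : 0 ≤ A) (hB : 0 ≤ B)
    (ha : ∀ n, ‖a n‖ ≤ A) {N : ℕ} (hb : ∀ n ≤ N, ‖b n‖ ≤ B) {U V : ℝ} (hU : 0 < U) (hV : 0 < V)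
    (haU : ∀ m : ℕ, (m : ℝ) ≤ U → a m = 0) (hbV : ∀ n : ℕ, (n : ℝ) ≤ V → b n = 0) {K L Q : ℕ}
    (hK : K = Nat.log 2 N + 1) (hL : L = Nat.log 2 Q + 1) {R : ℝ} (hR : 0 < R) :
    ∑ r ∈ Finset.Icc 1 Q with R < ((r : ℕ) : ℝ), 1 / (r.totient : ℝ) * ∑ χ ∈ primitiveChars r,
        ‖∑ m ∈ Finset.Ioc 0 N, a m * conj (χ (m : ZMod r)) *
          ∑ n ∈ Finset.Ioc 0 (N / m), b n * conj (χ (n : ZMod r))‖ ≤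
      5 * A * B * (8 * N * K / R + 40 * L * N * (1 / Real.sqrt U + 1 / Real.sqrt V) +
        16 * K ^ 2 * Q * Real.sqrt N) := by
  classical
  set T := (Finset.Icc 1 Q).filter fun r => R < ((r : ℕ) : ℝ) with hT
  set F : ℕ → ℝ := fun r => ∑ χ ∈ primitiveChars r,
        ‖∑ m ∈ Finset.Ioc 0 N, a m * conj (χ (m : ZMod r)) *
          ∑ n ∈ Finset.Ioc 0 (N / m), b n * conj (χ (n : ZMod r))‖ with hF
  have hF0 : ∀ r, 0 ≤ F r := fun r => by positivity
  set J := (Finset.range L).filter fun j => R < 2 ^ (j + 1) ∧ 2 ^ j ≤ Q with hJ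
  have hmaps : ∀ r ∈ T, Nat.log 2 r ∈ J := by
    intro r hr
    simp only [hT, Finset.mem_filter, Finset.mem_Icc] at hr
    simp only [hJ, Finset.mem_filter, Finset.mem_range]
    refine ⟨?_, ?_, ?_⟩
    · rw [hL]
      exact Nat.lt_succ_of_le (Nat.log_mono_right hr.1.2)
    · refine hr.2.trans ?_
      exact_mod_cast Nat.lt_pow_succ_log_self (by norm_num) r
    · exact (Nat.pow_log_le_self 2 (by omega)).trans hr.1.2
  have hblock : ∀ j ∈ J, ∑ r ∈ T with Nat.log 2 r = j, 1 / (r.totient : ℝ) * F r ≤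
      5 * A * B * (2 * N * K * (1 / 2 ^ j) + 40 * N * (1 / Real.sqrt U + 1 / Real.sqrt V) +
        8 * K ^ 2 * Real.sqrt N * 2 ^ j) := by
    intro j _
    have hr : ∀ r ∈ T.filter (fun r => Nat.log 2 r = j), 2 ^ j ≤ r ∧ r < 2 ^ (j + 1) := by
      intro r hr
      simp only [hT, Finset.mem_filter, Finset.mem_Icc] at hr
      rw [← hr.2]
      exact ⟨Nat.pow_log_le_self 2 (by omega), Nat.lt_pow_succ_log_self (by norm_num) r⟩
    have hfam := isLargeSieveFamily_primitiveChars (D := 2 ^ (j + 1)) (by positivity)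
      (T.filter fun r => Nat.log 2 r = j) (fun r h => Finset.mem_Icc.2
        ⟨le_trans Nat.one_le_two_pow (hr r h).1, (hr r h).2.le⟩)
    have hbil := hfam.bilinear_hyperbola_le (by norm_num) (by positivity)
      (fun p _ => by positivity) hA hB ha hb hU hV haU hbV hK
    rw [Finset.sum_sigma] at hbil
    simp only at hbil
    simp_rw [← Finset.mul_sum] at hbil
    have hp : (0 : ℝ) < 2 ^ j := by positivity
    -- On the block `r ≥ 2^j`, so `1/φ(r)` is at most `2^(-j)` times the large sieve weight
    -- `r/φ(r)`.
    calc _ ≤ ∑ r ∈ T with Nat.log 2 r = j, (1 / 2 ^ j) * ((r : ℝ) / r.totient * F r) := by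
          refine Finset.sum_le_sum fun r h => ?_
          rw [← mul_assoc]
          refine mul_le_mul_of_nonneg_right ?_ (hF0 r)
          rw [← mul_div_assoc]
          refine div_le_div_of_nonneg_right ?_ (Nat.cast_nonneg _)
          rw [one_div, ← div_eq_inv_mul, le_div_iff₀ hp, one_mul]
          exact_mod_cast (hr r h).1
      _ ≤ (1 / 2 ^ j) * (5 * A * B * (2 * N * K + 20 * ((2 ^ (j + 1) : ℕ) : ℝ) * N *
            (1 / Real.sqrt U + 1 / Real.sqrt V) +
            2 * K ^ 2 * ((2 ^ (j + 1) : ℕ) : ℝ) ^ 2 * Real.sqrt N)) := by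
          rw [← Finset.mul_sum]
          exact mul_le_mul_of_nonneg_left hbil (by positivity)
      _ = _ := by
          push_cast
          rw [pow_succ]
          field_simp
          ring
  rw [← Finset.sum_fiberwise_of_maps_to hmaps]
  refine (Finset.sum_le_sum hblock).trans ?_
  rw [← Finset.mul_sum]
  refine mul_le_mul_of_nonneg_left ?_ (by positivity)
  rw [Finset.sum_add_distrib, Finset.sum_add_distrib, Finset.sum_const, nsmul_eq_mul,
    ← Finset.mul_sum, ← Finset.mul_sum]
  -- The first term is governed by the smallest conductors, near `R`, and the last by the largest,
  -- near `Q`. The middle term is the same for all blocks and is multiplied by their number.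
  have g1 : ∑ j ∈ J, (1 : ℝ) / 2 ^ j ≤ 2 / (2 - 1) * (2 / R) := by
    refine sum_inv_pow_le_of_forall_inv_pow_le (by norm_num) (by positivity) J fun j hj => ?_
    have h1 := (Finset.mem_filter.1 hj).2.1
    rw [div_le_div_iff₀ (by positivity) hR, one_mul, ← pow_succ']
    exact h1.le
  have g2 : ∑ j ∈ J, (2 : ℝ) ^ j ≤ 2 / (2 - 1) * Q := by
    refine sum_pow_le_of_forall_pow_le (by norm_num) (Nat.cast_nonneg _) J fun j hj => ?_
    exact_mod_cast (Finset.mem_filter.1 hj).2.2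
  have hcard : (J.card : ℝ) ≤ L := by
    exact_mod_cast (Finset.card_filter_le _ _).trans (Finset.card_range L).le
  have k1 := mul_le_mul_of_nonneg_left g1 (by positivity : 0 ≤ 2 * (N : ℝ) * K)
  have k2 := mul_le_mul_of_nonneg_right hcard
    (by positivity : 0 ≤ 40 * (N : ℝ) * (1 / Real.sqrt U + 1 / Real.sqrt V))
  have k3 := mul_le_mul_of_nonneg_left g2 (by positivity : 0 ≤ 8 * (K : ℝ) ^ 2 * Real.sqrt N)
  refine (add_le_add (add_le_add k1 k2) k3).trans (le_of_eq ?_)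
  field_simp
  ring

/-! ### Dirichlet convolution and the logarithmic derivative -/

namespace ArithmeticFunction

/-- The restriction of an arithmetic function to the integers satisfying a predicate. -/
noncomputable def restrict (p : ℕ → Prop) (f : ArithmeticFunction ℂ) : ArithmeticFunction ℂ :=
  open Classical in ⟨fun n => if p n then f n else 0, by simp⟩

theorem restrict_apply (p : ℕ → Prop) [DecidablePred p] (f : ArithmeticFunction ℂ) (n : ℕ) :
    restrict p f n = if p n then f n else 0 := by
  simp only [restrict, coe_mk]
  congr

theorem restrict_of_pos {p : ℕ → Prop} {f : ArithmeticFunction ℂ} {n : ℕ} (h : p n) :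
    restrict p f n = f n := by
  classical
  rw [restrict_apply, if_pos h]

theorem restrict_of_neg {p : ℕ → Prop} {f : ArithmeticFunction ℂ} {n : ℕ} (h : ¬ p n) :
    restrict p f n = 0 := by
  classical
  rw [restrict_apply, if_neg h]

theorem norm_restrict_le (p : ℕ → Prop) (f : ArithmeticFunction ℂ) (n : ℕ) :
    ‖restrict p f n‖ ≤ ‖f n‖ := by
  by_cases h : p n
  · rw [restrict_of_pos h]
  · rw [restrict_of_neg h, norm_zero]
    exact norm_nonneg _

theorem restrict_add_restrict_not (p : ℕ → Prop) (f : ArithmeticFunction ℂ) :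
    restrict p f + restrict (fun n => ¬ p n) f = f := by
  ext n
  rw [add_apply]
  by_cases h : p n
  · rw [restrict_of_pos h, restrict_of_neg (by simpa using h), add_zero]
  · rw [restrict_of_neg h, restrict_of_pos h, zero_add]

/-- The indicator of such a predicate is completely multiplicative, and multiplication by a
completely multiplicative function distributes over convolution. -/
theorem restrict_mul {p : ℕ → Prop} (hp : ∀ m n, p (m * n) ↔ p m ∧ p n)
    (f g : ArithmeticFunction ℂ) : restrict p (f * g) = restrict p f * restrict p g := by
  ext n
  rw [mul_apply]
  by_cases h : p n
  · rw [restrict_of_pos h, mul_apply]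
    refine Finset.sum_congr rfl fun x hx => ?_
    have hx' := (Nat.mem_divisorsAntidiagonal.1 hx).1
    rw [← hx', hp] at h
    rw [restrict_of_pos h.1, restrict_of_pos h.2]
  · rw [restrict_of_neg h]
    refine (Finset.sum_eq_zero fun x hx => ?_).symm
    have hx' := (Nat.mem_divisorsAntidiagonal.1 hx).1
    rw [← hx', hp, not_and_or] at h
    rcases h with h | h
    · rw [restrict_of_neg h, zero_mul]
    · rw [restrict_of_neg h, mul_zero]

theorem restrict_one {p : ℕ → Prop} (hp : p 1) : restrict p 1 = 1 := by
  ext n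
  by_cases h : n = 1
  · subst h
    rw [restrict_of_pos hp]
  · by_cases h' : p n
    · rw [restrict_of_pos h']
    · rw [restrict_of_neg h', one_apply_ne h]

/-- Multiplication by the logarithm. -/
noncomputable def mulLog (f : ArithmeticFunction ℂ) : ArithmeticFunction ℂ :=
  ⟨fun n => f n * (Real.log n : ℂ), by simp⟩

theorem mulLog_apply (f : ArithmeticFunction ℂ) (n : ℕ) :
    mulLog f n = f n * (Real.log n : ℂ) := rfl

/-- The logarithm is additive on products: this is the product rule for `-d/ds` on Dirichlet series.
-/
theorem mulLog_mul (f g : ArithmeticFunction ℂ) :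
    mulLog (f * g) = mulLog f * g + f * mulLog g := by
  ext n
  rw [add_apply, mulLog_apply, mul_apply, mul_apply, mul_apply, Finset.sum_mul,
    ← Finset.sum_add_distrib]
  refine Finset.sum_congr rfl fun x hx => ?_
  obtain ⟨h1, h2⟩ := Nat.mem_divisorsAntidiagonal.1 hx
  have hx1 : (x.1 : ℝ) ≠ 0 := by
    have : x.1 ≠ 0 := by rintro h; simp [h] at h1; omega
    exact_mod_cast this
  have hx2 : (x.2 : ℝ) ≠ 0 := by
    have : x.2 ≠ 0 := by rintro h; simp [h] at h1; omega
    exact_mod_cast this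
  rw [mulLog_apply, mulLog_apply, ← h1, Nat.cast_mul, Real.log_mul hx1 hx2]
  push_cast
  ring

theorem mulLog_one : mulLog 1 = 0 := by
  ext n
  rw [mulLog_apply]
  by_cases h : n = 1
  · subst h
    simp
  · rw [one_apply_ne h, zero_mul, zero_apply]

theorem mulLog_restrict (p : ℕ → Prop) (f : ArithmeticFunction ℂ) :
    mulLog (restrict p f) = restrict p (mulLog f) := by
  ext n
  by_cases h : p n
  · rw [mulLog_apply, restrict_of_pos h, restrict_of_pos h, mulLog_apply]
  · rw [mulLog_apply, restrict_of_neg h, restrict_of_neg h, zero_mul]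

theorem norm_mul_apply_le_sum (f g : ArithmeticFunction ℂ) (n : ℕ) :
    ‖(f * g) n‖ ≤ ∑ x ∈ n.divisorsAntidiagonal, ‖f x.1‖ * ‖g x.2‖ := by
  rw [mul_apply]
  exact (norm_sum_le _ _).trans (Finset.sum_le_sum fun x _ => (norm_mul _ _).le)

theorem sum_vonMangoldt_divisorsAntidiagonal (n : ℕ) :
    ∑ x ∈ n.divisorsAntidiagonal, vonMangoldt x.1 = Real.log n := by
  rw [← vonMangoldt_sum, ← Nat.map_div_right_divisors, Finset.sum_map]
  rfl

/-- If `f` is bounded by `Λ` and `g` is bounded by one, then `f * g` is bounded by the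
logarithm. -/
theorem norm_mul_apply_le_log {f g : ArithmeticFunction ℂ} (hf : ∀ n, ‖f n‖ ≤ vonMangoldt n)
    (hg : ∀ n, ‖g n‖ ≤ 1) (n : ℕ) : ‖(f * g) n‖ ≤ Real.log n := by
  refine (norm_mul_apply_le_sum f g n).trans ?_
  rw [← sum_vonMangoldt_divisorsAntidiagonal]
  refine Finset.sum_le_sum fun x _ => ?_
  calc ‖f x.1‖ * ‖g x.2‖ ≤ vonMangoldt x.1 * 1 :=
        mul_le_mul (hf _) (hg _) (norm_nonneg _) vonMangoldt_nonneg
    _ = _ := mul_one _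

end ArithmeticFunction

open ArithmeticFunction (restrict mulLog)

/-- A normalised arithmetic function `f` whose logarithmic derivative has the coefficients
`Lam`, bounded by `Λ`. -/
structure LogDerivBounded (f Lam : ArithmeticFunction ℂ) : Prop where
  map_one : f 1 = 1
  mul_eq : Lam * f = mulLog f
  norm_le : ∀ n, ‖Lam n‖ ≤ ArithmeticFunction.vonMangoldt n

theorem ClassC.exists_logDerivBounded {f : ArithmeticFunction ℂ} (hf : ClassC f) :
    ∃ Lam, LogDerivBounded f Lam := by
  obtain ⟨hm, Lam, h1, h2⟩ := hf
  exact ⟨Lam, hm.1, ArithmeticFunction.ext h1, h2⟩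

namespace LogDerivBounded

variable {f g Lam : ArithmeticFunction ℂ}

/-- Strong induction: `|f n| log n ≤ ∑ Λ(d) |f (n/d)|` over `d ∣ n`. The term `d = 1` vanishes, so
only smaller arguments occur, and `∑ Λ(d) = log n`. -/
theorem norm_apply_le_one (h : LogDerivBounded f Lam) (n : ℕ) : ‖f n‖ ≤ 1 := by
  induction n using Nat.strong_induction_on with
  | _ n ih =>
    rcases Nat.lt_or_ge n 2 with hn | hn
    · interval_cases n
      · simp
      · rw [h.map_one, norm_one]
    · have hlog : 0 < Real.log n := Real.log_pos (by exact_mod_cast hn)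
      have h1 : ‖f n‖ * Real.log n = ‖(Lam * f) n‖ := by
        rw [h.mul_eq, ArithmeticFunction.mulLog_apply, norm_mul, Complex.norm_real,
          Real.norm_of_nonneg hlog.le]
      have h2 : ‖(Lam * f) n‖ ≤ Real.log n := by
        refine (ArithmeticFunction.norm_mul_apply_le_sum _ _ n).trans ?_
        rw [← ArithmeticFunction.sum_vonMangoldt_divisorsAntidiagonal]
        refine Finset.sum_le_sum fun x hx => ?_
        obtain ⟨e, hn0⟩ := Nat.mem_divisorsAntidiagonal.1 hx
        by_cases hx1 : x.1 = 1
        · have h0 : ‖Lam x.1‖ ≤ 0 := by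
            refine (h.norm_le x.1).trans (le_of_eq ?_)
            rw [hx1, ArithmeticFunction.vonMangoldt_apply_one]
          rw [le_antisymm h0 (norm_nonneg _), zero_mul]
          exact ArithmeticFunction.vonMangoldt_nonneg
        · have hx2 : x.2 < n := by
            have h10 : x.1 ≠ 0 := by rintro h; simp [h] at e; omega
            have h20 : x.2 ≠ 0 := by rintro h; simp [h] at e; omega
            rw [← e]
            exact (Nat.lt_mul_iff_one_lt_left (by omega)).2 (by omega)
          calc ‖Lam x.1‖ * ‖f x.2‖ ≤ ArithmeticFunction.vonMangoldt x.1 * 1 :=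
                mul_le_mul (h.norm_le _) (ih _ hx2) (norm_nonneg _)
                  ArithmeticFunction.vonMangoldt_nonneg
            _ = _ := mul_one _
      rw [← h1] at h2
      exact le_of_mul_le_mul_right (by linarith) hlog

/-- Differentiating `f * g = 1` gives `Lam * f * g + f * mulLog g = 0`. Multiplying by `g` clears
`f`. -/
theorem inverse (h : LogDerivBounded f Lam) (hfg : f * g = 1) : LogDerivBounded g (-Lam) where
  map_one := by
    have := congrArg (fun k : ArithmeticFunction ℂ => k 1) hfg
    simpa [h.map_one] using this
  mul_eq := by
    have h1 := ArithmeticFunction.mulLog_mul f g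
    rw [hfg, ArithmeticFunction.mulLog_one, ← h.mul_eq] at h1
    linear_combination (mulLog g + Lam * g) * hfg + g * h1
  norm_le n := by
    have : (-Lam) n = -(Lam n) := rfl
    rw [this, norm_neg]
    exact h.norm_le n

/-- Uniqueness for the differential equation: `Lam 1 = 0` and `log n ≠ 0` for `n ≥ 2`, so the value
at `n` is determined by the values at smaller integers. -/
theorem eq_of_mulLog_eq {h : ArithmeticFunction ℂ} (hf : LogDerivBounded f Lam)
    (h1 : h 1 = 1) (h2 : Lam * h = mulLog h) : h = f := by
  ext n
  induction n using Nat.strong_induction_on with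
  | _ n ih =>
    rcases Nat.lt_or_ge n 2 with hn | hn
    · interval_cases n
      · simp
      · rw [h1, hf.map_one]
    · have hlog : (Real.log n : ℂ) ≠ 0 := by
        exact_mod_cast (Real.log_pos (by exact_mod_cast hn)).ne'
      have e1 : h n * (Real.log n : ℂ) = (Lam * h) n := by
        rw [h2, ArithmeticFunction.mulLog_apply]
      have e2 : f n * (Real.log n : ℂ) = (Lam * f) n := by
        rw [hf.mul_eq, ArithmeticFunction.mulLog_apply]
      have e3 : (Lam * h) n = (Lam * f) n := by
        rw [ArithmeticFunction.mul_apply, ArithmeticFunction.mul_apply]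
        refine Finset.sum_congr rfl fun x hx => ?_
        obtain ⟨e, hn0⟩ := Nat.mem_divisorsAntidiagonal.1 hx
        by_cases hx1 : x.1 = 1
        · have h0 : ‖Lam x.1‖ ≤ 0 := by
            refine (hf.norm_le x.1).trans (le_of_eq ?_)
            rw [hx1, ArithmeticFunction.vonMangoldt_apply_one]
          rw [norm_le_zero_iff.1 h0, zero_mul, zero_mul]
        · have hx2 : x.2 < n := by
            have h10 : x.1 ≠ 0 := by rintro h; simp [h] at e; omega
            have h20 : x.2 ≠ 0 := by rintro h; simp [h] at e; omega
            rw [← e]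
            exact (Nat.lt_mul_iff_one_lt_left (by omega)).2 (by omega)
          rw [ih _ hx2]
      exact mul_right_cancel₀ hlog (by rw [e1, e2, e3])

end LogDerivBounded

/-! ### Coprimality conditions and Vaughan's identity -/

/-- All prime factors of `n` divide `s`. -/
def IsSmoothFor (s n : ℕ) : Prop := ∀ p : ℕ, p.Prime → p ∣ n → p ∣ s

theorem isSmoothFor_mul (s m n : ℕ) :
    IsSmoothFor s (m * n) ↔ IsSmoothFor s m ∧ IsSmoothFor s n := by
  unfold IsSmoothFor
  constructor
  · intro h
    exact ⟨fun p hp hd => h p hp (hd.mul_right n), fun p hp hd => h p hp (hd.mul_left m)⟩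
  · rintro ⟨h1, h2⟩ p hp hd
    rcases hp.dvd_mul.1 hd with hd | hd
    · exact h1 p hp hd
    · exact h2 p hp hd

theorem isSmoothFor_one (s : ℕ) : IsSmoothFor s 1 := fun _ hp hd =>
  absurd (Nat.dvd_one.1 hd) hp.one_lt.ne'

namespace LogDerivBounded

variable {f g Lam : ArithmeticFunction ℂ}

/-- `Lam` lives on prime powers, and a prime power `p^k` is coprime to `s` or composed of primes of
`s` according to whether `p ∣ s`. -/
theorem restrict_coprime_add_restrict_smooth (hf : LogDerivBounded f Lam) (s : ℕ) :
    restrict (fun n => n.Coprime s) Lam + restrict (IsSmoothFor s) Lam = Lam := by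
  ext n
  rw [ArithmeticFunction.add_apply]
  by_cases hn : IsPrimePow n
  · obtain ⟨p, k, hp, hk, rfl⟩ := hn
    have hp' : p.Prime := hp.nat_prime
    by_cases hps : p ∣ s
    · rw [ArithmeticFunction.restrict_of_neg, ArithmeticFunction.restrict_of_pos, zero_add]
      · intro q hq hd
        rwa [(Nat.prime_dvd_prime_iff_eq hq hp').1 (hq.dvd_of_dvd_pow hd)]
      · intro hc
        exact (Nat.Prime.coprime_iff_not_dvd hp').1 (Nat.Coprime.coprime_dvd_left
          (dvd_pow_self p hk.ne') hc) hps
    · rw [ArithmeticFunction.restrict_of_neg (p := IsSmoothFor s),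
        ArithmeticFunction.restrict_of_pos, add_zero]
      · exact Nat.Coprime.pow_left k ((Nat.Prime.coprime_iff_not_dvd hp').2 hps)
      · intro hc
        exact hps (hc p hp' (dvd_pow_self p hk.ne'))
  · have h0 : Lam n = 0 := by
      refine norm_le_zero_iff.1 ((hf.norm_le n).trans (le_of_eq ?_))
      exact ArithmeticFunction.vonMangoldt_eq_zero_iff.2 hn
    have h1 : ∀ p : ℕ → Prop, restrict p Lam n = 0 := fun p =>
      norm_le_zero_iff.1 ((ArithmeticFunction.norm_restrict_le p Lam n).trans (by rw [h0, norm_zero]))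
    rw [h1, h1, h0, add_zero]

/-- The restriction of `f` to the integers coprime to `s`, as the convolution of `f` with its
inverse restricted to the integers composed of primes dividing `s`. -/
theorem restrict_coprime_eq (hf : LogDerivBounded f Lam) (hfg : f * g = 1) (s : ℕ) :
    restrict (fun n => n.Coprime s) f = restrict (IsSmoothFor s) g * f := by
  have hc : ∀ m n : ℕ, (m * n).Coprime s ↔ m.Coprime s ∧ n.Coprime s := fun m n =>
    Nat.coprime_mul_iff_left
  set fc := restrict (fun n => n.Coprime s) f with hfc
  set fs := restrict (IsSmoothFor s) f with hfs
  -- A substitute for factoring the Euler product: `fc * fs` satisfies the same differential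
  -- equation as `f` with the same value at one.
  have h1 : fc * fs = f := by
    refine hf.eq_of_mulLog_eq ?_ ?_
    · rw [ArithmeticFunction.mul_apply_one, hfc, hfs,
        ArithmeticFunction.restrict_of_pos (p := fun n => n.Coprime s) (Nat.coprime_one_left s),
        ArithmeticFunction.restrict_of_pos (isSmoothFor_one s), hf.map_one, one_mul]
    · rw [ArithmeticFunction.mulLog_mul, hfc, hfs, ArithmeticFunction.mulLog_restrict,
        ArithmeticFunction.mulLog_restrict, ← hf.mul_eq, ArithmeticFunction.restrict_mul hc,
        ArithmeticFunction.restrict_mul (isSmoothFor_mul s)]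
      nth_rewrite 1 [← hf.restrict_coprime_add_restrict_smooth s]
      ring
  have h2 : fs * restrict (IsSmoothFor s) g = 1 := by
    rw [hfs, ← ArithmeticFunction.restrict_mul (isSmoothFor_mul s), hfg,
      ArithmeticFunction.restrict_one (isSmoothFor_one s)]
  linear_combination restrict (IsSmoothFor s) g * h1 - fc * h2

/-- Vaughan's identity for the logarithmic derivative. -/
theorem vaughan (hf : LogDerivBounded f Lam) (hfg : f * g = 1) (U V : ℝ) :
    Lam = restrict (fun n => (n : ℝ) ≤ V) Lam + restrict (fun n => (n : ℝ) ≤ U) g * mulLog f -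
      (restrict (fun n => (n : ℝ) ≤ V) Lam * restrict (fun n => (n : ℝ) ≤ U) g) * f +
      restrict (fun n => ¬ (n : ℝ) ≤ U) g * (restrict (fun n => ¬ (n : ℝ) ≤ V) Lam * f) := by
  have h1 := ArithmeticFunction.restrict_add_restrict_not (fun n => (n : ℝ) ≤ V) Lam
  have h2 := ArithmeticFunction.restrict_add_restrict_not (fun n => (n : ℝ) ≤ U) g
  rw [← hf.mul_eq]
  set a := restrict (fun n => (n : ℝ) ≤ V) Lam
  set a' := restrict (fun n => ¬ (n : ℝ) ≤ V) Lam
  set b := restrict (fun n => (n : ℝ) ≤ U) g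
  set b' := restrict (fun n => ¬ (n : ℝ) ≤ U) g
  rw [← h1]
  rw [← h2] at hfg
  -- With `Lam = a + a'`, the middle terms combine to `a' * b * f`. Adding `b' * a' * f` gives `a' *
  -- (f * g) = a'`.
  linear_combination (-a') * hfg

end LogDerivBounded

/-! ### The mean value of `1/φ` -/

theorem sum_Ioc_one_div_le (N : ℕ) : ∑ n ∈ Finset.Ioc 0 N, 1 / (n : ℝ) ≤ 1 + Real.log N := by
  have h := harmonic_le_one_add_log N
  rw [harmonic_eq_sum_Icc] at h
  push_cast at h
  simp_rw [one_div]
  exact h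

theorem sum_multiples_one_div_le {d : ℕ} (hd : 0 < d) (S : ℕ) :
    ∑ s ∈ Finset.Icc 1 S with d ∣ s, 1 / (s : ℝ) ≤ 1 / d * (1 + Real.log S) := by
  have hd' : (0 : ℝ) < d := by exact_mod_cast hd
  refine le_trans ?_ (mul_le_mul_of_nonneg_left (sum_Ioc_one_div_le S) (by positivity))
  rw [Finset.mul_sum]
  have hinj : Set.InjOn (fun s => s / d) ((Finset.Icc 1 S).filter fun s => d ∣ s) := by
    intro s hs t ht h
    simp only [Finset.coe_filter, Set.mem_ofPred_eq] at hs ht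
    rw [← Nat.div_mul_cancel hs.2, ← Nat.div_mul_cancel ht.2]
    simp only at h
    rw [h]
  calc ∑ s ∈ Finset.Icc 1 S with d ∣ s, 1 / (s : ℝ)
      = ∑ s ∈ Finset.Icc 1 S with d ∣ s, 1 / (d : ℝ) * (1 / ((s / d : ℕ) : ℝ)) := by
        refine Finset.sum_congr rfl fun s hs => ?_
        have h1 := (Finset.mem_filter.1 hs).2
        rw [Nat.cast_div h1 hd'.ne']
        field_simp
    _ = ∑ k ∈ ((Finset.Icc 1 S).filter fun s => d ∣ s).image fun s => s / d,
          1 / (d : ℝ) * (1 / (k : ℝ)) := by rw [Finset.sum_image hinj]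
    _ ≤ _ := by
        refine Finset.sum_le_sum_of_subset_of_nonneg ?_ fun _ _ _ => by positivity
        intro k hk
        obtain ⟨s, hs, rfl⟩ := Finset.mem_image.1 hk
        obtain ⟨h1, h2⟩ := Finset.mem_filter.1 hs
        rw [Finset.mem_Icc] at h1
        exact Finset.mem_Ioc.2 ⟨Nat.div_pos (Nat.le_of_dvd h1.1 h2) hd,
          (Nat.div_le_self s d).trans h1.2⟩

theorem one_div_totient_eq (s : ℕ) :
    1 / (s.totient : ℝ) = 1 / s * ∏ p ∈ s.primeFactors, (1 + 1 / ((p : ℝ) - 1)) := by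
  have h := Nat.totient_eq_mul_prod_factors s
  have h' : (s.totient : ℝ) = s * ∏ p ∈ s.primeFactors, (1 - (p : ℝ)⁻¹) := by
    have h2 := congrArg (fun x : ℚ => (x : ℝ)) h
    push_cast at h2
    exact h2
  have hp : ∀ p ∈ s.primeFactors, (1 + 1 / ((p : ℝ) - 1)) = (1 - (p : ℝ)⁻¹)⁻¹ := by
    intro p hp
    have h2 : (1 : ℝ) < p := by exact_mod_cast (Nat.prime_of_mem_primeFactors hp).one_lt
    have h3 : (p : ℝ) - 1 ≠ 0 := by linarith
    have h4 : (p : ℝ) ≠ 0 := by linarith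
    field_simp
    ring
  rw [h', Finset.prod_congr rfl hp, Finset.prod_inv_distrib, one_div, mul_inv, one_div]

/-- The product is at most the exponential of `∑ 1/(k(k-1))`, which telescopes to at most one. -/
theorem prod_primes_one_add_le (S : ℕ) :
    ∏ p ∈ (Finset.Icc 1 S).filter Nat.Prime, (1 + 1 / ((p : ℝ) * (p - 1))) ≤ 3 := by
  have h1 : ∀ n : ℕ, ∑ k ∈ Finset.Ico 2 (n + 2), 1 / ((k : ℝ) * (k - 1)) = 1 - 1 / (n + 1) := by
    intro n
    induction n with
    | zero => simp
    | succ n ih =>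
      rw [Finset.sum_Ico_succ_top (by omega), ih]
      push_cast
      rw [show (n : ℝ) + 2 - 1 = n + 1 by ring, show (n : ℝ) + 1 + 1 = n + 2 by ring]
      field_simp
      ring
  have hnn : ∀ k : ℕ, 0 ≤ 1 / ((k : ℝ) * (k - 1)) := by
    intro k
    rcases Nat.eq_zero_or_pos k with rfl | hk
    · simp
    · have : (1 : ℝ) ≤ k := by exact_mod_cast hk
      have : (0 : ℝ) ≤ k - 1 := by linarith
      positivity
  have h2 : ∑ p ∈ (Finset.Icc 1 S).filter Nat.Prime, 1 / ((p : ℝ) * (p - 1)) ≤ 1 := by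
    refine (Finset.sum_le_sum_of_subset_of_nonneg (t := Finset.Ico 2 (S + 2)) ?_
      fun k _ _ => hnn k).trans ?_
    · intro p hp
      obtain ⟨h1, h2⟩ := Finset.mem_filter.1 hp
      exact Finset.mem_Ico.2 ⟨h2.two_le, by have := (Finset.mem_Icc.1 h1).2; omega⟩
    · rw [h1]
      have : (0 : ℝ) ≤ 1 / (S + 1) := by positivity
      linarith
  calc _ ≤ ∏ p ∈ (Finset.Icc 1 S).filter Nat.Prime, Real.exp (1 / ((p : ℝ) * (p - 1))) := by
        refine Finset.prod_le_prod (fun p _ => by have := hnn p; linarith) fun p _ => ?_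
        rw [add_comm]
        exact Real.add_one_le_exp _
    _ = Real.exp (∑ p ∈ (Finset.Icc 1 S).filter Nat.Prime, 1 / ((p : ℝ) * (p - 1))) :=
        (Real.exp_sum _ _).symm
    _ ≤ Real.exp 1 := Real.exp_le_exp.2 h2
    _ ≤ 3 := Real.exp_one_lt_three.le

/-- Expand `s/φ(s) = ∏ (1 + 1/(p-1))` over sets `T` of primes dividing `s` and interchange. The
multiples of `∏ T` contribute `(1 + log S)/∏ T`, and the sum over `T` folds back into a bounded
product. -/
theorem sum_one_div_totient_le (S : ℕ) :
    ∑ s ∈ Finset.Icc 1 S, 1 / (s.totient : ℝ) ≤ 3 * (1 + Real.log S) := by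
  classical
  set P := (Finset.Icc 1 S).filter Nat.Prime with hP
  have hlog : 0 ≤ 1 + Real.log S := by
    have := Real.log_natCast_nonneg S
    linarith
  have h1 : ∀ s ∈ Finset.Icc 1 S, 1 / (s.totient : ℝ) =
      ∑ T ∈ P.powerset, if T ⊆ s.primeFactors then 1 / (s : ℝ) * ∏ p ∈ T, 1 / ((p : ℝ) - 1)
        else 0 := by
    intro s hs
    have hs' := Finset.mem_Icc.1 hs
    rw [one_div_totient_eq, Finset.prod_one_add, Finset.mul_sum, ← Finset.sum_filter]
    refine Finset.sum_congr ?_ fun _ _ => rfl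
    ext T
    simp only [Finset.mem_powerset, Finset.mem_filter]
    refine ⟨fun h => ⟨fun p hp => ?_, h⟩, fun h => h.2⟩
    have hp' := h hp
    have h2 := Nat.prime_of_mem_primeFactors hp'
    exact Finset.mem_filter.2 ⟨Finset.mem_Icc.2 ⟨h2.pos,
      (Nat.le_of_mem_primeFactors hp').trans hs'.2⟩, h2⟩
  rw [Finset.sum_congr rfl h1, Finset.sum_comm]
  have h2 : ∀ T ∈ P.powerset, ∑ s ∈ Finset.Icc 1 S,
      (if T ⊆ s.primeFactors then 1 / (s : ℝ) * ∏ p ∈ T, 1 / ((p : ℝ) - 1) else 0) ≤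
      (1 + Real.log S) * ∏ p ∈ T, 1 / ((p : ℝ) * (p - 1)) := by
    intro T hT
    have hTP : ∀ p ∈ T, p.Prime := fun p hp =>
      (Finset.mem_filter.1 (Finset.mem_powerset.1 hT hp)).2
    have hd : 0 < ∏ p ∈ T, p := Finset.prod_pos fun p hp => (hTP p hp).pos
    have hprod : 0 ≤ ∏ p ∈ T, 1 / ((p : ℝ) - 1) := Finset.prod_nonneg fun p hp => by
      have : (1 : ℝ) < p := by exact_mod_cast (hTP p hp).one_lt
      have : (0 : ℝ) ≤ p - 1 := by linarith
      positivity
    rw [← Finset.sum_filter, ← Finset.sum_mul]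
    have h3 : ∑ s ∈ Finset.Icc 1 S with T ⊆ s.primeFactors, 1 / (s : ℝ) ≤
        1 / ((∏ p ∈ T, p : ℕ) : ℝ) * (1 + Real.log S) := by
      refine le_trans (Finset.sum_le_sum_of_subset_of_nonneg ?_ fun _ _ _ => by positivity)
        (sum_multiples_one_div_le hd S)
      intro s hs
      obtain ⟨h1, h2⟩ := Finset.mem_filter.1 hs
      refine Finset.mem_filter.2 ⟨h1, Finset.prod_primes_dvd s (fun p hp => (hTP p hp).prime)
        fun p hp => Nat.dvd_of_mem_primeFactors (h2 hp)⟩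
    refine (mul_le_mul_of_nonneg_right h3 hprod).trans (le_of_eq ?_)
    simp_rw [one_div, mul_inv, Finset.prod_mul_distrib, Finset.prod_inv_distrib]
    push_cast
    ring
  refine (Finset.sum_le_sum h2).trans ?_
  rw [← Finset.mul_sum, ← Finset.prod_one_add, mul_comm]
  exact mul_le_mul_of_nonneg_right (prod_primes_one_add_le S) hlog

/-! ### The functional `Δ_Ξ` and its sums of maxima -/

theorem CharSet.card_induced_le (Ξ : CharSet) (q : ℕ) : (Ξ.induced q).card ≤ Ξ.card := by
  classical
  unfold CharSet.induced
  refine (Finset.card_biUnion_le).trans ?_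
  refine (Finset.sum_le_card_nsmul _ _ 1 fun ξ _ => ?_).trans (by simp)
  split_ifs <;> simp

/-- The kernel of the linear functional `h ↦ Δ_Ξ(h, X; q, a)`. -/
noncomputable def deltaKernel (Ξ : CharSet) {q : ℕ} (a : (ZMod q)ˣ) (n : ℕ) : ℂ :=
  (if (n : ZMod q) = (a : ZMod q) then 1 else 0) -
    1 / (Nat.totient q : ℂ) * ∑ χ ∈ Ξ.induced q, χ (a : ZMod q) * conj (χ (n : ZMod q))

theorem Finset.Icc_one_eq_Ioc_zero (N : ℕ) : Finset.Icc 1 N = Finset.Ioc 0 N := rfl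

theorem deltaXi_eq_sum (Ξ : CharSet) (h : ℕ → ℂ) (X : ℝ) {q : ℕ} (a : (ZMod q)ˣ) :
    deltaXi Ξ h X q a = ∑ n ∈ Finset.Ioc 0 ⌊X⌋₊, h n * deltaKernel Ξ a n := by
  unfold deltaXi charSum deltaKernel
  rw [Finset.Icc_one_eq_Ioc_zero, Finset.sum_filter]
  simp_rw [mul_sub, Finset.sum_sub_distrib, mul_ite, mul_one, mul_zero]
  congr 1
  simp_rw [Finset.mul_sum]
  rw [Finset.sum_comm]
  refine Finset.sum_congr rfl fun n _ => Finset.sum_congr rfl fun χ _ => ?_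
  ring

theorem norm_sum_char_mul_conj_le {q : ℕ} (T : Finset (DirichletCharacter ℂ q)) (a b : ZMod q) :
    ‖∑ χ ∈ T, χ a * conj (χ b)‖ ≤ T.card := by
  refine (norm_sum_le _ _).trans ((Finset.sum_le_card_nsmul _ _ 1 fun χ _ => ?_).trans (by simp))
  rw [norm_mul, Complex.norm_conj]
  exact mul_le_one₀ (χ.norm_le_one a) (norm_nonneg _) (χ.norm_le_one b)

theorem card_dirichletCharacter (q : ℕ) [NeZero q] :
    (Finset.univ : Finset (DirichletCharacter ℂ q)).card = q.totient := by
  rw [Finset.card_univ, ← Nat.card_eq_fintype_card,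
    DirichletCharacter.card_eq_totient_of_hasEnoughRootsOfUnity]

/-- The normalisation by `φ(q)` absorbs the character sum, since `Ξ_q` consists of characters mod
`q` and there are only `φ(q)` of these. -/
theorem norm_deltaKernel_le_two (Ξ : CharSet) {q : ℕ} [NeZero q] (a : (ZMod q)ˣ) (n : ℕ) :
    ‖deltaKernel Ξ a n‖ ≤ 2 := by
  have hφ : (0 : ℝ) < q.totient := by exact_mod_cast Nat.totient_pos.2 (NeZero.pos q)
  unfold deltaKernel
  refine (norm_sub_le _ _).trans ?_
  have h1 : ‖(if (n : ZMod q) = (a : ZMod q) then (1 : ℂ) else 0)‖ ≤ 1 := by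
    split_ifs <;> simp
  have h2 : ‖1 / (Nat.totient q : ℂ) * ∑ χ ∈ Ξ.induced q,
      χ (a : ZMod q) * conj (χ (n : ZMod q))‖ ≤ 1 := by
    rw [norm_mul, norm_div, norm_one, Complex.norm_natCast, div_mul_eq_mul_div, one_mul,
      div_le_one hφ]
    refine (norm_sum_char_mul_conj_le _ _ _).trans ?_
    rw [← card_dirichletCharacter]
    exact_mod_cast Finset.card_le_univ _
  linarith

theorem deltaKernel_mul_of_not_isUnit (Ξ : CharSet) {q : ℕ} (a : (ZMod q)ˣ) {m : ℕ}
    (hm : ¬ IsUnit (m : ZMod q)) (n : ℕ) : deltaKernel Ξ a (m * n) = 0 := by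
  unfold deltaKernel
  have h1 : ¬ ((m * n : ℕ) : ZMod q) = (a : ZMod q) := by
    intro h
    refine hm (isUnit_of_mul_isUnit_left (y := (n : ZMod q)) ?_)
    rw [← Nat.cast_mul, h]
    exact a.isUnit
  rw [if_neg h1, Finset.sum_eq_zero, mul_zero, sub_zero]
  intro χ _
  rw [Nat.cast_mul, map_mul, MulChar.map_nonunit _ hm, zero_mul, map_zero, mul_zero]

/-- Dilation by a unit only moves the residue class. After taking the maximum over classes it is
invisible, which makes type I sums accessible. -/
theorem deltaKernel_mul_of_isUnit (Ξ : CharSet) {q : ℕ} [NeZero q] (a u : (ZMod q)ˣ) {m : ℕ}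
    (hm : (u : ZMod q) = m) (n : ℕ) : deltaKernel Ξ a (m * n) = deltaKernel Ξ (u⁻¹ * a) n := by
  unfold deltaKernel
  have h1 : (((m * n : ℕ) : ZMod q) = (a : ZMod q)) ↔
      ((n : ZMod q) = ((u⁻¹ * a : (ZMod q)ˣ) : ZMod q)) := by
    rw [Nat.cast_mul, ← hm, Units.val_mul, Units.eq_inv_mul_iff_mul_eq]
  simp only [h1]
  congr 2
  refine Finset.sum_congr rfl fun χ _ => ?_
  rw [Nat.cast_mul, ← hm, map_mul, map_mul, DirichletCharacter.conj_apply, MulChar.inv_apply,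
    Ring.inverse_unit, Units.val_mul, map_mul]
  ring

/-- `max_{(a,q)=1} |Δ_Ξ(h, X; q, a)|`. -/
noncomputable def maxDelta (Ξ : CharSet) (h : ℕ → ℂ) (X : ℝ) (q : ℕ) : ℝ :=
  ⨆ a : (ZMod q)ˣ, ‖deltaXi Ξ h X q a‖

theorem sumMaxDelta_eq (Ξ : CharSet) (h : ℕ → ℂ) (X Q : ℝ) :
    sumMaxDelta Ξ h X Q = ∑ q ∈ Finset.Icc 1 ⌊Q⌋₊, maxDelta Ξ h X q := rfl

theorem norm_deltaXi_le_maxDelta (Ξ : CharSet) (h : ℕ → ℂ) (X : ℝ) {q : ℕ} [NeZero q]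
    (a : (ZMod q)ˣ) : ‖deltaXi Ξ h X q a‖ ≤ maxDelta Ξ h X q :=
  le_ciSup (f := fun a : (ZMod q)ˣ => ‖deltaXi Ξ h X q a‖) (Set.finite_range _).bddAbove a

theorem maxDelta_nonneg (Ξ : CharSet) (h : ℕ → ℂ) (X : ℝ) (q : ℕ) : 0 ≤ maxDelta Ξ h X q :=
  Real.iSup_nonneg fun _ => norm_nonneg _

theorem sumMaxDelta_nonneg (Ξ : CharSet) (h : ℕ → ℂ) (X Q : ℝ) : 0 ≤ sumMaxDelta Ξ h X Q :=
  Finset.sum_nonneg fun _ _ => maxDelta_nonneg _ _ _ _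

theorem sumMaxDelta_le_of_forall {Ξ : CharSet} {h : ℕ → ℂ} {X Q : ℝ} {B : ℕ → ℝ}
    (hB : ∀ q ∈ Finset.Icc 1 ⌊Q⌋₊, ∀ a : (ZMod q)ˣ, ‖deltaXi Ξ h X q a‖ ≤ B q) :
    sumMaxDelta Ξ h X Q ≤ ∑ q ∈ Finset.Icc 1 ⌊Q⌋₊, B q :=
  Finset.sum_le_sum fun q hq => ciSup_le fun a => hB q hq a

theorem sumMaxDelta_congr {Ξ : CharSet} {h h' : ℕ → ℂ} {X X' Q : ℝ} (hX : ⌊X⌋₊ = ⌊X'⌋₊)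
    (hh : ∀ n ∈ Finset.Ioc 0 ⌊X⌋₊, h n = h' n) :
    sumMaxDelta Ξ h X Q = sumMaxDelta Ξ h' X' Q := by
  unfold sumMaxDelta
  refine Finset.sum_congr rfl fun q _ => iSup_congr fun a => ?_
  rw [deltaXi_eq_sum, deltaXi_eq_sum, ← hX]
  refine congrArg _ (Finset.sum_congr rfl fun n hn => ?_)
  rw [hh n hn]

/-- Bounds for `Δ` that are linear in other values of `Δ` carry over to the sum of maxima. -/
theorem sumMaxDelta_le_sum {ι : Type*} (I : Finset ι) {Ξ : CharSet} {h : ℕ → ℂ} {X Q : ℝ}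
    (c : ι → ℝ) (h' : ι → ℕ → ℂ) (X' : ι → ℝ)
    (hB : ∀ q, 1 ≤ q → ∀ a : (ZMod q)ˣ, ‖deltaXi Ξ h X q a‖ ≤
      ∑ i ∈ I, c i * maxDelta Ξ (h' i) (X' i) q) :
    sumMaxDelta Ξ h X Q ≤ ∑ i ∈ I, c i * sumMaxDelta Ξ (h' i) (X' i) Q := by
  refine (sumMaxDelta_le_of_forall fun q hq a => hB q (Finset.mem_Icc.1 hq).1 a).trans
    (le_of_eq ?_)
  rw [Finset.sum_comm]
  simp_rw [sumMaxDelta_eq, Finset.mul_sum]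

theorem sumMaxDelta_add_le (Ξ : CharSet) (h₁ h₂ : ℕ → ℂ) (X Q : ℝ) :
    sumMaxDelta Ξ (h₁ + h₂) X Q ≤ sumMaxDelta Ξ h₁ X Q + sumMaxDelta Ξ h₂ X Q := by
  rw [sumMaxDelta_eq Ξ h₁, sumMaxDelta_eq Ξ h₂, ← Finset.sum_add_distrib]
  refine sumMaxDelta_le_of_forall fun q hq a => ?_
  have : NeZero q := ⟨by have := (Finset.mem_Icc.1 hq).1; omega⟩
  refine le_trans ?_ (add_le_add (norm_deltaXi_le_maxDelta Ξ h₁ X a)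
    (norm_deltaXi_le_maxDelta Ξ h₂ X a))
  refine le_trans (le_of_eq ?_) (norm_add_le _ _)
  simp_rw [deltaXi_eq_sum, ← Finset.sum_add_distrib, Pi.add_apply, add_mul]

theorem sumMaxDelta_neg (Ξ : CharSet) (h : ℕ → ℂ) (X Q : ℝ) :
    sumMaxDelta Ξ (-h) X Q = sumMaxDelta Ξ h X Q := by
  unfold sumMaxDelta
  refine Finset.sum_congr rfl fun q _ => iSup_congr fun a => ?_
  rw [deltaXi_eq_sum, deltaXi_eq_sum, ← norm_neg, ← Finset.sum_neg_distrib]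
  simp

theorem sumMaxDelta_sub_le (Ξ : CharSet) (h₁ h₂ : ℕ → ℂ) (X Q : ℝ) :
    sumMaxDelta Ξ (h₁ - h₂) X Q ≤ sumMaxDelta Ξ h₁ X Q + sumMaxDelta Ξ h₂ X Q := by
  rw [sub_eq_add_neg, ← sumMaxDelta_neg Ξ h₂]
  exact sumMaxDelta_add_le _ _ _ _ _

/-- Meant for sparse functions, where losing the whole factor `Q` is affordable. -/
theorem sumMaxDelta_le_two_mul {Ξ : CharSet} {h : ℕ → ℂ} {X Q : ℝ} (hQ : 0 ≤ Q) {B : ℝ}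
    (hB : ∑ n ∈ Finset.Ioc 0 ⌊X⌋₊, ‖h n‖ ≤ B) : sumMaxDelta Ξ h X Q ≤ 2 * Q * B := by
  have hB0 : 0 ≤ B := le_trans (by positivity) hB
  calc sumMaxDelta Ξ h X Q ≤ ∑ q ∈ Finset.Icc 1 ⌊Q⌋₊, 2 * B := by
        refine sumMaxDelta_le_of_forall fun q hq a => ?_
        have : NeZero q := ⟨by have := (Finset.mem_Icc.1 hq).1; omega⟩
        rw [deltaXi_eq_sum]
        refine (norm_sum_le _ _).trans ?_
        refine le_trans ?_ (mul_le_mul_of_nonneg_left hB (by norm_num))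
        rw [Finset.mul_sum]
        refine Finset.sum_le_sum fun n _ => ?_
        rw [norm_mul, mul_comm]
        exact mul_le_mul_of_nonneg_right (norm_deltaKernel_le_two _ _ _) (norm_nonneg _)
    _ = ⌊Q⌋₊ * (2 * B) := by rw [Finset.sum_const, Nat.card_Icc, nsmul_eq_mul, Nat.add_sub_cancel]
    _ ≤ Q * (2 * B) := by
        gcongr
        exact Nat.floor_le hQ
    _ = _ := by ring

theorem card_filter_zmod_eq_le (N : ℕ) {q : ℕ} (hq : 0 < q) (a : ZMod q) :
    (((Finset.Ioc 0 N).filter fun n => ((n : ℕ) : ZMod q) = a).card : ℝ) ≤ N / q + 1 := by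
  have : NeZero q := ⟨by omega⟩
  have h : ((Finset.Ioc 0 N).filter fun n => ((n : ℕ) : ZMod q) = a).card ≤ N / q + 1 := by
    rw [← Finset.card_range (N / q + 1)]
    refine Finset.card_le_card_of_injOn (fun n => n / q) ?_ ?_
    · intro n hn
      have h1 := (Finset.mem_Ioc.1 (Finset.mem_filter.1 hn).1).2
      exact Finset.mem_coe.2 (Finset.mem_range.2 (Nat.lt_succ_of_le (Nat.div_le_div_right h1)))
    · intro m hm n hn hmn
      have h1 := (Finset.mem_filter.1 hm).2
      have h2 := (Finset.mem_filter.1 hn).2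
      rw [← h2, ZMod.natCast_eq_natCast_iff'] at h1
      rw [← Nat.div_add_mod m q, ← Nat.div_add_mod n q, h1]
      simp only at hmn
      rw [hmn]
  calc (_ : ℝ) ≤ ((N / q + 1 : ℕ) : ℝ) := by exact_mod_cast h
    _ ≤ N / q + 1 := by
        push_cast
        gcongr
        exact Nat.cast_div_le

/-- The trivial bound for the sum of maxima. -/
theorem sumMaxDelta_le_trivial {Ξ : CharSet} {h : ℕ → ℂ} {N : ℕ} {Q H : ℝ} (hQ : 1 ≤ Q)
    (hH0 : 0 ≤ H) (hH : ∀ n ∈ Finset.Ioc 0 N, ‖h n‖ ≤ H) :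
    sumMaxDelta Ξ h N Q ≤ H * (N * ((1 + 3 * Ξ.card) * (1 + Real.log Q)) + Q) := by
  have hQ0 : 0 ≤ Q := by linarith
  have hfl : (⌊Q⌋₊ : ℝ) ≤ Q := Nat.floor_le hQ0
  have hpt : ∀ q ∈ Finset.Icc 1 ⌊Q⌋₊, ∀ a : (ZMod q)ˣ, ‖deltaXi Ξ h N q a‖ ≤
      H * (N * (1 / q) + 1 + Ξ.card * N * (1 / (q.totient : ℝ))) := by
    intro q hq a
    have hq1 := (Finset.mem_Icc.1 hq).1
    unfold deltaXi charSum
    rw [Nat.floor_natCast, Finset.Icc_one_eq_Ioc_zero]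
    refine (norm_sub_le _ _).trans ?_
    have h1 : ‖∑ n ∈ Finset.Ioc 0 N with ((n : ℕ) : ZMod q) = (a : ZMod q), h n‖ ≤
        H * (N * (1 / q) + 1) := by
      refine (norm_sum_le _ _).trans ((Finset.sum_le_card_nsmul _ _ H fun n hn =>
        hH n (Finset.mem_filter.1 hn).1).trans ?_)
      rw [nsmul_eq_mul, mul_comm]
      refine mul_le_mul_of_nonneg_left ?_ hH0
      rw [mul_one_div]
      exact card_filter_zmod_eq_le N hq1 _
    have h2 : ‖1 / (Nat.totient q : ℂ) * ∑ χ ∈ Ξ.induced q, χ (a : ZMod q) *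
        ∑ n ∈ Finset.Ioc 0 N, h n * conj (χ (n : ZMod q))‖ ≤
        H * (Ξ.card * N * (1 / (q.totient : ℝ))) := by
      rw [norm_mul, norm_div, norm_one, Complex.norm_natCast]
      have h3 : ‖∑ χ ∈ Ξ.induced q, χ (a : ZMod q) *
          ∑ n ∈ Finset.Ioc 0 N, h n * conj (χ (n : ZMod q))‖ ≤ Ξ.card * (N * H) := by
        refine (norm_sum_le _ _).trans ((Finset.sum_le_card_nsmul _ _ (N * H) fun χ _ => ?_).trans ?_)
        · rw [norm_mul]
          refine (mul_le_of_le_one_left (norm_nonneg _) (χ.norm_le_one _)).trans ?_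
          refine (norm_sum_le _ _).trans ((Finset.sum_le_card_nsmul _ _ H fun n hn => ?_).trans ?_)
          · rw [norm_mul, Complex.norm_conj]
            exact (mul_le_of_le_one_right (norm_nonneg _) (χ.norm_le_one _)).trans (hH n hn)
          · rw [Nat.card_Ioc, nsmul_eq_mul, Nat.sub_zero]
        · rw [nsmul_eq_mul]
          gcongr
          exact CharSet.card_induced_le Ξ q
      refine (mul_le_mul_of_nonneg_left h3 (by positivity)).trans (le_of_eq ?_)
      ring
    refine (add_le_add h1 h2).trans (le_of_eq ?_)
    ring
  refine (sumMaxDelta_le_of_forall hpt).trans ?_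
  rw [← Finset.mul_sum, Finset.sum_add_distrib, Finset.sum_add_distrib, ← Finset.mul_sum,
    ← Finset.mul_sum, Finset.sum_const, Nat.card_Icc, nsmul_eq_mul, Nat.add_sub_cancel, mul_one]
  refine mul_le_mul_of_nonneg_left ?_ hH0
  have hfl1 : (1 : ℝ) ≤ ⌊Q⌋₊ := by
    exact_mod_cast Nat.le_floor (by exact_mod_cast hQ)
  have hlog : Real.log ⌊Q⌋₊ ≤ Real.log Q := Real.log_le_log (by linarith) hfl
  have h1 : ∑ q ∈ Finset.Icc 1 ⌊Q⌋₊, 1 / (q : ℝ) ≤ 1 + Real.log Q := by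
    have := sum_Ioc_one_div_le ⌊Q⌋₊
    rw [← Finset.Icc_one_eq_Ioc_zero] at this
    linarith
  have h2 : ∑ q ∈ Finset.Icc 1 ⌊Q⌋₊, 1 / (q.totient : ℝ) ≤ 3 * (1 + Real.log Q) :=
    (sum_one_div_totient_le ⌊Q⌋₊).trans (by linarith)
  have h3 := mul_le_mul_of_nonneg_left h1 (Nat.cast_nonneg (α := ℝ) N)
  have h4 := mul_le_mul_of_nonneg_left h2
    (mul_nonneg (Nat.cast_nonneg (α := ℝ) Ξ.card) (Nat.cast_nonneg (α := ℝ) N))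
  linarith

theorem sum_Ioc_mul_apply (c h : ArithmeticFunction ℂ) (F : ℕ → ℂ) (N : ℕ) :
    ∑ n ∈ Finset.Ioc 0 N, (c * h) n * F n =
      ∑ m ∈ Finset.Ioc 0 N, c m * ∑ n ∈ Finset.Ioc 0 (N / m), h n * F (m * n) := by
  classical
  have h1 : ∀ n ∈ Finset.Ioc 0 N, (c * h) n * F n =
      ∑ x ∈ Finset.Ioc 0 N ×ˢ Finset.Ioc 0 N,
        if x.1 * x.2 = n then c x.1 * (h x.2 * F (x.1 * x.2)) else 0 := by
    intro n hn
    have hn' := Finset.mem_Ioc.1 hn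
    rw [ArithmeticFunction.mul_apply, Finset.sum_mul, ← Finset.sum_filter,
      Nat.divisorsAntidiagonal_eq_prod_filter_of_le (by omega) hn'.2]
    refine Finset.sum_congr rfl fun x hx => ?_
    rw [(Finset.mem_filter.1 hx).2]
    ring
  rw [Finset.sum_congr rfl h1, Finset.sum_comm, Finset.sum_product]
  refine Finset.sum_congr rfl fun m hm => ?_
  have hm' := Finset.mem_Ioc.1 hm
  rw [Finset.mul_sum]
  have h2 : ∀ k ∈ Finset.Ioc 0 N, (∑ n ∈ Finset.Ioc 0 N,
      if m * k = n then c m * (h k * F (m * k)) else 0) =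
      if k ∈ Finset.Ioc 0 (N / m) then c m * (h k * F (m * k)) else 0 := by
    intro k hk
    have hk' := Finset.mem_Ioc.1 hk
    rw [Finset.sum_ite_eq]
    have : m * k ∈ Finset.Ioc 0 N ↔ k ∈ Finset.Ioc 0 (N / m) := by
      rw [Finset.mem_Ioc, Finset.mem_Ioc, Nat.le_div_iff_mul_le hm'.1, mul_comm k]
      exact ⟨fun h => ⟨hk'.1, h.2⟩, fun h => ⟨Nat.mul_pos hm'.1 hk'.1, h.2⟩⟩
    simp only [this]
  rw [Finset.sum_congr rfl h2, ← Finset.sum_filter]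
  refine Finset.sum_congr ?_ fun _ _ => rfl
  ext k
  simp only [Finset.mem_filter, Finset.mem_Ioc]
  refine ⟨fun h => h.2, fun h => ⟨⟨h.1, h.2.trans (Nat.div_le_self N m)⟩, h⟩⟩

/-- Type I sums: the sum of maxima for a convolution. -/
theorem sumMaxDelta_mul_le (Ξ : CharSet) (c h : ArithmeticFunction ℂ) (N : ℕ) (Q : ℝ) :
    sumMaxDelta Ξ ⇑(c * h) N Q ≤
      ∑ m ∈ Finset.Ioc 0 N, ‖c m‖ * sumMaxDelta Ξ h ((N / m : ℕ) : ℝ) Q := by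
  refine sumMaxDelta_le_sum (Finset.Ioc 0 N) (fun m => ‖c m‖) (fun _ => h)
    (fun m => ((N / m : ℕ) : ℝ)) fun q hq a => ?_
  have : NeZero q := ⟨by omega⟩
  rw [deltaXi_eq_sum, Nat.floor_natCast, sum_Ioc_mul_apply]
  refine (norm_sum_le _ _).trans (Finset.sum_le_sum fun m _ => ?_)
  rw [norm_mul]
  refine mul_le_mul_of_nonneg_left ?_ (norm_nonneg _)
  -- For `m` coprime to `q` the class `a` becomes `u⁻¹ * a`. For other `m` the kernel vanishes
  -- identically.
  by_cases hm : IsUnit (m : ZMod q)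
  · obtain ⟨u, hu⟩ := hm
    simp_rw [deltaKernel_mul_of_isUnit Ξ a u hu]
    have := norm_deltaXi_le_maxDelta Ξ h ((N / m : ℕ) : ℝ) (u⁻¹ * a)
    rwa [deltaXi_eq_sum, Nat.floor_natCast] at this
  · simp_rw [deltaKernel_mul_of_not_isUnit Ξ a hm, mul_zero]
    rw [Finset.sum_const_zero, norm_zero]
    exact maxDelta_nonneg _ _ _ _

theorem sum_Ioc_mul_abel (F w : ℕ → ℂ) (N : ℕ) :
    ∑ n ∈ Finset.Ioc 0 N, F n * w n = w N * ∑ n ∈ Finset.Ioc 0 N, F n +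
      ∑ k ∈ Finset.range N, (w k - w (k + 1)) * ∑ n ∈ Finset.Ioc 0 k, F n := by
  induction N with
  | zero => simp
  | succ N ih =>
    rw [Finset.sum_Ioc_succ_top (Nat.zero_le N), Finset.sum_Ioc_succ_top (Nat.zero_le N),
      Finset.sum_range_succ, ih]
    ring

/-- Partial summation for the sum of maxima. -/
theorem sumMaxDelta_mul_weight_le (Ξ : CharSet) (h : ℕ → ℂ) (w : ℕ → ℝ) (N : ℕ) (Q : ℝ) :
    sumMaxDelta Ξ (fun n => h n * (w n : ℂ)) N Q ≤ |w N| * sumMaxDelta Ξ h N Q +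
      ∑ k ∈ Finset.range N, |w k - w (k + 1)| * sumMaxDelta Ξ h k Q := by
  have hpt : ∀ q, 1 ≤ q → ∀ a : (ZMod q)ˣ, ‖deltaXi Ξ (fun n => h n * (w n : ℂ)) N q a‖ ≤
      |w N| * maxDelta Ξ h N q + ∑ k ∈ Finset.range N, |w k - w (k + 1)| * maxDelta Ξ h k q := by
    intro q hq a
    have : NeZero q := ⟨by omega⟩
    rw [deltaXi_eq_sum, Nat.floor_natCast]
    simp_rw [mul_right_comm _ ((w _ : ℝ) : ℂ)]
    rw [sum_Ioc_mul_abel (fun n => h n * deltaKernel Ξ a n) (fun n => (w n : ℂ))]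
    have hk : ∀ k : ℕ, ‖∑ n ∈ Finset.Ioc 0 k, h n * deltaKernel Ξ a n‖ ≤ maxDelta Ξ h k q := by
      intro k
      have := norm_deltaXi_le_maxDelta Ξ h (k : ℝ) a
      rwa [deltaXi_eq_sum, Nat.floor_natCast] at this
    refine (norm_add_le _ _).trans (add_le_add ?_ ?_)
    · rw [norm_mul, Complex.norm_real, Real.norm_eq_abs]
      exact mul_le_mul_of_nonneg_left (hk N) (abs_nonneg _)
    · refine (norm_sum_le _ _).trans (Finset.sum_le_sum fun k _ => ?_)
      rw [norm_mul, ← Complex.ofReal_sub, Complex.norm_real, Real.norm_eq_abs]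
      exact mul_le_mul_of_nonneg_left (hk k) (abs_nonneg _)
  refine (sumMaxDelta_le_of_forall fun q hq a => hpt q (Finset.mem_Icc.1 hq).1 a).trans
    (le_of_eq ?_)
  rw [Finset.sum_add_distrib, ← Finset.mul_sum, Finset.sum_comm]
  simp_rw [sumMaxDelta_eq, Finset.mul_sum]

/-! ### Characters outside `Ξ` and reduction to primitive characters -/

theorem sum_units_zmod_eq {q : ℕ} [NeZero q] (F : ZMod q → ℂ) (hF : ∀ b, ¬ IsUnit b → F b = 0) :
    ∑ u : (ZMod q)ˣ, F u = ∑ b, F b := by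
  refine Finset.sum_of_injOn (fun u => (u : ZMod q)) (Units.val_injective.injOn)
    (fun _ _ => Finset.mem_coe.2 (Finset.mem_univ _)) ?_ fun _ _ => rfl
  intro b _ hb
  refine hF b fun hu => hb ?_
  obtain ⟨u, rfl⟩ := hu
  exact ⟨u, Finset.mem_coe.2 (Finset.mem_univ _), rfl⟩

theorem sum_units_mul_conj_eq_zero {q : ℕ} [NeZero q] {χ χ' : DirichletCharacter ℂ q}
    (h : χ' ≠ χ) : ∑ u : (ZMod q)ˣ, χ' (u : ZMod q) * conj (χ (u : ZMod q)) = 0 := by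
  have e : ∀ b : ZMod q, χ' b * conj (χ b) = (χ' * χ⁻¹) b := fun b => by
    rw [DirichletCharacter.conj_apply, MulChar.mul_apply]
  rw [sum_units_zmod_eq (fun b => χ' b * conj (χ b))
    fun b hb => by simp only [MulChar.map_nonunit _ hb, zero_mul]]
  simp_rw [e]
  refine MulChar.sum_eq_zero_of_ne_one ?_
  rw [Ne, mul_inv_eq_one]
  exact h

/-- By orthogonality the subtracted characters, all different from `χ`, contribute nothing, so the
transform of the kernel in `a` sees `χ` unchanged. -/
theorem sum_units_conj_mul_deltaKernel (Ξ : CharSet) {q : ℕ} [NeZero q]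
    {χ : DirichletCharacter ℂ q} (hχ : χ ∉ Ξ.induced q) (n : ℕ) :
    ∑ a : (ZMod q)ˣ, conj (χ (a : ZMod q)) * deltaKernel Ξ a n = conj (χ (n : ZMod q)) := by
  unfold deltaKernel
  simp_rw [mul_sub, Finset.sum_sub_distrib, mul_ite, mul_one, mul_zero]
  have h1 : (∑ a : (ZMod q)ˣ, if (n : ZMod q) = (a : ZMod q) then conj (χ (a : ZMod q)) else 0) =
      conj (χ (n : ZMod q)) := by
    by_cases hn : IsUnit (n : ZMod q)
    · obtain ⟨u, hu⟩ := hn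
      rw [← hu, Finset.sum_eq_single u]
      · simp
      · intro b _ hb
        rw [if_neg]
        intro h
        exact hb (Units.ext h).symm
      · simp
    · rw [MulChar.map_nonunit _ hn, map_zero]
      refine Finset.sum_eq_zero fun a _ => ?_
      rw [if_neg]
      intro h
      exact hn (h ▸ a.isUnit)
  have h2 : ∑ a : (ZMod q)ˣ, conj (χ (a : ZMod q)) * (1 / (q.totient : ℂ) *
      ∑ χ' ∈ Ξ.induced q, χ' (a : ZMod q) * conj (χ' (n : ZMod q))) = 0 := by
    have h3 : ∀ a : (ZMod q)ˣ, conj (χ (a : ZMod q)) * (1 / (q.totient : ℂ) *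
        ∑ χ' ∈ Ξ.induced q, χ' (a : ZMod q) * conj (χ' (n : ZMod q))) =
        ∑ χ' ∈ Ξ.induced q, 1 / (q.totient : ℂ) * conj (χ' (n : ZMod q)) *
          (χ' (a : ZMod q) * conj (χ (a : ZMod q))) := by
      intro a
      rw [Finset.mul_sum, Finset.mul_sum]
      exact Finset.sum_congr rfl fun χ' _ => by ring
    simp_rw [h3]
    rw [Finset.sum_comm]
    refine Finset.sum_eq_zero fun χ' hχ' => ?_
    rw [← Finset.mul_sum, sum_units_mul_conj_eq_zero, mul_zero]
    rintro rfl
    exact hχ hχ'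
  rw [h1, h2, sub_zero]

/-- Character sums outside `Ξ` are controlled by `Δ_Ξ`. -/
theorem norm_charSum_le_of_norm_deltaXi_le {Ξ : CharSet} {h : ℕ → ℂ} {X B : ℝ} {q : ℕ} [NeZero q]
    (hB : ∀ a : (ZMod q)ˣ, ‖deltaXi Ξ h X q a‖ ≤ B) {χ : DirichletCharacter ℂ q}
    (hχ : χ ∉ Ξ.induced q) : ‖charSum h X χ‖ ≤ q.totient * B := by
  have e : charSum h X χ = ∑ a : (ZMod q)ˣ, conj (χ (a : ZMod q)) * deltaXi Ξ h X q a := by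
    unfold charSum
    simp_rw [deltaXi_eq_sum, Finset.mul_sum]
    rw [Finset.sum_comm]
    refine Finset.sum_congr rfl fun n _ => ?_
    rw [← sum_units_conj_mul_deltaKernel Ξ hχ, Finset.mul_sum]
    exact Finset.sum_congr rfl fun a _ => by ring
  rw [e]
  refine (norm_sum_le _ _).trans ((Finset.sum_le_card_nsmul _ _ B fun a _ => ?_).trans ?_)
  · rw [norm_mul, Complex.norm_conj]
    exact (mul_le_of_le_one_left (norm_nonneg _) (χ.norm_le_one _)).trans (hB a)
  · rw [Finset.card_univ, ZMod.card_units_eq_totient, nsmul_eq_mul]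

/-- Orthogonality writes the indicator of the class as a sum over all characters. The correction
term removes exactly those in `Ξ_q`. -/
theorem deltaKernel_eq_sum_compl (Ξ : CharSet) {q : ℕ} [NeZero q] (a : (ZMod q)ˣ) (n : ℕ)
    [DecidableEq (DirichletCharacter ℂ q)] :
    deltaKernel Ξ a n = 1 / (Nat.totient q : ℂ) *
      ∑ χ ∈ (Ξ.induced q)ᶜ, χ (a : ZMod q) * conj (χ (n : ZMod q)) := by
  have hφ : (q.totient : ℂ) ≠ 0 := by exact_mod_cast (Nat.totient_pos.2 (NeZero.pos q)).ne'
  have h1 := DirichletCharacter.sum_mul_conj (a : ZMod q) (n : ZMod q)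
  rw [← Finset.sum_add_sum_compl (Ξ.induced q)] at h1
  have h2 : (if IsUnit (n : ZMod q) ∧ (a : ZMod q) = (n : ZMod q) then (q.totient : ℂ) else 0) =
      q.totient * (if (n : ZMod q) = (a : ZMod q) then 1 else 0) := by
    by_cases h : (n : ZMod q) = (a : ZMod q)
    · simp [h]
    · simp [h, Ne.symm h]
  rw [h2] at h1
  unfold deltaKernel
  field_simp
  linear_combination -h1

theorem norm_deltaXi_le_sum_charSum (Ξ : CharSet) (h : ℕ → ℂ) (X : ℝ) {q : ℕ} [NeZero q]
    (a : (ZMod q)ˣ) [DecidableEq (DirichletCharacter ℂ q)] :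
    ‖deltaXi Ξ h X q a‖ ≤ 1 / (q.totient : ℝ) * ∑ χ ∈ (Ξ.induced q)ᶜ, ‖charSum h X χ‖ := by
  have e : deltaXi Ξ h X q a =
      1 / (Nat.totient q : ℂ) * ∑ χ ∈ (Ξ.induced q)ᶜ, χ (a : ZMod q) * charSum h X χ := by
    rw [deltaXi_eq_sum]
    simp_rw [deltaKernel_eq_sum_compl, charSum, Finset.mul_sum]
    rw [Finset.sum_comm]
    refine Finset.sum_congr rfl fun χ _ => ?_
    rw [Finset.Icc_one_eq_Ioc_zero]
    exact Finset.sum_congr rfl fun n _ => by ring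
  rw [e, norm_mul, norm_div, norm_one, Complex.norm_natCast]
  refine mul_le_mul_of_nonneg_left ((norm_sum_le _ _).trans (Finset.sum_le_sum fun χ _ => ?_))
    (by positivity)
  rw [norm_mul]
  exact mul_le_of_le_one_left (norm_nonneg _) (χ.norm_le_one _)

/-- The sum of `h(n) \bar ξ(n)` over `n ≤ N`. -/
noncomputable def twistedSum (h : ℕ → ℂ) (N : ℕ) {r : ℕ} (ξ : DirichletCharacter ℂ r) : ℂ :=
  ∑ n ∈ Finset.Ioc 0 N, h n * conj (ξ (n : ZMod r))

theorem charSum_eq_twistedSum (h : ℕ → ℂ) (X : ℝ) {r : ℕ} (ξ : DirichletCharacter ℂ r) :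
    charSum h X ξ = twistedSum h ⌊X⌋₊ ξ := rfl

theorem changeLevel_natCast {r s : ℕ} [NeZero (r * s)] (ξ : DirichletCharacter ℂ r) (n : ℕ)
    (hd : r ∣ r * s) : DirichletCharacter.changeLevel hd ξ (n : ZMod (r * s)) =
      if n.Coprime s then ξ (n : ZMod r) else 0 := by
  by_cases h : IsUnit (n : ZMod (r * s))
  · have hc := (ZMod.isUnit_iff_coprime n (r * s)).1 h
    rw [if_pos (Nat.Coprime.coprime_mul_left_right hc)]
    obtain ⟨u, hu⟩ := h
    rw [← hu, DirichletCharacter.changeLevel_eq_cast_of_dvd, hu, ZMod.cast_natCast hd]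
  · rw [MulChar.map_nonunit _ h]
    split_ifs with hs
    · refine (MulChar.map_nonunit _ fun hr => h ?_).symm
      exact (ZMod.isUnit_iff_coprime n (r * s)).2
        (Nat.Coprime.mul_right ((ZMod.isUnit_iff_coprime n r).1 hr) hs)
    · rfl

theorem charSum_changeLevel (h : ArithmeticFunction ℂ) (X : ℝ) {r s : ℕ} [NeZero (r * s)]
    (ξ : DirichletCharacter ℂ r) (hd : r ∣ r * s) :
    charSum h X (DirichletCharacter.changeLevel hd ξ) =
      twistedSum (restrict (fun n => n.Coprime s) h) ⌊X⌋₊ ξ := by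
  unfold charSum twistedSum
  rw [Finset.Icc_one_eq_Ioc_zero]
  refine Finset.sum_congr rfl fun n _ => ?_
  rw [changeLevel_natCast, ArithmeticFunction.restrict_apply]
  split_ifs <;> simp

/-- Induction of characters is transitive: a member of `Ξ` inducing the primitive character would
induce `χ` as well. -/
theorem primitiveCharacter_notMem_induced {Ξ : CharSet} {q : ℕ} {χ : DirichletCharacter ℂ q}
    (hχ : χ ∉ Ξ.induced q) : χ.primitiveCharacter ∉ Ξ.induced χ.conductor := by
  intro h
  obtain ⟨ξ, hξ, hd, e⟩ := (CharSet.mem_induced _ _ _).1 h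
  refine hχ ((CharSet.mem_induced _ _ _).2 ⟨ξ, hξ, hd.trans χ.conductor_dvd_level, ?_⟩)
  rw [DirichletCharacter.changeLevel_trans _ hd χ.conductor_dvd_level, ← e,
    DirichletCharacter.changeLevel_primitiveCharacter]

open Classical in
/-- The primitive characters modulo `r` that are not induced by members of `Ξ`. -/
noncomputable def CharSet.outerPrimitiveChars (Ξ : CharSet) (r : ℕ) :
    Finset (DirichletCharacter ℂ r) :=
  (primitiveChars r).filter fun ξ => ξ ∉ Ξ.induced r

/-- A character is determined by its conductor `r` and its primitive character. Its values are those
of the primitive character on integers coprime to `q / r`, and zero elsewhere. -/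
theorem sum_norm_charSum_le (Ξ : CharSet) (h : ArithmeticFunction ℂ) (X : ℝ) {q : ℕ} [NeZero q]
    [DecidableEq (DirichletCharacter ℂ q)] :
    ∑ χ ∈ (Ξ.induced q)ᶜ, ‖charSum h X χ‖ ≤ ∑ r ∈ q.divisors, ∑ ξ ∈ Ξ.outerPrimitiveChars r,
      ‖twistedSum (restrict (fun n => n.Coprime (q / r)) h) ⌊X⌋₊ ξ‖ := by
  classical
  rw [Finset.sum_sigma']
  set i : DirichletCharacter ℂ q → Σ r : ℕ, DirichletCharacter ℂ r :=
    fun χ => ⟨χ.conductor, χ.primitiveCharacter⟩ with hi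
  -- A left inverse of `i`, which proves injectivity. The default value `1` is never reached on the
  -- image of `i`.
  set Φ : (Σ r : ℕ, DirichletCharacter ℂ r) → DirichletCharacter ℂ q :=
    fun p => if hd : p.1 ∣ q then DirichletCharacter.changeLevel hd p.2 else 1 with hΦ
  have hΦi : ∀ χ, Φ (i χ) = χ := by
    intro χ
    simp only [hΦ, hi]
    rw [dif_pos χ.conductor_dvd_level, DirichletCharacter.changeLevel_primitiveCharacter]
  have hinj : Set.InjOn i ((Ξ.induced q)ᶜ : Finset _) := fun χ _ χ' _ h => by
    rw [← hΦi χ, ← hΦi χ', h]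
  set G : (Σ r : ℕ, DirichletCharacter ℂ r) → ℝ := fun p =>
    ‖twistedSum (restrict (fun n => n.Coprime (q / p.1)) h) ⌊X⌋₊ p.2‖ with hG
  have hterm : ∀ χ : DirichletCharacter ℂ q, ‖charSum h X χ‖ = G (i χ) := by
    intro χ
    simp only [hG, hi]
    -- The modulus is kept general so that `q` can be replaced by `r * s` inside the dependent
    -- types.
    have key : ∀ (r s : ℕ) (ξ : DirichletCharacter ℂ r) (hd : r ∣ q), q = r * s →
        charSum h X (DirichletCharacter.changeLevel hd ξ) =
          twistedSum (restrict (fun n => n.Coprime s) h) ⌊X⌋₊ ξ := by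
      rintro r s ξ hd rfl
      exact charSum_changeLevel h X ξ hd
    rw [← key χ.conductor (q / χ.conductor) χ.primitiveCharacter χ.conductor_dvd_level
      (Nat.mul_div_cancel' χ.conductor_dvd_level).symm,
      DirichletCharacter.changeLevel_primitiveCharacter]
  calc _ = ∑ p ∈ ((Ξ.induced q)ᶜ : Finset _).image i, G p := by
        rw [Finset.sum_image hinj]
        exact Finset.sum_congr rfl fun χ _ => hterm χ
    _ ≤ _ := by
        refine Finset.sum_le_sum_of_subset_of_nonneg ?_ fun _ _ _ => norm_nonneg _
        intro p hp
        obtain ⟨χ, hχ, rfl⟩ := Finset.mem_image.1 hp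
        rw [Finset.mem_compl] at hχ
        refine Finset.mem_sigma.2 ⟨Nat.mem_divisors.2 ⟨χ.conductor_dvd_level, NeZero.ne q⟩, ?_⟩
        exact Finset.mem_filter.2 ⟨mem_primitiveChars.2 χ.primitiveCharacter_isPrimitive,
          primitiveCharacter_notMem_induced hχ⟩

/-- Substitute `q = rs` and drop the condition `rs ≤ Q`, which only adds nonnegative terms. -/
theorem sum_Icc_sum_divisors_le {Q : ℕ} (F : ℕ → ℕ → ℝ) (hF : ∀ r s, 0 ≤ F r s) :
    ∑ q ∈ Finset.Icc 1 Q, ∑ r ∈ q.divisors, F r (q / r) ≤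
      ∑ s ∈ Finset.Icc 1 Q, ∑ r ∈ Finset.Icc 1 Q, F r s := by
  rw [Finset.sum_sigma', ← Finset.sum_product' (f := fun s r => F r s)]
  set i : (Σ _ : ℕ, ℕ) → ℕ × ℕ := fun p => (p.1 / p.2, p.2) with hi
  have hinj : Set.InjOn i ((Finset.Icc 1 Q).sigma fun q => q.divisors) := by
    rintro ⟨q, r⟩ h ⟨q', r'⟩ h' e
    simp only [Finset.coe_sigma, Set.mem_sigma_iff, Finset.mem_coe, Nat.mem_divisors] at h h'
    simp only [hi, Prod.mk.injEq] at e
    obtain ⟨e1, rfl⟩ := e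
    have : q = q' := by
      rw [← Nat.div_mul_cancel h.2.1, ← Nat.div_mul_cancel h'.2.1, e1]
    rw [this]
  calc _ = ∑ p ∈ ((Finset.Icc 1 Q).sigma fun q => q.divisors).image i, F p.2 p.1 := by
        rw [Finset.sum_image hinj]
    _ ≤ _ := by
        refine Finset.sum_le_sum_of_subset_of_nonneg ?_ fun _ _ _ => hF _ _
        intro p hp
        obtain ⟨⟨q, r⟩, h, rfl⟩ := Finset.mem_image.1 hp
        obtain ⟨h1, h2⟩ := Finset.mem_sigma.1 h
        simp only [Finset.mem_Icc, Nat.mem_divisors] at h1 h2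
        have hr : 0 < r := Nat.pos_of_dvd_of_pos h2.1 (by omega)
        have hrq : r ≤ q := Nat.le_of_dvd (by omega) h2.1
        simp only [hi, Finset.mem_product, Finset.mem_Icc]
        exact ⟨⟨Nat.div_pos hrq hr, (Nat.div_le_self q r).trans h1.2⟩, hr, hrq.trans h1.2⟩

/-- The sum of maxima is bounded by sums over primitive characters outside `Ξ`. -/
theorem sumMaxDelta_le_sum_outerPrimitiveChars (Ξ : CharSet) (h : ArithmeticFunction ℂ) (N : ℕ)
    (Q : ℝ) : sumMaxDelta Ξ h N Q ≤ ∑ s ∈ Finset.Icc 1 ⌊Q⌋₊, 1 / (s.totient : ℝ) *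
      ∑ r ∈ Finset.Icc 1 ⌊Q⌋₊, 1 / (r.totient : ℝ) * ∑ ξ ∈ Ξ.outerPrimitiveChars r,
        ‖twistedSum (restrict (fun n => n.Coprime s) h) N ξ‖ := by
  classical
  set G : ℕ → ℕ → ℝ := fun r s => ∑ ξ ∈ Ξ.outerPrimitiveChars r,
        ‖twistedSum (restrict (fun n => n.Coprime s) h) N ξ‖ with hG
  have hG0 : ∀ r s, 0 ≤ G r s := fun r s => by positivity
  have hpt : ∀ q ∈ Finset.Icc 1 ⌊Q⌋₊, ∀ a : (ZMod q)ˣ, ‖deltaXi Ξ h N q a‖ ≤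
      ∑ r ∈ q.divisors, 1 / ((q / r).totient : ℝ) * (1 / (r.totient : ℝ) * G r (q / r)) := by
    intro q hq a
    have hq1 := (Finset.mem_Icc.1 hq).1
    have : NeZero q := ⟨by omega⟩
    refine (norm_deltaXi_le_sum_charSum Ξ h N a).trans ?_
    refine (mul_le_mul_of_nonneg_left (sum_norm_charSum_le Ξ h N) (by positivity)).trans ?_
    rw [Nat.floor_natCast, Finset.mul_sum]
    refine Finset.sum_le_sum fun r hr => ?_
    have hd := (Nat.mem_divisors.1 hr).1
    have hr0 : 0 < r := Nat.pos_of_dvd_of_pos hd (by omega)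
    have hs0 : 0 < q / r := Nat.div_pos (Nat.le_of_dvd (by omega) hd) hr0
    rw [← mul_assoc]
    refine mul_le_mul_of_nonneg_right ?_ (hG0 _ _)
    rw [one_div_mul_one_div]
    -- Supermultiplicativity of `φ` separates the weight into `1/φ(s)` and `1/φ(r)`.
    have h1 : (q / r).totient * r.totient ≤ q.totient := by
      conv_rhs => rw [← Nat.div_mul_cancel hd]
      exact Nat.totient_super_multiplicative _ _
    refine one_div_le_one_div_of_le ?_ (by exact_mod_cast h1)
    have := Nat.totient_pos.2 hr0
    have := Nat.totient_pos.2 hs0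
    positivity
  refine (sumMaxDelta_le_of_forall hpt).trans ?_
  refine (sum_Icc_sum_divisors_le
    (fun r s => 1 / (s.totient : ℝ) * (1 / (r.totient : ℝ) * G r s))
    fun r s => by have := hG0 r s; positivity).trans (le_of_eq ?_)
  simp_rw [← Finset.mul_sum]
  rfl

/-! ### Character sums over integers coprime to `s` -/

/-- The completely multiplicative function `n ↦ n^{-1/2}`. -/
noncomputable def invSqrtHom : ℕ →* ℝ where
  toFun n := 1 / Real.sqrt n
  map_one' := by simp
  map_mul' m n := by
    rw [Nat.cast_mul, Real.sqrt_mul (Nat.cast_nonneg m)]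
    rw [one_div_mul_one_div]

theorem invSqrtHom_apply (n : ℕ) : invSqrtHom n = 1 / Real.sqrt n := rfl

theorem invSqrtHom_nonneg (n : ℕ) : 0 ≤ invSqrtHom n := by
  rw [invSqrtHom_apply]
  positivity

/-- Since `1/√2 < 3/4`, each Euler factor `(1 - p^(-1/2))⁻¹` is at most `4`. -/
theorem invSqrtHom_le_of_prime {p : ℕ} (hp : p.Prime) : invSqrtHom p ≤ 3 / 4 := by
  rw [invSqrtHom_apply]
  have h2 : (2 : ℝ) ≤ p := by exact_mod_cast hp.two_le
  have h1 : 4 / 3 ≤ Real.sqrt p := Real.le_sqrt_of_sq_le (by norm_num; linarith)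
  rw [div_le_div_iff₀ (by linarith) (by norm_num)]
  linarith

/-- Euler product: the full series of `d^(-1/2)` over integers composed of primes of `s` is the
finite product of `(1 - p^(-1/2))⁻¹`. -/
theorem sum_smooth_invSqrt_le {s : ℕ} (hs : 0 < s) (N : ℕ) [DecidablePred (IsSmoothFor s)] :
    ∑ d ∈ Finset.Ioc 0 N with IsSmoothFor s d, 1 / Real.sqrt d ≤ 4 ^ s.primeFactors.card := by
  obtain ⟨hsum, hhas⟩ :=
    EulerProduct.summable_and_hasSum_factoredNumbers_prod_filter_prime_geometric
      (f := invSqrtHom) (fun {p} hp => by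
        rw [Real.norm_of_nonneg (invSqrtHom_nonneg p)]
        linarith [invSqrtHom_le_of_prime hp]) s.primeFactors
  have hmem : ∀ d ∈ (Finset.Ioc 0 N).filter (IsSmoothFor s),
      d ∈ Nat.factoredNumbers s.primeFactors := by
    intro d hd
    obtain ⟨h1, h2⟩ := Finset.mem_filter.1 hd
    rw [Finset.mem_Ioc] at h1
    refine Nat.mem_factoredNumbers.2 ⟨by omega, fun p hp => ?_⟩
    have hp' := Nat.prime_of_mem_primeFactorsList hp
    exact Nat.mem_primeFactors.2 ⟨hp', h2 p hp' (Nat.dvd_of_mem_primeFactorsList hp), by omega⟩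
  have hle : ∑ d ∈ Finset.Ioc 0 N with IsSmoothFor s d, 1 / Real.sqrt d ≤
      ∏ p ∈ s.primeFactors with p.Prime, (1 - invSqrtHom p)⁻¹ := by
    rw [← Finset.sum_attach]
    have hinj : Function.Injective
        (fun d : {x // x ∈ (Finset.Ioc 0 N).filter (IsSmoothFor s)} =>
          (⟨d.1, hmem d.1 d.2⟩ : Nat.factoredNumbers s.primeFactors)) := by
      intro a b h
      exact Subtype.ext (by simpa using h)
    have := hhas.summable.sum_le_tsum ((Finset.univ.map ⟨_, hinj⟩))
      (fun d _ => invSqrtHom_nonneg _)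
    rw [hhas.tsum_eq, Finset.sum_map] at this
    exact this
  refine hle.trans ?_
  calc _ ≤ ∏ p ∈ s.primeFactors with p.Prime, (4 : ℝ) := by
        refine Finset.prod_le_prod (fun p hp => ?_) fun p hp => ?_
        · have := invSqrtHom_le_of_prime (Finset.mem_filter.1 hp).2
          exact inv_nonneg.2 (by linarith)
        · have := invSqrtHom_le_of_prime (Finset.mem_filter.1 hp).2
          rw [inv_le_comm₀ (by linarith) (by norm_num)]
          linarith
    _ = 4 ^ (s.primeFactors.filter Nat.Prime).card := by rw [Finset.prod_const]
    _ ≤ 4 ^ s.primeFactors.card :=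
        pow_le_pow_right₀ (by norm_num) (Finset.card_filter_le _ _)

/-- Rankin's trick: `1/d ≤ 1/(√D √d)` for `d > D`. -/
theorem sum_smooth_tail_le {s : ℕ} (hs : 0 < s) (N : ℕ) {D : ℕ} (hD : 0 < D)
    [DecidablePred (IsSmoothFor s)] :
    ∑ d ∈ Finset.Ioc 0 N with IsSmoothFor s d ∧ D < d, 1 / (d : ℝ) ≤
      4 ^ s.primeFactors.card / Real.sqrt D := by
  have hD' : (0 : ℝ) < Real.sqrt D := Real.sqrt_pos.2 (by exact_mod_cast hD)
  rw [le_div_iff₀ hD', Finset.sum_mul]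
  refine le_trans ?_ (sum_smooth_invSqrt_le hs N)
  rw [← Finset.filter_filter]
  refine (Finset.sum_le_sum fun d hd => ?_).trans
    (Finset.sum_le_sum_of_subset_of_nonneg (Finset.filter_subset _ _) fun _ _ _ => by positivity)
  have hd' := (Finset.mem_filter.1 hd).2
  have hd0 : (0 : ℝ) < d := by
    have : 0 < d := by omega
    exact_mod_cast this
  have h1 : Real.sqrt D ≤ Real.sqrt d := Real.sqrt_le_sqrt (by exact_mod_cast hd'.le)
  have h2 : 0 < Real.sqrt d := Real.sqrt_pos.2 hd0
  rw [div_mul_eq_mul_div, one_mul, div_le_div_iff₀ hd0 h2, one_mul]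
  calc Real.sqrt D * Real.sqrt d ≤ Real.sqrt d * Real.sqrt d := by gcongr
    _ = d := Real.mul_self_sqrt hd0.le

/-- The number of prime factors of `s` is small compared with `log s`. -/
theorem four_pow_card_primeFactors_le {η : ℝ} (hη : 0 < η) :
    ∃ c : ℝ, 0 < c ∧ ∀ s : ℕ, 0 < s → (4 : ℝ) ^ s.primeFactors.card ≤ c * (s : ℝ) ^ η := by
  -- Beyond `P` every prime satisfies `4 ≤ p^η`, so the large prime factors contribute at most
  -- `s^η`. Those below `P` give at most `4^P`.
  obtain ⟨P, hP⟩ := exists_nat_ge ((4 : ℝ) ^ (1 / η))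
  refine ⟨4 ^ P, by positivity, fun s hs => ?_⟩
  have hlarge : ∀ p : ℕ, P ≤ p → (4 : ℝ) ≤ (p : ℝ) ^ η := by
    intro p hp
    have h1 : (4 : ℝ) ^ (1 / η) ≤ p := hP.trans (by exact_mod_cast hp)
    calc (4 : ℝ) = ((4 : ℝ) ^ (1 / η)) ^ η := by
          rw [← Real.rpow_mul (by norm_num), one_div_mul_cancel hη.ne', Real.rpow_one]
      _ ≤ (p : ℝ) ^ η := Real.rpow_le_rpow (by positivity) h1 hη.le
  have hsplit := Finset.card_filter_add_card_filter_not (s := s.primeFactors) (fun p => p < P)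
  rw [← hsplit, pow_add]
  refine mul_le_mul ?_ ?_ (by positivity) (by positivity)
  · refine pow_le_pow_right₀ (by norm_num) ?_
    exact (Finset.card_le_card (t := Finset.range P) fun p hp =>
      Finset.mem_range.2 (Finset.mem_filter.1 hp).2).trans (Finset.card_range P).le
  · have hprod : ((∏ p ∈ s.primeFactors.filter (fun p => ¬ p < P), p : ℕ) : ℝ) ≤ s := by
      have h1 : (∏ p ∈ s.primeFactors.filter (fun p => ¬ p < P), p) ∣ s :=
        (Finset.prod_dvd_prod_of_subset _ _ _ (Finset.filter_subset _ _)).trans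
          (Nat.prod_primeFactors_dvd s)
      exact_mod_cast Nat.le_of_dvd hs h1
    calc (4 : ℝ) ^ (s.primeFactors.filter (fun p => ¬ p < P)).card
        = ∏ p ∈ s.primeFactors.filter (fun p => ¬ p < P), (4 : ℝ) := by rw [Finset.prod_const]
      _ ≤ ∏ p ∈ s.primeFactors.filter (fun p => ¬ p < P), (p : ℝ) ^ η := by
          refine Finset.prod_le_prod (fun _ _ => by norm_num) fun p hp => hlarge p ?_
          exact not_lt.1 (Finset.mem_filter.1 hp).2
      _ = ((∏ p ∈ s.primeFactors.filter (fun p => ¬ p < P), p : ℕ) : ℝ) ^ η := by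
          push_cast
          exact Real.finsetProd_rpow _ _ (fun _ _ => Nat.cast_nonneg _) η
      _ ≤ (s : ℝ) ^ η := Real.rpow_le_rpow (by positivity) hprod hη.le

theorem twistedSum_mul (c h : ArithmeticFunction ℂ) (N : ℕ) {r : ℕ} (ξ : DirichletCharacter ℂ r) :
    twistedSum ⇑(c * h) N ξ =
      ∑ m ∈ Finset.Ioc 0 N, c m * conj (ξ (m : ZMod r)) * twistedSum h (N / m) ξ := by
  unfold twistedSum
  rw [sum_Ioc_mul_apply]
  refine Finset.sum_congr rfl fun m _ => ?_
  rw [mul_assoc, Finset.mul_sum (a := conj (ξ (m : ZMod r)))]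
  refine congrArg _ (Finset.sum_congr rfl fun n _ => ?_)
  rw [Nat.cast_mul, map_mul, map_mul]
  ring

theorem norm_conj_char_le_one {r : ℕ} (ξ : DirichletCharacter ℂ r) (a : ZMod r) :
    ‖conj (ξ a)‖ ≤ 1 := by
  rw [Complex.norm_conj]
  exact ξ.norm_le_one a

theorem norm_twistedSum_le {h : ℕ → ℂ} {N : ℕ} {B : ℝ} (hB : ∀ n ∈ Finset.Ioc 0 N, ‖h n‖ ≤ B)
    {r : ℕ} (ξ : DirichletCharacter ℂ r) : ‖twistedSum h N ξ‖ ≤ N * B := by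
  refine (norm_sum_le _ _).trans ((Finset.sum_le_card_nsmul _ _ B fun n hn => ?_).trans ?_)
  · rw [norm_mul]
    exact (mul_le_of_le_one_right (norm_nonneg _) (norm_conj_char_le_one _ _)).trans (hB n hn)
  · rw [Nat.card_Ioc, nsmul_eq_mul, Nat.sub_zero]

theorem norm_twistedSum_mul_le (c h : ArithmeticFunction ℂ) (N : ℕ) {r : ℕ}
    (ξ : DirichletCharacter ℂ r) :
    ‖twistedSum ⇑(c * h) N ξ‖ ≤ ∑ m ∈ Finset.Ioc 0 N, ‖c m‖ * ‖twistedSum h (N / m) ξ‖ := by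
  rw [twistedSum_mul]
  refine (norm_sum_le _ _).trans (Finset.sum_le_sum fun m _ => ?_)
  rw [norm_mul, norm_mul]
  refine mul_le_mul_of_nonneg_right ?_ (norm_nonneg _)
  exact mul_le_of_le_one_right (norm_nonneg _) (norm_conj_char_le_one _ _)

theorem LogDerivBounded.norm_restrict_le_one {f Lam : ArithmeticFunction ℂ}
    (hf : LogDerivBounded f Lam) (p : ℕ → Prop) (n : ℕ) : ‖restrict p f n‖ ≤ 1 :=
  (ArithmeticFunction.norm_restrict_le p f n).trans (hf.norm_apply_le_one n)

/-- Passing from character sums over all integers to sums over the integers coprime to `s`. -/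
theorem LogDerivBounded.norm_twistedSum_coprime_le {f g Lam : ArithmeticFunction ℂ}
    (hf : LogDerivBounded f Lam) (hfg : f * g = 1) {s : ℕ} (hs : 0 < s) {r : ℕ}
    (ξ : DirichletCharacter ℂ r) {Y D y N : ℕ} {η : ℝ} (hη : 0 ≤ η) (hD : 0 < D)
    (hF : ∀ k, Y ≤ k → k ≤ N → ‖twistedSum f k ξ‖ ≤ k * η) (hy : Y * D ≤ y) (hyN : y ≤ N) :
    ‖twistedSum (restrict (fun n => n.Coprime s) f) y ξ‖ ≤
      y * (η * (1 + Real.log y) + 4 ^ s.primeFactors.card / Real.sqrt D) := by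
  classical
  rw [hf.restrict_coprime_eq hfg s]
  have hg := hf.inverse hfg
  refine (norm_twistedSum_mul_le _ _ _ _).trans ?_
  have hterm : ∀ d ∈ Finset.Ioc 0 y, ‖restrict (IsSmoothFor s) g d‖ * ‖twistedSum f (y / d) ξ‖ ≤
      y * η * (1 / d) + if IsSmoothFor s d ∧ D < d then y * (1 / (d : ℝ)) else 0 := by
    intro d hd
    have hd' := Finset.mem_Ioc.1 hd
    have hdiv : ((y / d : ℕ) : ℝ) ≤ y * (1 / d) := by
      rw [mul_one_div]
      exact Nat.cast_div_le
    have h0 : 0 ≤ y * η * (1 / (d : ℝ)) := by positivity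
    by_cases hsm : IsSmoothFor s d
    · have h1 : ‖restrict (IsSmoothFor s) g d‖ * ‖twistedSum f (y / d) ξ‖ ≤
          ‖twistedSum f (y / d) ξ‖ :=
        mul_le_of_le_one_left (norm_nonneg _) (hg.norm_restrict_le_one _ _)
      -- For `d > D` the inner sum is bounded trivially and Rankin's tail provides the saving. For
      -- `d ≤ D` the length `y / d` is still at least `Y`, so the hypothesis on character sums
      -- applies.
      by_cases hdD : D < d
      · rw [if_pos ⟨hsm, hdD⟩]
        have h2 : ‖twistedSum f (y / d) ξ‖ ≤ ((y / d : ℕ) : ℝ) * 1 :=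
          norm_twistedSum_le (fun n _ => hf.norm_apply_le_one n) ξ
        linarith
      · rw [if_neg fun h => hdD h.2]
        have h2 := hF (y / d) ((Nat.le_div_iff_mul_le hd'.1).2
          ((Nat.mul_le_mul_left Y (not_lt.1 hdD)).trans hy)) ((Nat.div_le_self _ _).trans hyN)
        have h3 := mul_le_mul_of_nonneg_right hdiv hη
        linarith
    · rw [ArithmeticFunction.restrict_of_neg hsm, norm_zero, zero_mul, if_neg fun h => hsm h.1]
      linarith
  refine (Finset.sum_le_sum hterm).trans ?_
  rw [Finset.sum_add_distrib, ← Finset.mul_sum, ← Finset.sum_filter, ← Finset.mul_sum]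
  have h1 := mul_le_mul_of_nonneg_left (sum_Ioc_one_div_le y)
    (mul_nonneg (Nat.cast_nonneg (α := ℝ) y) hη)
  have h2 := mul_le_mul_of_nonneg_left (sum_smooth_tail_le hs y hD) (Nat.cast_nonneg (α := ℝ) y)
  linarith

/-! ### Bilinear sums against a single character -/

/-- Dirichlet's hyperbola method. -/
theorem sum_hyperbola_eq (α β : ℕ → ℂ) {N Z : ℕ} (hZ : 0 < Z) :
    ∑ m ∈ Finset.Ioc 0 N, α m * ∑ n ∈ Finset.Ioc 0 (N / m), β n =
      ∑ n ∈ Finset.Ioc 0 Z, β n * ∑ m ∈ Finset.Ioc 0 (N / n), α m +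
      ∑ m ∈ Finset.Ioc 0 (N / Z), α m *
        (∑ n ∈ Finset.Ioc 0 (N / m), β n - ∑ n ∈ Finset.Ioc 0 Z, β n) := by
  have h1 : ∑ n ∈ Finset.Ioc 0 Z, β n * ∑ m ∈ Finset.Ioc 0 (N / n), α m =
      ∑ m ∈ Finset.Ioc 0 N, α m * ∑ n ∈ Finset.Ioc 0 (min (N / m) Z), β n := by
    simp_rw [Finset.mul_sum]
    refine Finset.sum_comm' (fun n m => ?_) |>.trans
      (Finset.sum_congr rfl fun m _ => Finset.sum_congr rfl fun n _ => mul_comm _ _)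
    simp only [Finset.mem_Ioc, le_min_iff]
    constructor
    · rintro ⟨⟨hn, hnZ⟩, hm, hmn⟩
      have h := (Nat.le_div_iff_mul_le hn).1 hmn
      exact ⟨⟨hn, (Nat.le_div_iff_mul_le hm).2 (by rwa [mul_comm]), hnZ⟩, hm,
        hmn.trans (Nat.div_le_self _ _)⟩
    · rintro ⟨⟨hn, hmn, hnZ⟩, hm, _⟩
      have h := (Nat.le_div_iff_mul_le hm).1 hmn
      exact ⟨⟨hn, hnZ⟩, hm, (Nat.le_div_iff_mul_le hn).2 (by rwa [mul_comm])⟩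
  have h2 : ∑ m ∈ Finset.Ioc 0 (N / Z), α m *
        (∑ n ∈ Finset.Ioc 0 (N / m), β n - ∑ n ∈ Finset.Ioc 0 Z, β n) =
      ∑ m ∈ Finset.Ioc 0 N, α m * (∑ n ∈ Finset.Ioc 0 (N / m), β n -
        ∑ n ∈ Finset.Ioc 0 (min (N / m) Z), β n) := by
    have hsub : Finset.Ioc 0 (N / Z) ⊆ Finset.Ioc 0 N := fun m hm =>
      Finset.mem_Ioc.2 ⟨(Finset.mem_Ioc.1 hm).1,
        (Finset.mem_Ioc.1 hm).2.trans (Nat.div_le_self _ _)⟩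
    rw [← Finset.sum_subset hsub]
    · refine Finset.sum_congr rfl fun m hm => ?_
      have hm' := Finset.mem_Ioc.1 hm
      have : Z ≤ N / m := by
        have := (Nat.le_div_iff_mul_le hZ).1 hm'.2
        exact (Nat.le_div_iff_mul_le hm'.1).2 (by rwa [mul_comm])
      rw [min_eq_right this]
    · intro m hm hm'
      have h3 := Finset.mem_Ioc.1 hm
      have : N / m ≤ Z := by
        by_contra hc
        refine hm' (Finset.mem_Ioc.2 ⟨h3.1, (Nat.le_div_iff_mul_le hZ).2 ?_⟩)
        have := (Nat.le_div_iff_mul_le h3.1).1 (not_le.1 hc).le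
        rwa [mul_comm]
      rw [min_eq_left this, sub_self, mul_zero]
  rw [h1, h2, ← Finset.sum_add_distrib]
  refine Finset.sum_congr rfl fun m _ => ?_
  ring

/-- Cutting at `Z = ⌊√N⌋` makes every inner sum at least `Z` long, in either order of summation, so
cancellation is required only beyond `√N`. The two sums of `1/n` and `1/m` cost one logarithm. -/
theorem norm_sum_hyperbola_le {α β : ℕ → ℂ} {N : ℕ} (hN : 0 < N) {B ηa ηb : ℝ} (hB : 0 ≤ B)
    (hηa : 0 ≤ ηa) (hηb : 0 ≤ ηb) (hα : ∀ n, ‖α n‖ ≤ 1) (hβ : ∀ n ≤ N, ‖β n‖ ≤ B)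
    (hTα : ∀ y, Nat.sqrt N ≤ y → y ≤ N → ‖∑ m ∈ Finset.Ioc 0 y, α m‖ ≤ y * ηa)
    (hTβ : ∀ y, Nat.sqrt N ≤ y → y ≤ N → ‖∑ m ∈ Finset.Ioc 0 y, β m‖ ≤ y * ηb) :
    ‖∑ m ∈ Finset.Ioc 0 N, α m * ∑ n ∈ Finset.Ioc 0 (N / m), β n‖ ≤
      N * (1 + Real.log N) * (B * ηa + 2 * ηb) := by
  set Z := Nat.sqrt N with hZ
  have hZ0 : 0 < Z := Nat.sqrt_pos.2 hN
  have hZN : Z ≤ N := Nat.sqrt_le_self N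
  have hZZ : Z * Z ≤ N := Nat.sqrt_le N
  have hN1 : (1 : ℝ) ≤ N := by exact_mod_cast hN
  have hlog : 0 ≤ Real.log N := Real.log_natCast_nonneg N
  have hbig : ∀ n ∈ Finset.Ioc 0 Z, Z ≤ N / n := fun n hn => by
    have hn' := Finset.mem_Ioc.1 hn
    exact (Nat.le_div_iff_mul_le hn'.1).2 ((Nat.mul_le_mul_left Z hn'.2).trans hZZ)
  have hdiv : ∀ n : ℕ, ((N / n : ℕ) : ℝ) ≤ N * (1 / n) := fun n => by
    rw [mul_one_div]
    exact Nat.cast_div_le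
  rw [sum_hyperbola_eq α β hZ0]
  refine (norm_add_le _ _).trans ?_
  have h1 : ‖∑ n ∈ Finset.Ioc 0 Z, β n * ∑ m ∈ Finset.Ioc 0 (N / n), α m‖ ≤
      N * (1 + Real.log N) * (B * ηa) := by
    calc _ ≤ ∑ n ∈ Finset.Ioc 0 Z, B * ηa * N * (1 / (n : ℝ)) := by
          refine (norm_sum_le _ _).trans (Finset.sum_le_sum fun n hn => ?_)
          rw [norm_mul]
          have hn' := Finset.mem_Ioc.1 hn
          have h2 := hTα (N / n) (hbig n hn) (Nat.div_le_self _ _)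
          have h3 := mul_le_mul (hβ n (hn'.2.trans hZN)) h2 (norm_nonneg _) hB
          have h4 := mul_le_mul_of_nonneg_left (hdiv n) (mul_nonneg hB hηa)
          linarith
      _ ≤ B * ηa * N * (1 + Real.log Z) := by
          rw [← Finset.mul_sum]
          exact mul_le_mul_of_nonneg_left (sum_Ioc_one_div_le Z) (by positivity)
      _ ≤ B * ηa * N * (1 + Real.log N) := by
          have : Real.log Z ≤ Real.log N :=
            Real.log_le_log (by exact_mod_cast hZ0) (by exact_mod_cast hZN)
          gcongr
      _ = _ := by ring
  have h2 : ‖∑ m ∈ Finset.Ioc 0 (N / Z), α m *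
        (∑ n ∈ Finset.Ioc 0 (N / m), β n - ∑ n ∈ Finset.Ioc 0 Z, β n)‖ ≤
      N * (1 + Real.log N) * (2 * ηb) := by
    have hNZ : Z ≤ N / Z := (Nat.le_div_iff_mul_le hZ0).2 hZZ
    calc _ ≤ ∑ m ∈ Finset.Ioc 0 (N / Z), (ηb * N * (1 / (m : ℝ)) + Z * ηb) := by
          refine (norm_sum_le _ _).trans (Finset.sum_le_sum fun m hm => ?_)
          rw [norm_mul]
          have hm' := Finset.mem_Ioc.1 hm
          have hZm : Z ≤ N / m := by
            have := (Nat.le_div_iff_mul_le hZ0).1 hm'.2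
            exact (Nat.le_div_iff_mul_le hm'.1).2 (by rwa [mul_comm])
          have h3 := hTβ (N / m) hZm (Nat.div_le_self _ _)
          have h4 := hTβ Z le_rfl hZN
          have h5 := mul_le_mul_of_nonneg_left (hdiv m) hηb
          have h6 := norm_sub_le (∑ n ∈ Finset.Ioc 0 (N / m), β n) (∑ n ∈ Finset.Ioc 0 Z, β n)
          refine (mul_le_of_le_one_left (norm_nonneg _) (hα m)).trans ?_
          linarith
      _ = ηb * N * ∑ m ∈ Finset.Ioc 0 (N / Z), 1 / (m : ℝ) + ((N / Z : ℕ) : ℝ) * (Z * ηb) := by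
          rw [Finset.sum_add_distrib, ← Finset.mul_sum, Finset.sum_const, Nat.card_Ioc,
            nsmul_eq_mul, Nat.sub_zero]
      _ ≤ ηb * N * (1 + Real.log N) + N * ηb := by
          have h3 : ((N / Z : ℕ) : ℝ) * Z ≤ N := by exact_mod_cast Nat.div_mul_le_self N Z
          have h4 : Real.log ((N / Z : ℕ) : ℝ) ≤ Real.log N :=
            Real.log_le_log (by exact_mod_cast lt_of_lt_of_le hZ0 hNZ)
              (by exact_mod_cast Nat.div_le_self N Z)
          have h5 := sum_Ioc_one_div_le (N / Z)
          have h6 := mul_le_mul_of_nonneg_left (h5.trans (add_le_add_right h4 1))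
            (mul_nonneg hηb (Nat.cast_nonneg (α := ℝ) N))
          have h7 := mul_le_mul_of_nonneg_right h3 hηb
          linarith
      _ ≤ _ := by
          have : 0 ≤ (N : ℝ) * ηb * Real.log N := by positivity
          linarith
  refine (add_le_add h1 h2).trans (le_of_eq ?_)
  ring

theorem abs_log_sub_log_succ_le (k : ℕ) :
    |Real.log k - Real.log ((k + 1 : ℕ) : ℝ)| ≤ 1 / k := by
  -- At `k = 0` both sides are zero, by the default values `Real.log 0 = 0` and `1 / 0 = 0`.
  rcases Nat.eq_zero_or_pos k with rfl | hk
  · simp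
  · have hk' : (0 : ℝ) < k := by exact_mod_cast hk
    have h1 : Real.log k ≤ Real.log ((k + 1 : ℕ) : ℝ) := by
      refine Real.log_le_log hk' ?_
      push_cast
      linarith
    rw [abs_of_nonpos (by linarith), neg_sub, ← Real.log_div (by positivity) hk'.ne']
    refine (Real.log_le_sub_one_of_pos (by positivity)).trans (le_of_eq ?_)
    push_cast
    field_simp
    ring

/-- Partial summation with increments at most `1/k`. Each `k < Y` contributes at most one by the
trivial bound, and each larger `k` contributes `η`. -/
theorem norm_twistedSum_mulLog_le {h : ArithmeticFunction ℂ} (hh : ∀ n, ‖h n‖ ≤ 1) {r : ℕ}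
    (ξ : DirichletCharacter ℂ r) {Y y : ℕ} {η : ℝ} (hη : 0 ≤ η)
    (hF : ∀ k, Y ≤ k → k ≤ y → ‖twistedSum h k ξ‖ ≤ k * η) (hy : Y ≤ y) :
    ‖twistedSum (mulLog h) y ξ‖ ≤ y * η * (1 + Real.log y) + Y := by
  have e : twistedSum (mulLog h) y ξ =
      ∑ n ∈ Finset.Ioc 0 y, (h n * conj (ξ (n : ZMod r))) * ((Real.log n : ℝ) : ℂ) := by
    unfold twistedSum
    refine Finset.sum_congr rfl fun n _ => ?_
    rw [ArithmeticFunction.mulLog_apply]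
    ring
  rw [e, sum_Ioc_mul_abel _ (fun n => ((Real.log n : ℝ) : ℂ))]
  refine (norm_add_le _ _).trans ?_
  have h1 : ‖((Real.log y : ℝ) : ℂ) * ∑ n ∈ Finset.Ioc 0 y, h n * conj (ξ (n : ZMod r))‖ ≤
      Real.log y * (y * η) := by
    rw [norm_mul, Complex.norm_real, Real.norm_of_nonneg (Real.log_natCast_nonneg y)]
    exact mul_le_mul_of_nonneg_left (hF y hy le_rfl) (Real.log_natCast_nonneg y)
  have h2 : ‖∑ k ∈ Finset.range y, (((Real.log k : ℝ) : ℂ) - ((Real.log ((k + 1 : ℕ) : ℝ) : ℝ) : ℂ)) *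
      ∑ n ∈ Finset.Ioc 0 k, h n * conj (ξ (n : ZMod r))‖ ≤ y * η + Y := by
    calc _ ≤ ∑ k ∈ Finset.range y, (η + if k ∈ Finset.range Y then 1 else 0) := by
          refine (norm_sum_le _ _).trans (Finset.sum_le_sum fun k hk => ?_)
          have hk' := Finset.mem_range.1 hk
          rw [norm_mul, ← Complex.ofReal_sub, Complex.norm_real, Real.norm_eq_abs]
          have hdiff := abs_log_sub_log_succ_le k
          have hkk : 1 / (k : ℝ) * k ≤ 1 := by
            rcases Nat.eq_zero_or_pos k with rfl | hk0
            · simp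
            · rw [one_div_mul_cancel]
              exact_mod_cast hk0.ne'
          by_cases hkY : k ∈ Finset.range Y
          · rw [if_pos hkY]
            have h3 : ‖twistedSum h k ξ‖ ≤ k * 1 := norm_twistedSum_le (fun n _ => hh n) ξ
            have h4 := mul_le_mul hdiff h3 (norm_nonneg _) (by positivity)
            refine h4.trans ?_
            linarith
          · rw [if_neg hkY, add_zero]
            have h3 := hF k (by simpa using hkY) hk'.le
            have h4 := mul_le_mul hdiff h3 (norm_nonneg _) (by positivity)
            refine h4.trans ?_
            have h5 := mul_le_mul_of_nonneg_right hkk hη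
            linarith
      _ = y * η + Y := by
          rw [Finset.sum_add_distrib, Finset.sum_const, Finset.card_range, nsmul_eq_mul,
            Finset.sum_ite_mem, Finset.inter_eq_right.2 (Finset.range_subset_range.2 hy)]
          simp
  refine (add_le_add h1 h2).trans (le_of_eq ?_)
  ring

/-- Bilinear sums twisted by a character, when the character sums of `f` and `g` are small. -/
theorem LogDerivBounded.norm_twistedSum_bilinear_le {f g Lam : ArithmeticFunction ℂ}
    (hf : LogDerivBounded f Lam) (hfg : f * g = 1) {s : ℕ} {r : ℕ} (ξ : DirichletCharacter ℂ r)
    {U V : ℝ} {Y N : ℕ} (hN : 0 < N) {η : ℝ} (hη : 0 ≤ η)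
    (hF : ∀ k, Y ≤ k → k ≤ N → ‖twistedSum (restrict (fun n => n.Coprime s) f) k ξ‖ ≤ k * η)
    (hG : ∀ k, Y ≤ k → k ≤ N → ‖twistedSum (restrict (fun n => n.Coprime s) g) k ξ‖ ≤ k * η)
    (hU0 : 0 ≤ U) (hV : 1 ≤ V) (hYV : Y * V ≤ Nat.sqrt N) (hY : Y ≤ Nat.sqrt N * η)
    (hU : U ≤ Nat.sqrt N * η) :
    ‖twistedSum (restrict (fun n => n.Coprime s) (restrict (fun n => ¬ (n : ℝ) ≤ U) g *
        (restrict (fun n => ¬ (n : ℝ) ≤ V) Lam * f))) N ξ‖ ≤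
      8 * N * (1 + Real.log N) ^ 3 * η := by
  have hg := hf.inverse hfg
  have hc : ∀ m n : ℕ, (m * n).Coprime s ↔ m.Coprime s ∧ n.Coprime s := fun m n =>
    Nat.coprime_mul_iff_left
  have hlogN : 0 ≤ Real.log N := Real.log_natCast_nonneg N
  have hY' : (Y : ℝ) ≤ Nat.sqrt N := by
    have : (Y : ℝ) * 1 ≤ Y * V := mul_le_mul_of_nonneg_left hV (Nat.cast_nonneg _)
    linarith
  have hYN : Y ≤ Nat.sqrt N := by exact_mod_cast hY'
  set cop : ℕ → Prop := fun n => n.Coprime s with hcop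
  set a := restrict (fun n : ℕ => ¬ (n : ℝ) ≤ U) g with ha
  set L' := restrict (fun n : ℕ => ¬ (n : ℝ) ≤ V) Lam with hL'
  set L₀ := restrict (fun n : ℕ => (n : ℝ) ≤ V) Lam with hL₀
  rw [ArithmeticFunction.restrict_mul hc, twistedSum_mul]
  have hα : ∀ n, ‖restrict cop a n * conj (ξ (n : ZMod r))‖ ≤ 1 := by
    intro n
    rw [norm_mul]
    exact mul_le_one₀ ((ArithmeticFunction.norm_restrict_le _ _ _).trans
      (hg.norm_restrict_le_one _ _)) (norm_nonneg _) (norm_conj_char_le_one _ _)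
  have hβ : ∀ n ≤ N, ‖restrict cop (L' * f) n * conj (ξ (n : ZMod r))‖ ≤ Real.log N := by
    intro n hn
    rw [norm_mul]
    refine (mul_le_of_le_one_right (norm_nonneg _) (norm_conj_char_le_one _ _)).trans ?_
    refine (ArithmeticFunction.norm_restrict_le _ _ _).trans ?_
    refine (ArithmeticFunction.norm_mul_apply_le_log (fun k =>
      (ArithmeticFunction.norm_restrict_le _ _ _).trans (hf.norm_le k))
      hf.norm_apply_le_one n).trans ?_
    rcases Nat.eq_zero_or_pos n with rfl | hn0
    · simpa using hlogN
    · exact Real.log_le_log (by exact_mod_cast hn0) (by exact_mod_cast hn)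
  have hTα : ∀ y, Nat.sqrt N ≤ y → y ≤ N →
      ‖∑ m ∈ Finset.Ioc 0 y, restrict cop a m * conj (ξ (m : ZMod r))‖ ≤ y * (2 * η) := by
    intro y hy hyN
    have hyR : ((Nat.sqrt N : ℕ) : ℝ) ≤ y := by exact_mod_cast hy
    -- Removing the terms `m ≤ U` changes the sum by at most `U ≤ √N · η`, the same order as the
    -- bound for `g` itself.
    have e : ∑ m ∈ Finset.Ioc 0 y, restrict cop a m * conj (ξ (m : ZMod r)) =
        twistedSum (restrict cop g) y ξ -
          ∑ m ∈ Finset.Ioc 0 y with ((m : ℕ) : ℝ) ≤ U,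
            restrict cop g m * conj (ξ (m : ZMod r)) := by
      unfold twistedSum
      rw [Finset.sum_filter, ← Finset.sum_sub_distrib]
      refine Finset.sum_congr rfl fun m _ => ?_
      by_cases hmU : (m : ℝ) ≤ U
      · have h0 : a m = 0 := ArithmeticFunction.restrict_of_neg (by simpa using hmU)
        have h1 : restrict cop a m = 0 := norm_le_zero_iff.1
          ((ArithmeticFunction.norm_restrict_le _ _ _).trans (by rw [h0, norm_zero]))
        rw [if_pos hmU, h1, zero_mul, sub_self]
      · have h0 : a m = g m := ArithmeticFunction.restrict_of_pos hmU
        have h1 : restrict cop a m = restrict cop g m := by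
          by_cases hm : cop m
          · rw [ArithmeticFunction.restrict_of_pos hm, ArithmeticFunction.restrict_of_pos hm, h0]
          · rw [ArithmeticFunction.restrict_of_neg hm, ArithmeticFunction.restrict_of_neg hm]
        rw [if_neg hmU, h1, sub_zero]
    rw [e]
    refine (norm_sub_le _ _).trans ?_
    have h1 := hG y (hYN.trans hy) hyN
    have h2 : ‖∑ m ∈ Finset.Ioc 0 y with ((m : ℕ) : ℝ) ≤ U,
        restrict cop g m * conj (ξ (m : ZMod r))‖ ≤ U := by
      refine (norm_sum_le _ _).trans ((Finset.sum_le_card_nsmul _ _ 1 fun m _ => ?_).trans ?_)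
      · rw [norm_mul]
        exact mul_le_one₀ (hg.norm_restrict_le_one _ _) (norm_nonneg _)
          (norm_conj_char_le_one _ _)
      · rw [nsmul_eq_mul, mul_one]
        have hsub : (Finset.Ioc 0 y).filter (fun m => ((m : ℕ) : ℝ) ≤ U) ⊆
            Finset.Ioc 0 ⌊U⌋₊ := by
          intro m hm
          obtain ⟨h3, h4⟩ := Finset.mem_filter.1 hm
          exact Finset.mem_Ioc.2 ⟨(Finset.mem_Ioc.1 h3).1, Nat.le_floor h4⟩
        have h5 := Finset.card_le_card hsub
        rw [Nat.card_Ioc, Nat.sub_zero] at h5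
        exact le_trans (by exact_mod_cast h5) (Nat.floor_le hU0)
    have h3 := mul_le_mul_of_nonneg_right hyR hη
    linarith
  have hTβ : ∀ y, Nat.sqrt N ≤ y → y ≤ N →
      ‖∑ m ∈ Finset.Ioc 0 y, restrict cop (L' * f) m * conj (ξ (m : ZMod r))‖ ≤
        y * (3 * (1 + Real.log N) ^ 2 * η) := by
    intro y hy hyN
    have hyR : ((Nat.sqrt N : ℕ) : ℝ) ≤ y := by exact_mod_cast hy
    have hy0 : 0 < y := lt_of_lt_of_le (Nat.sqrt_pos.2 hN) hy
    have hlogy : Real.log y ≤ Real.log N :=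
      Real.log_le_log (by exact_mod_cast hy0) (by exact_mod_cast hyN)
    have hlogy0 : 0 ≤ Real.log y := Real.log_natCast_nonneg y
    have hyη : 0 ≤ y * η := by positivity
    -- From `(L₀ + L') * f = mulLog f`. This trades the unknown tail `L'` for the character sums of
    -- `f`, by partial summation and by a convolution supported on `m ≤ V`.
    have e : restrict cop (L' * f) = mulLog (restrict cop f) - restrict cop L₀ * restrict cop f := by
      have h1 : L₀ + L' = Lam := ArithmeticFunction.restrict_add_restrict_not _ _
      have h2 : L' * f + L₀ * f = mulLog f := by
        rw [← hf.mul_eq, ← h1]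
        ring
      rw [ArithmeticFunction.mulLog_restrict, ← h2, ← ArithmeticFunction.restrict_mul hc]
      ext n
      have h3 : ∀ u v : ArithmeticFunction ℂ, (u - v) n = u n - v n := fun _ _ => rfl
      rw [h3]
      by_cases hn : cop n
      · rw [ArithmeticFunction.restrict_of_pos hn, ArithmeticFunction.restrict_of_pos hn,
          ArithmeticFunction.restrict_of_pos hn, ArithmeticFunction.add_apply]
        ring
      · rw [ArithmeticFunction.restrict_of_neg hn, ArithmeticFunction.restrict_of_neg hn,
          ArithmeticFunction.restrict_of_neg hn, sub_zero]
    have e2 : ∑ m ∈ Finset.Ioc 0 y, restrict cop (L' * f) m * conj (ξ (m : ZMod r)) =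
        twistedSum (mulLog (restrict cop f)) y ξ -
          twistedSum ⇑(restrict cop L₀ * restrict cop f) y ξ := by
      unfold twistedSum
      rw [e, ← Finset.sum_sub_distrib]
      refine Finset.sum_congr rfl fun m _ => ?_
      rw [← sub_mul]
      rfl
    rw [e2]
    refine (norm_sub_le _ _).trans ?_
    have h1 := norm_twistedSum_mulLog_le (h := restrict cop f) (hf.norm_restrict_le_one _) ξ hη
      (fun k h1 h2 => hF k h1 (h2.trans hyN)) (hYN.trans hy)
    have h2 : ‖twistedSum ⇑(restrict cop L₀ * restrict cop f) y ξ‖ ≤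
        y * η * Real.log N * (1 + Real.log N) := by
      refine (norm_twistedSum_mul_le _ _ _ _).trans ?_
      calc _ ≤ ∑ m ∈ Finset.Ioc 0 y, Real.log N * (y * η) * (1 / (m : ℝ)) := by
            refine Finset.sum_le_sum fun m hm => ?_
            have hm' := Finset.mem_Ioc.1 hm
            by_cases hmV : (m : ℝ) ≤ V
            · have h3 : ‖restrict cop L₀ m‖ ≤ Real.log N := by
                refine (ArithmeticFunction.norm_restrict_le _ _ _).trans
                  ((ArithmeticFunction.norm_restrict_le _ _ _).trans ((hf.norm_le m).trans ?_))
                exact ArithmeticFunction.vonMangoldt_le_log.trans (Real.log_le_log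
                  (by exact_mod_cast hm'.1) (by exact_mod_cast hm'.2.trans hyN))
              -- This is where `Y V ≤ √N` enters: shortening by `m ≤ V` leaves a sum long enough for
              -- the hypothesis.
              have h4 : Y ≤ y / m := by
                refine (Nat.le_div_iff_mul_le hm'.1).2 ?_
                have : (Y : ℝ) * m ≤ y := (mul_le_mul_of_nonneg_left hmV
                  (Nat.cast_nonneg _)).trans (hYV.trans hyR)
                exact_mod_cast this
              have h5 := hF (y / m) h4 ((Nat.div_le_self _ _).trans hyN)
              have h6 : ((y / m : ℕ) : ℝ) ≤ y / m := Nat.cast_div_le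
              have h7 := mul_le_mul h3 (h5.trans (mul_le_mul_of_nonneg_right h6 hη))
                (norm_nonneg _) hlogN
              refine h7.trans (le_of_eq ?_)
              ring
            · have h0 : L₀ m = 0 := ArithmeticFunction.restrict_of_neg hmV
              have h3 : restrict cop L₀ m = 0 := norm_le_zero_iff.1
                ((ArithmeticFunction.norm_restrict_le _ _ _).trans (by rw [h0, norm_zero]))
              rw [h3, norm_zero, zero_mul]
              positivity
        _ ≤ Real.log N * (y * η) * (1 + Real.log y) := by
            rw [← Finset.mul_sum]
            exact mul_le_mul_of_nonneg_left (sum_Ioc_one_div_le y) (by positivity)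
        _ ≤ Real.log N * (y * η) * (1 + Real.log N) := by gcongr
        _ = _ := by ring
    have h3 : y * η * (1 + Real.log y) ≤ y * η * (1 + Real.log N) := by gcongr
    have h4 := mul_le_mul_of_nonneg_right hyR hη
    have h5 : 0 ≤ y * η * Real.log N := by positivity
    have h6 : 0 ≤ y * η * Real.log N ^ 2 := by positivity
    nlinarith
  refine (norm_sum_hyperbola_le hN hlogN (by positivity) (by positivity) hα hβ hTα hTβ).trans ?_
  have hp : Real.log N * (2 * η) + 2 * (3 * (1 + Real.log N) ^ 2 * η) ≤
      8 * (1 + Real.log N) ^ 2 * η := by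
    have : 0 ≤ η * Real.log N := by positivity
    have : 0 ≤ η * Real.log N ^ 2 := by positivity
    nlinarith
  refine (mul_le_mul_of_nonneg_left hp (by positivity)).trans (le_of_eq ?_)
  ring

/-! ### Type I summation and partial summation -/

/-- The part `P / m` of the inner bound costs only `log W`, while the constant part costs `W`. In
the application `W` is a power of `log x`, so the first cost is `log log x`. -/
theorem sum_norm_mul_le_of_support {c : ℕ → ℂ} {F : ℕ → ℝ} {N : ℕ} {W H P S : ℝ} (hW : 1 ≤ W)
    (hH : 0 ≤ H) (hP : 0 ≤ P) (hS : 0 ≤ S)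
    (hc : ∀ m ∈ Finset.Ioc 0 N, (m : ℝ) ≤ W → ‖c m‖ ≤ H)
    (hc0 : ∀ m : ℕ, W < m → c m = 0) (hF0 : ∀ m, 0 ≤ F m)
    (hF : ∀ m ∈ Finset.Ioc 0 N, (m : ℝ) ≤ W → F m ≤ P / m + S) :
    ∑ m ∈ Finset.Ioc 0 N, ‖c m‖ * F m ≤ H * (P * (1 + Real.log W) + W * S) := by
  have hW0 : 0 ≤ W := by linarith
  have hterm : ∀ m ∈ Finset.Ioc 0 N, ‖c m‖ * F m ≤
      if m ∈ Finset.Ioc 0 ⌊W⌋₊ then H * (P * (1 / (m : ℝ)) + S) else 0 := by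
    intro m hm
    by_cases hmW : (m : ℝ) ≤ W
    · rw [if_pos (Finset.mem_Ioc.2 ⟨(Finset.mem_Ioc.1 hm).1, Nat.le_floor hmW⟩)]
      rw [mul_one_div]
      exact mul_le_mul (hc m hm hmW) (hF m hm hmW) (hF0 m) hH
    · rw [hc0 m (not_le.1 hmW), norm_zero, zero_mul]
      split_ifs <;> positivity
  refine (Finset.sum_le_sum hterm).trans ?_
  rw [Finset.sum_ite_mem]
  calc _ ≤ ∑ m ∈ Finset.Ioc 0 ⌊W⌋₊, H * (P * (1 / (m : ℝ)) + S) :=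
        Finset.sum_le_sum_of_subset_of_nonneg Finset.inter_subset_right
          fun _ _ _ => by positivity
    _ = H * (P * ∑ m ∈ Finset.Ioc 0 ⌊W⌋₊, 1 / (m : ℝ) + ⌊W⌋₊ * S) := by
        rw [← Finset.mul_sum, Finset.sum_add_distrib, ← Finset.mul_sum, Finset.sum_const,
          Nat.card_Ioc, nsmul_eq_mul, Nat.sub_zero]
    _ ≤ _ := by
        have h1 : (⌊W⌋₊ : ℝ) ≤ W := Nat.floor_le hW0
        have h2 : Real.log (⌊W⌋₊ : ℝ) ≤ Real.log W :=
          Real.log_le_log (by exact_mod_cast Nat.floor_pos.2 hW) h1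
        have h3 := sum_Ioc_one_div_le ⌊W⌋₊
        refine mul_le_mul_of_nonneg_left (add_le_add ?_ ?_) hH
        · exact mul_le_mul_of_nonneg_left (by linarith) hP
        · exact mul_le_mul_of_nonneg_right h1 hS

/-- Partial summation with increments at most `1/k`. The bound `P` is available from `X₁` on; below
it the trivial bound contributes `T` per term, plus a harmonic sum of `Q`. -/
theorem sumMaxDelta_mulLog_le {Ξ : CharSet} {f : ArithmeticFunction ℂ} {M : ℕ} {P T Q X₁ : ℝ}
    (hP : 0 ≤ P) (hT : 0 ≤ T) (hQ : 0 ≤ Q) (hX₁ : 0 ≤ X₁)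
    (h1 : ∀ k : ℕ, X₁ ≤ k → k ≤ M → sumMaxDelta Ξ f k Q ≤ k * P)
    (h2 : ∀ k : ℕ, sumMaxDelta Ξ f k Q ≤ k * T + Q) :
    sumMaxDelta Ξ (mulLog f) M Q ≤ Real.log M * sumMaxDelta Ξ f M Q + M * P + (X₁ + 1) * T +
      Q * (1 + Real.log M) := by
  have h := sumMaxDelta_mul_weight_le Ξ f (fun n => Real.log n) M Q
  have e : (fun n => f n * (((Real.log n : ℝ)) : ℂ)) = ⇑(mulLog f) := rfl
  rw [e, abs_of_nonneg (Real.log_natCast_nonneg M)] at h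
  refine h.trans ?_
  rw [add_assoc, add_assoc]
  refine add_le_add_right ?_ _
  have hterm : ∀ k ∈ Finset.range M, |Real.log k - Real.log ((k + 1 : ℕ) : ℝ)| *
      sumMaxDelta Ξ f k Q ≤
      P + ((if k ∈ Finset.range ⌈X₁⌉₊ then T else 0) + Q * (1 / k)) := by
    intro k hk
    have hk' := Finset.mem_range.1 hk
    have hd := abs_log_sub_log_succ_le k
    have hkk : 1 / (k : ℝ) * k ≤ 1 := by
      rcases Nat.eq_zero_or_pos k with rfl | hk0
      · simp
      · rw [one_div_mul_cancel]
        exact_mod_cast hk0.ne'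
    have hQk : 0 ≤ Q * (1 / (k : ℝ)) := by positivity
    by_cases hkX : k ∈ Finset.range ⌈X₁⌉₊
    · rw [if_pos hkX]
      have h3 := mul_le_mul hd (h2 k) (sumMaxDelta_nonneg _ _ _ _) (by positivity)
      have h4 := mul_le_mul_of_nonneg_right hkk hT
      refine h3.trans ?_
      linarith
    · rw [if_neg hkX]
      have h3 := mul_le_mul hd (h1 k (Nat.ceil_le.1 (by simpa using hkX)) hk'.le)
        (sumMaxDelta_nonneg _ _ _ _) (by positivity)
      have h4 := mul_le_mul_of_nonneg_right hkk hP
      refine h3.trans ?_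
      linarith
  refine (Finset.sum_le_sum hterm).trans ?_
  rw [Finset.sum_add_distrib, Finset.sum_add_distrib, Finset.sum_const, Finset.card_range,
    nsmul_eq_mul, ← Finset.mul_sum, Finset.sum_ite_mem, Finset.sum_const, nsmul_eq_mul]
  refine add_le_add_right (add_le_add ?_ ?_) _
  · refine mul_le_mul_of_nonneg_right ?_ hT
    have h3 := Finset.card_le_card
      (Finset.inter_subset_right (s₁ := Finset.range M) (s₂ := Finset.range ⌈X₁⌉₊))
    rw [Finset.card_range] at h3
    exact le_trans (by exact_mod_cast h3) (Nat.ceil_lt_add_one hX₁).le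
  · refine mul_le_mul_of_nonneg_left (le_trans ?_ (sum_Ioc_one_div_le M)) hQ
    have h3 : ∑ k ∈ Finset.range (M + 1), 1 / (k : ℝ) = ∑ k ∈ Finset.Ioc 0 M, 1 / (k : ℝ) := by
      rw [← Finset.Icc_one_eq_Ioc_zero, Finset.sum_range_succ']
      simp only [Nat.cast_zero, div_zero, add_zero]
      rw [Finset.range_eq_Ico, Finset.sum_Ico_add' (fun k : ℕ => 1 / (k : ℝ)) 0 M 1]
      rfl
    rw [← h3]
    exact Finset.sum_le_sum_of_subset_of_nonneg (Finset.range_subset_range.2 (Nat.le_succ M))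
      fun _ _ _ => by positivity

theorem sumMaxDelta_eq_of_support {Ξ : CharSet} {h : ℕ → ℂ} {M N : ℕ} (hMN : M ≤ N)
    (hh : ∀ n, M < n → h n = 0) (Q : ℝ) : sumMaxDelta Ξ h N Q = sumMaxDelta Ξ h M Q := by
  unfold sumMaxDelta
  refine Finset.sum_congr rfl fun q _ => iSup_congr fun a => ?_
  rw [deltaXi_eq_sum, deltaXi_eq_sum, Nat.floor_natCast, Nat.floor_natCast]
  refine congrArg _ (Finset.sum_subset (Finset.Ioc_subset_Ioc_right hMN) fun n h1 h2 => ?_).symm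
  rw [hh n, zero_mul]
  rw [Finset.mem_Ioc] at h1 h2
  omega

/-- Partial summation against an antitone weight. -/
theorem sumMaxDelta_mul_antitone_le {Ξ : CharSet} {h : ℕ → ℂ} {w : ℕ → ℝ} (hw : Antitone w)
    (hw0 : ∀ n, 0 ≤ w n) {N : ℕ} {Q M : ℝ}
    (hM : ∀ k ≤ N, (k < N → w k ≠ w (k + 1)) → sumMaxDelta Ξ h k Q ≤ M) :
    sumMaxDelta Ξ (fun n => h n * (w n : ℂ)) N Q ≤ w 0 * M := by
  refine (sumMaxDelta_mul_weight_le Ξ h w N Q).trans ?_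
  have h1 : ∑ k ∈ Finset.range N, |w k - w (k + 1)| * sumMaxDelta Ξ h k Q ≤
      ∑ k ∈ Finset.range N, (w k - w (k + 1)) * M := by
    refine Finset.sum_le_sum fun k hk => ?_
    have hk' := Finset.mem_range.1 hk
    rw [abs_of_nonneg (sub_nonneg.2 (hw (Nat.le_succ k)))]
    -- Where the weight is locally constant no bound on the partial sum is needed, so nothing has to
    -- be known there.
    by_cases he : w k = w (k + 1)
    · rw [he, sub_self, zero_mul, zero_mul]
    · exact mul_le_mul_of_nonneg_left (hM k hk'.le fun _ => he)
        (sub_nonneg.2 (hw (Nat.le_succ k)))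
  rw [← Finset.sum_mul, Finset.sum_range_sub'] at h1
  rw [abs_of_nonneg (hw0 N)]
  have h2 := mul_le_mul_of_nonneg_left (hM N le_rfl fun h => absurd h (lt_irrefl N)) (hw0 N)
  linarith

/-! ### Parameters and powers of the logarithm -/

/-- The range of parameters: `x` is large in terms of `A` and `C`, and `Q` is admissible. -/
structure LevelParams (A C x Q : ℝ) : Prop where
  hA : 0 ≤ A
  hC : 0 ≤ C
  one_le : 1 ≤ x
  le_log : 8 ≤ Real.log x
  log_rpow_le : Real.log x ^ (20 * (A + C + 2)) ≤ x ^ (0.01 : ℝ)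
  two_le : 2 ≤ Q
  level_le : Q ≤ x ^ (1 / 2 : ℝ) / Real.log x ^ (5 * A / 2 + C / 4 + 7 / 2)

theorem exists_forall_large (A C : ℝ) : ∃ x₀ : ℝ, ∀ x, x₀ ≤ x → 1 ≤ x ∧ 8 ≤ Real.log x ∧
    Real.log x ^ (20 * (A + C + 2)) ≤ x ^ (0.01 : ℝ) := by
  have h1 := (isLittleO_log_rpow_rpow_atTop (20 * (A + C + 2)) (s := 0.01)
    (by norm_num)).bound one_pos
  have h2 := Real.tendsto_log_atTop.eventually_ge_atTop 8
  have h3 := Filter.eventually_ge_atTop (1 : ℝ)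
  obtain ⟨x₀, hx₀⟩ := Filter.eventually_atTop.1 (h1.and (h2.and h3))
  refine ⟨x₀, fun x hx => ?_⟩
  obtain ⟨h1, h2, h3⟩ := hx₀ x hx
  refine ⟨h3, h2, ?_⟩
  rw [one_mul, Real.norm_of_nonneg (by positivity), Real.norm_of_nonneg (by positivity)] at h1
  exact h1

namespace LevelParams

variable {A C x Q : ℝ}

theorem log_pos (h : LevelParams A C x Q) : 0 < Real.log x := by linarith [h.le_log]

theorem one_le_log (h : LevelParams A C x Q) : 1 ≤ Real.log x := by linarith [h.le_log]

theorem pos (h : LevelParams A C x Q) : 0 < x := by linarith [h.one_le]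

theorem rpow_log_le_rpow_log (h : LevelParams A C x Q) {a b : ℝ} (hab : a ≤ b) :
    Real.log x ^ a ≤ Real.log x ^ b :=
  Real.rpow_le_rpow_of_exponent_le h.one_le_log hab

theorem one_le_rpow_log (h : LevelParams A C x Q) {a : ℝ} (ha : 0 ≤ a) :
    1 ≤ Real.log x ^ a := Real.one_le_rpow h.one_le_log ha

theorem rpow_log_le (h : LevelParams A C x Q) {b : ℝ} (hb : b ≤ 20 * (A + C + 2)) :
    Real.log x ^ b ≤ x ^ (0.01 : ℝ) := (h.rpow_log_le_rpow_log hb).trans h.log_rpow_le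

/-- A slack of `0.01` in the exponent of `x` pays for every power of `log x` that occurs. -/
theorem rpow_log_mul_rpow_le (h : LevelParams A C x Q) {a b e : ℝ} (ha : a + 0.01 ≤ e) {b' : ℝ}
    (hb : b - b' ≤ 20 * (A + C + 2)) :
    Real.log x ^ b * x ^ a ≤ x ^ e * Real.log x ^ b' := by
  have h1 : Real.log x ^ b = Real.log x ^ (b - b') * Real.log x ^ b' := by
    rw [← Real.rpow_add h.log_pos]
    ring_nf
  calc Real.log x ^ b * x ^ a = Real.log x ^ (b - b') * x ^ a * Real.log x ^ b' := by
        rw [h1]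
        ring
    _ ≤ x ^ (0.01 : ℝ) * x ^ a * Real.log x ^ b' := by
        have := h.pos
        have := h.log_pos
        gcongr
        exact h.rpow_log_le hb
    _ ≤ _ := by
        have := h.log_pos
        refine mul_le_mul_of_nonneg_right ?_ (by positivity)
        rw [← Real.rpow_add h.pos]
        exact Real.rpow_le_rpow_of_exponent_le h.one_le (by linarith)

theorem level_le_sqrt (h : LevelParams A C x Q) : Q ≤ x ^ (1 / 2 : ℝ) := by
  have hA := h.hA
  have hC := h.hC
  exact h.level_le.trans (div_le_self (Real.rpow_nonneg h.pos.le _)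
    (h.one_le_rpow_log (by positivity)))

theorem level_le_self (h : LevelParams A C x Q) : Q ≤ x :=
  h.level_le_sqrt.trans (by
    have := Real.rpow_le_rpow_of_exponent_le h.one_le (by norm_num : (1 / 2 : ℝ) ≤ 1)
    rwa [Real.rpow_one] at this)

/-- The logarithmic saving in the level is spent here. All other estimates use only `Q ≤ √x`. -/
theorem level_mul_sqrt_le (h : LevelParams A C x Q) {b : ℝ}
    (hb : -b ≤ 5 * A / 2 + C / 4 + 7 / 2) :
    Q * Real.sqrt x ≤ x * Real.log x ^ b := by
  have := h.pos
  have := h.log_pos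
  calc Q * Real.sqrt x ≤
        x ^ (1 / 2 : ℝ) * Real.log x ^ (-(5 * A / 2 + C / 4 + 7 / 2)) * x ^ (1 / 2 : ℝ) := by
        rw [Real.sqrt_eq_rpow, Real.rpow_neg h.log_pos.le, ← div_eq_mul_inv]
        exact mul_le_mul_of_nonneg_right h.level_le (by positivity)
    _ = x * Real.log x ^ (-(5 * A / 2 + C / 4 + 7 / 2)) := by
        rw [mul_right_comm, ← Real.rpow_add h.pos]
        norm_num
    _ ≤ _ := mul_le_mul_of_nonneg_left (h.rpow_log_le_rpow_log (by linarith)) h.pos.le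

theorem log_level_le (h : LevelParams A C x Q) : Real.log Q ≤ Real.log x :=
  Real.log_le_log (by linarith [h.two_le]) h.level_le_self

theorem log_natCast_le (h : LevelParams A C x Q) {n : ℕ} (hn : (n : ℝ) ≤ x) :
    Real.log n ≤ Real.log x := by
  rcases Nat.eq_zero_or_pos n with rfl | hn0
  · simpa using h.log_pos.le
  · exact Real.log_le_log (by exact_mod_cast hn0) hn

theorem sumMaxDelta_le_of_bounded (h : LevelParams A C x Q) {Ξ : CharSet}
    (hΞ : (Ξ.card : ℝ) ≤ Real.log x ^ C) {f : ℕ → ℂ} {H : ℝ} (hH : 0 ≤ H) {N : ℕ}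
    (hf : ∀ n ∈ Finset.Ioc 0 N, ‖f n‖ ≤ H) :
    sumMaxDelta Ξ f N Q ≤ H * (N * (8 * Real.log x ^ (C + 1)) + Q) := by
  refine (sumMaxDelta_le_trivial (by linarith [h.two_le]) hH hf).trans ?_
  refine mul_le_mul_of_nonneg_left (add_le_add_left (mul_le_mul_of_nonneg_left ?_
    (Nat.cast_nonneg _)) _) hH
  have h1 := h.one_le_rpow_log h.hC
  have h2 := h.log_level_le
  have h3 := h.one_le_log
  have h4 : 0 ≤ Real.log Q := Real.log_nonneg (by linarith [h.two_le])
  rw [Real.rpow_add_one h.log_pos.ne']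
  calc (1 + 3 * (Ξ.card : ℝ)) * (1 + Real.log Q) ≤
        (4 * Real.log x ^ C) * (2 * Real.log x) := by
        refine mul_le_mul (by linarith) (by linarith) (by linarith) (by positivity)
    _ = _ := by ring

/-- A sum of `1/m` up to a power of `log x` costs `log log x`, which is at most a constant times
`(log x)^ε`. The extra `ε` in the averaged hypothesis serves to absorb it. -/
theorem one_add_log_rpow_log_le (h : LevelParams A C x Q) {ε b : ℝ} (hε : 0 < ε) (hb : 0 ≤ b) :
    1 + Real.log (Real.log x ^ b) ≤ (1 + b / ε) * Real.log x ^ ε := by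
  have h1 := h.one_le_rpow_log hε.le
  have h2 := mul_le_mul_of_nonneg_left (Real.log_le_rpow_div h.log_pos.le hε) hb
  rw [Real.log_rpow h.log_pos]
  calc 1 + b * Real.log (Real.log x) ≤ Real.log x ^ ε + b * (Real.log x ^ ε / ε) := by linarith
    _ = _ := by ring

end LevelParams

/-! ### Type I terms of Vaughan's identity -/

/-- The hypotheses on the distribution of an arithmetic function in arithmetic progressions. -/
structure EquidistributionHyp (A C ε K x Q : ℝ) (Ξ : CharSet) (h : ArithmeticFunction ℂ) :
    Prop where
  norm_deltaXi_le : ∀ X : ℝ, x ^ (0.4 : ℝ) ≤ X → X ≤ x → ∀ q : ℕ, 1 ≤ q → ∀ a : (ZMod q)ˣ,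
    ‖deltaXi Ξ h X q a‖ ≤ K * (X / Real.log x ^ (14 * A + 28))
  sumMaxDelta_le : ∀ X : ℝ, x / Real.log x ^ (6 * A + C + 10) ≤ X → X ≤ x →
    sumMaxDelta Ξ h X Q ≤ K * (X / Real.log x ^ (A + ε))

section

variable {A C ε K x Q : ℝ} {Ξ : CharSet} {f g Lam : ArithmeticFunction ℂ}

/-- Since `m ≤ (log x)^(4A+8)`, the quotient `N/m` stays above `x/(log x)^(5A+C+10)`, inside the
range of the averaged hypothesis. -/
theorem EquidistributionHyp.sumMaxDelta_div_le (hE : EquidistributionHyp A C ε K x Q Ξ f)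
    (hp : LevelParams A C x Q) {N m : ℕ} {b : ℝ} (hb : b ≤ 4 * A + 8) (hm : 0 < m)
    (hN0 : x / Real.log x ^ (A + C + 2) ≤ N) (hN : (N : ℝ) ≤ x) (hmb : (m : ℝ) ≤ Real.log x ^ b) :
    sumMaxDelta Ξ f ((N / m : ℕ) : ℝ) Q ≤ K * ((N / m : ℝ) / Real.log x ^ (A + ε)) := by
  have hm' : (1 : ℝ) ≤ m := by exact_mod_cast hm
  have hL := hp.log_pos
  -- The natural and the real quotient have the same floor, so the hypothesis may be applied at the
  -- real point.
  rw [sumMaxDelta_congr (X' := (N : ℝ) / m) (h' := f)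
    (by rw [Nat.floor_natCast, Nat.floor_div_natCast, Nat.floor_natCast]) fun _ _ => rfl]
  refine hE.sumMaxDelta_le _ ?_ ((div_le_self (Nat.cast_nonneg _) hm').trans hN)
  rw [le_div_iff₀ (by linarith)]
  refine le_trans ?_ hN0
  rw [div_mul_eq_mul_div, div_le_div_iff₀ (by positivity) (by positivity), mul_assoc]
  refine mul_le_mul_of_nonneg_left ?_ hp.pos.le
  calc (m : ℝ) * Real.log x ^ (A + C + 2) ≤ Real.log x ^ (4 * A + 8) * Real.log x ^ (A + C + 2) :=
        mul_le_mul_of_nonneg_right (hmb.trans (hp.rpow_log_le_rpow_log hb)) (by positivity)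
    _ ≤ _ := by
        rw [← Real.rpow_add hL]
        exact hp.rpow_log_le_rpow_log (by linarith [hp.hA])

/-- The weight in `mulLog f` costs one logarithm, the sum over `m` costs `(log x)^ε`, and the
hypothesis saves `(log x)^(A+ε)`. Partial summation also meets partial sums below the range of the
hypothesis, which are bounded trivially. -/
theorem EquidistributionHyp.sumMaxDelta_mul_mulLog_le
    (hE : EquidistributionHyp A C ε K x Q Ξ f) (hp : LevelParams A C x Q) (hε : 0 < ε)
    (hK : 0 ≤ K) (hΞ : (Ξ.card : ℝ) ≤ Real.log x ^ C) (hf : ∀ n, ‖f n‖ ≤ 1)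
    {c : ArithmeticFunction ℂ} (hc : ∀ n, ‖c n‖ ≤ 1)
    (hc0 : ∀ m : ℕ, Real.log x ^ (2 * A + 4) < m → c m = 0) {N : ℕ}
    (hN0 : x / Real.log x ^ (A + C + 2) ≤ N) (hN : (N : ℝ) ≤ x) :
    sumMaxDelta Ξ ⇑(c * mulLog f) N Q ≤
      (2 * K * (1 + (2 * A + 4) / ε) + 18) * (x * Real.log x ^ (1 - A)) := by
  have hA := hp.hA
  have hC := hp.hC
  have hx := hp.pos
  have hL := hp.log_pos
  have hL1 := hp.one_le_log
  have hQ0 : 0 ≤ Q := by linarith [hp.two_le]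
  set L := Real.log x with hLdef
  set P := K / L ^ (A + ε) with hP
  set X₁ := x / L ^ (6 * A + C + 10) with hX₁
  set T := 8 * L ^ (C + 1) with hT
  have hP0 : 0 ≤ P := by positivity
  have hT0 : 0 ≤ T := by positivity
  have hX0 : 0 ≤ X₁ := by positivity
  have hX1 : 1 ≤ X₁ := by
    rw [hX₁, le_div_iff₀ (by positivity), one_mul]
    refine (hp.rpow_log_le (by linarith)).trans ?_
    have := Real.rpow_le_rpow_of_exponent_le hp.one_le (by norm_num : (0.01 : ℝ) ≤ 1)
    rwa [Real.rpow_one] at this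
  refine (sumMaxDelta_mul_le Ξ c (mulLog f) N Q).trans ?_
  refine (sum_norm_mul_le_of_support (W := L ^ (2 * A + 4)) (H := 1) (P := (1 + L) * N * P)
    (S := (X₁ + 1) * T + Q * (1 + L)) (hp.one_le_rpow_log (by linarith)) zero_le_one
    (by positivity) (by positivity) (fun m _ _ => hc m) hc0
    (fun m => sumMaxDelta_nonneg _ _ _ _) ?_).trans ?_
  · intro m hm hmU
    have hm' := Finset.mem_Ioc.1 hm
    have hMx : ∀ k : ℕ, k ≤ N / m → (k : ℝ) ≤ x := fun k hk =>
      le_trans (by exact_mod_cast hk.trans (Nat.div_le_self N m)) hN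
    have h1 := sumMaxDelta_mulLog_le (Ξ := Ξ) (f := f) (M := N / m) hP0 hT0 hQ0 hX0
      (fun k hk hkM => (hE.sumMaxDelta_le k hk (hMx k hkM)).trans (le_of_eq (by rw [hP]; ring)))
      (fun k => (hp.sumMaxDelta_le_of_bounded hΞ zero_le_one (fun n _ => hf n)).trans
        (le_of_eq (one_mul _)))
    refine h1.trans ?_
    have h2 := hE.sumMaxDelta_div_le hp (b := 2 * A + 4) (by linarith) hm'.1 hN0 hN hmU
    have h3 : Real.log ((N / m : ℕ) : ℝ) ≤ L := hp.log_natCast_le (hMx _ le_rfl)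
    have h4 : ((N / m : ℕ) : ℝ) ≤ N / m := Nat.cast_div_le
    have h5 := mul_le_mul h3 h2 (sumMaxDelta_nonneg _ _ _ _) hL.le
    have h6 := mul_le_mul_of_nonneg_right h4 hP0
    have h7 := mul_le_mul_of_nonneg_left h3 hQ0
    have h8 : L * (K * ((N / m : ℝ) / L ^ (A + ε))) = L * (N * P) / m := by
      rw [hP]
      ring
    have h9 : (1 + L) * N * P / m = N / m * P + L * (N * P) / m := by ring
    rw [h9]
    linarith
  · rw [one_mul, add_mul (2 * K * _)]
    refine add_le_add ?_ ?_
    · have h1 := hp.one_add_log_rpow_log_le hε (by linarith : 0 ≤ 2 * A + 4)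
      have h2 : 0 ≤ Real.log (L ^ (2 * A + 4)) :=
        Real.log_nonneg (hp.one_le_rpow_log (by linarith))
      calc (1 + L) * N * P * (1 + Real.log (L ^ (2 * A + 4)))
          ≤ (2 * L) * x * P * ((1 + (2 * A + 4) / ε) * L ^ ε) := by
            gcongr
            linarith
        _ = 2 * K * (1 + (2 * A + 4) / ε) * (x * (L * L ^ ε / L ^ (A + ε))) := by
            rw [hP]
            ring
        _ = _ := by
            rw [← Real.rpow_one_add' hL.le (by linarith), ← Real.rpow_sub hL]
            ring_nf
    -- The trivial range: `X₁` is small enough to beat both the number of `m` and the `(log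
    -- x)^(C+1)` in `T`.
    · have h1 : L ^ (2 * A + 4) * ((X₁ + 1) * T) ≤ 16 * (x * L ^ (1 - A)) := by
        calc L ^ (2 * A + 4) * ((X₁ + 1) * T) ≤ L ^ (2 * A + 4) * ((X₁ + X₁) * T) := by gcongr
          _ = 16 * (x * (L ^ (2 * A + 4) * L ^ (C + 1) / L ^ (6 * A + C + 10))) := by
              rw [hX₁, hT]
              ring
          _ ≤ _ := by
              rw [← Real.rpow_add hL, ← Real.rpow_sub hL]
              have := hp.rpow_log_le_rpow_log
                (show 2 * A + 4 + (C + 1) - (6 * A + C + 10) ≤ 1 - A by linarith)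
              gcongr
      have h2 : L ^ (2 * A + 4) * (Q * (1 + L)) ≤ 2 * (x * L ^ (1 - A)) := by
        calc L ^ (2 * A + 4) * (Q * (1 + L)) ≤ L ^ (2 * A + 4) * (x ^ (1 / 2 : ℝ) * (2 * L)) := by
              have := hp.level_le_sqrt
              gcongr
              linarith
          _ = 2 * (L ^ (2 * A + 4 + 1) * x ^ (1 / 2 : ℝ)) := by
              rw [Real.rpow_add_one hL.ne']
              ring
          _ ≤ 2 * (x ^ (1 : ℝ) * L ^ (1 - A)) := by
              have := hp.rpow_log_mul_rpow_le (a := 1 / 2) (b := 2 * A + 4 + 1) (e := 1)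
                (b' := 1 - A) (by norm_num) (by linarith)
              linarith
          _ = _ := by rw [Real.rpow_one]
      rw [mul_add]
      linarith

theorem EquidistributionHyp.sumMaxDelta_mul_le
    (hE : EquidistributionHyp A C ε K x Q Ξ f) (hp : LevelParams A C x Q) (hε : 0 < ε)
    (hK : 0 ≤ K) {c : ArithmeticFunction ℂ} (hc : ∀ n, ‖c n‖ ≤ Real.log n)
    (hc0 : ∀ m : ℕ, Real.log x ^ (4 * A + 8) < m → c m = 0) {N : ℕ}
    (hN0 : x / Real.log x ^ (A + C + 2) ≤ N) (hN : (N : ℝ) ≤ x) :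
    sumMaxDelta Ξ ⇑(c * f) N Q ≤ K * (1 + (4 * A + 8) / ε) * (x * Real.log x ^ (1 - A)) := by
  have hA := hp.hA
  have hx := hp.pos
  have hL := hp.log_pos
  set L := Real.log x with hLdef
  refine (_root_.sumMaxDelta_mul_le Ξ c f N Q).trans ?_
  refine (sum_norm_mul_le_of_support (W := L ^ (4 * A + 8)) (H := L) (P := N * (K / L ^ (A + ε)))
    (S := 0) (hp.one_le_rpow_log (by linarith)) hL.le
    (by positivity) le_rfl (fun m hm _ => (hc m).trans (hp.log_natCast_le (le_trans
      (by exact_mod_cast (Finset.mem_Ioc.1 hm).2) hN))) hc0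
    (fun m => sumMaxDelta_nonneg _ _ _ _) ?_).trans ?_
  · intro m hm hmU
    have h2 := hE.sumMaxDelta_div_le hp (b := 4 * A + 8) le_rfl (Finset.mem_Ioc.1 hm).1 hN0 hN hmU
    refine h2.trans (le_of_eq ?_)
    ring
  · have h1 := hp.one_add_log_rpow_log_le hε (by linarith : 0 ≤ 4 * A + 8)
    have h2 : 0 ≤ Real.log (L ^ (4 * A + 8)) :=
      Real.log_nonneg (hp.one_le_rpow_log (by linarith))
    calc L * (N * (K / L ^ (A + ε)) * (1 + Real.log (L ^ (4 * A + 8))) + L ^ (4 * A + 8) * 0)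
        ≤ L * (x * (K / L ^ (A + ε)) * ((1 + (4 * A + 8) / ε) * L ^ ε) + L ^ (4 * A + 8) * 0) := by
          gcongr
      _ = K * (1 + (4 * A + 8) / ε) * (x * (L * L ^ ε / L ^ (A + ε))) := by ring
      _ = _ := by
          rw [← Real.rpow_one_add' hL.le (by linarith), ← Real.rpow_sub hL]
          ring_nf

theorem LogDerivBounded.sumMaxDelta_restrict_le (hf : LogDerivBounded f Lam)
    (hp : LevelParams A C x Q) {N : ℕ} (hN : (N : ℝ) ≤ x) (Ξ : CharSet) :
    sumMaxDelta Ξ (restrict (fun n => (n : ℝ) ≤ Real.log x ^ (2 * A + 4)) Lam) N Q ≤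
      2 * (x * Real.log x ^ (1 - A)) := by
  have hA := hp.hA
  have hC := hp.hC
  have hx := hp.pos
  have hL := hp.log_pos
  have hQ0 : 0 ≤ Q := by linarith [hp.two_le]
  set L := Real.log x with hLdef
  have hV0 : 0 ≤ L ^ (2 * A + 4) := by positivity
  refine (sumMaxDelta_le_two_mul hQ0 (B := L ^ (2 * A + 4) * L) ?_).trans ?_
  · rw [Nat.floor_natCast]
    calc _ ≤ ∑ n ∈ Finset.Ioc 0 N, if n ∈ Finset.Ioc 0 ⌊L ^ (2 * A + 4)⌋₊ then L else 0 := by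
          refine Finset.sum_le_sum fun n hn => ?_
          have hn' := Finset.mem_Ioc.1 hn
          by_cases hV : (n : ℝ) ≤ L ^ (2 * A + 4)
          · rw [if_pos (Finset.mem_Ioc.2 ⟨hn'.1, Nat.le_floor hV⟩)]
            refine (ArithmeticFunction.norm_restrict_le _ _ _).trans ((hf.norm_le n).trans ?_)
            exact ArithmeticFunction.vonMangoldt_le_log.trans (hp.log_natCast_le (le_trans
              (by exact_mod_cast hn'.2) hN))
          · rw [ArithmeticFunction.restrict_of_neg hV, norm_zero]
            split_ifs <;> positivity
      _ ≤ ∑ n ∈ Finset.Ioc 0 ⌊L ^ (2 * A + 4)⌋₊, L := by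
          rw [Finset.sum_ite_mem]
          exact Finset.sum_le_sum_of_subset_of_nonneg Finset.inter_subset_right
            fun _ _ _ => hL.le
      _ ≤ _ := by
          rw [Finset.sum_const, Nat.card_Ioc, nsmul_eq_mul, Nat.sub_zero]
          exact mul_le_mul_of_nonneg_right (Nat.floor_le hV0) hL.le
  · calc 2 * Q * (L ^ (2 * A + 4) * L) ≤ 2 * x ^ (1 / 2 : ℝ) * (L ^ (2 * A + 4) * L) := by
          have := hp.level_le_sqrt
          gcongr
      _ = 2 * (L ^ (2 * A + 4 + 1) * x ^ (1 / 2 : ℝ)) := by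
          rw [Real.rpow_add_one hL.ne']
          ring
      _ ≤ 2 * (x ^ (1 : ℝ) * L ^ (1 - A)) := by
          have := hp.rpow_log_mul_rpow_le (a := 1 / 2) (b := 2 * A + 4 + 1) (e := 1)
            (b' := 1 - A) (by norm_num) (by linarith)
          linarith
      _ = _ := by rw [Real.rpow_one]

/-! ### Type II term: large and small conductors -/

theorem CharSet.card_outerPrimitiveChars_le (Ξ : CharSet) {r : ℕ} (hr : 0 < r) :
    (Ξ.outerPrimitiveChars r).card ≤ r.totient := by
  have : NeZero r := ⟨hr.ne'⟩
  rw [← card_dirichletCharacter r]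
  exact Finset.card_le_card (Finset.subset_univ _)

theorem CharSet.mem_outerPrimitiveChars {Ξ : CharSet} {r : ℕ} {ξ : DirichletCharacter ℂ r} :
    ξ ∈ Ξ.outerPrimitiveChars r ↔ ξ ∈ primitiveChars r ∧ ξ ∉ Ξ.induced r := by
  simp only [CharSet.outerPrimitiveChars, Finset.mem_filter]

namespace LevelParams

theorem natLog_add_one_le (h : LevelParams A C x Q) {n : ℕ} (hn : (n : ℝ) ≤ x) :
    ((Nat.log 2 n + 1 : ℕ) : ℝ) ≤ 2 * Real.log x := by
  have h8 := h.le_log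
  push_cast
  rcases Nat.eq_zero_or_pos n with rfl | hn0
  · simp only [Nat.log_zero_right, Nat.cast_zero]
    linarith
  · have h1 : ((2 : ℝ)) ^ Nat.log 2 n ≤ n := by exact_mod_cast Nat.pow_log_le_self 2 hn0.ne'
    have h2 := Real.log_le_log (by positivity) h1
    rw [Real.log_pow] at h2
    have h3 := h.log_natCast_le hn
    have h4 := Real.log_two_gt_d9
    have h5 : (0 : ℝ) ≤ Nat.log 2 n := Nat.cast_nonneg _
    nlinarith

theorem sqrt_rpow_log (h : LevelParams A C x Q) :
    Real.sqrt (Real.log x ^ (2 * A + 4)) = Real.log x ^ (A + 2) := by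
  rw [Real.sqrt_eq_rpow, ← Real.rpow_mul h.log_pos.le]
  ring_nf

/-- With `R = (log x)^(A+2)` and `√U = R`, the three terms of the large sieve bound are each `O(x
(log x)^(-A-1))`, the last by the bound on `Q √x`. The remaining factor `log x` bounds the
coefficients of `β`. -/
theorem sum_large_conductor_le (hp : LevelParams A C x Q) (hf : LogDerivBounded f Lam)
    (hg : LogDerivBounded g (-Lam)) {N : ℕ} (hN : (N : ℝ) ≤ x) (s : ℕ) (Ξ : CharSet) :
    ∑ r ∈ Finset.Icc 1 ⌊Q⌋₊ with Real.log x ^ (A + 2) < ((r : ℕ) : ℝ), 1 / (r.totient : ℝ) *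
      ∑ ξ ∈ Ξ.outerPrimitiveChars r, ‖twistedSum (restrict (fun n => n.Coprime s)
        (restrict (fun n => ¬ (n : ℝ) ≤ Real.log x ^ (2 * A + 4)) g *
        (restrict (fun n => ¬ (n : ℝ) ≤ Real.log x ^ (2 * A + 4)) Lam * f))) N ξ‖ ≤
      1200 * (x * Real.log x ^ (-A)) := by
  have hA := hp.hA
  have hC := hp.hC
  have hx := hp.pos
  have hL := hp.log_pos
  have hQ0 : 0 ≤ Q := by linarith [hp.two_le]
  have hc : ∀ m n : ℕ, (m * n).Coprime s ↔ m.Coprime s ∧ n.Coprime s := fun m n =>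
    Nat.coprime_mul_iff_left
  have hlogs := fun (n : ℕ) (hn : (n : ℝ) ≤ x) => hp.natLog_add_one_le hn
  have hsqrtU := hp.sqrt_rpow_log
  set L := Real.log x with hLdef
  set U := L ^ (2 * A + 4) with hU
  have hU0 : 0 < U := by positivity
  set α := restrict (fun n : ℕ => ¬ (n : ℝ) ≤ U) g with hα
  set β := restrict (fun n : ℕ => ¬ (n : ℝ) ≤ U) Lam * f with hβ
  have hα1 : ∀ n, ‖restrict (fun n => n.Coprime s) α n‖ ≤ 1 := fun n =>
    (ArithmeticFunction.norm_restrict_le _ _ _).trans (hg.norm_restrict_le_one _ _)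
  have hα0 : ∀ m : ℕ, (m : ℝ) ≤ U → restrict (fun n => n.Coprime s) α m = 0 := fun m hm =>
    norm_le_zero_iff.1 ((ArithmeticFunction.norm_restrict_le _ _ _).trans
      (by rw [hα, ArithmeticFunction.restrict_of_neg (by simpa using hm), norm_zero]))
  have hβ1 : ∀ n ≤ N, ‖restrict (fun n => n.Coprime s) β n‖ ≤ L := fun n hn =>
    (ArithmeticFunction.norm_restrict_le _ _ _).trans
      ((ArithmeticFunction.norm_mul_apply_le_log (fun k =>
        (ArithmeticFunction.norm_restrict_le _ _ _).trans (hf.norm_le k))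
        hf.norm_apply_le_one n).trans (hp.log_natCast_le (le_trans (by exact_mod_cast hn) hN)))
  -- In the convolution the first factor divides `m`, hence is at most `U`, where the truncated
  -- `Lam` vanishes.
  have hβ0 : ∀ m : ℕ, (m : ℝ) ≤ U → restrict (fun n => n.Coprime s) β m = 0 := by
    intro m hm
    refine norm_le_zero_iff.1 ((ArithmeticFunction.norm_restrict_le _ _ _).trans ?_)
    rw [hβ, ArithmeticFunction.mul_apply, Finset.sum_eq_zero, norm_zero]
    intro y hy
    obtain ⟨h1, h2⟩ := Nat.mem_divisorsAntidiagonal.1 hy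
    have h3 : (y.1 : ℝ) ≤ m := by
      exact_mod_cast Nat.le_of_dvd (Nat.pos_of_ne_zero h2) (Dvd.intro _ h1)
    rw [ArithmeticFunction.restrict_of_neg (by simpa using h3.trans hm), zero_mul]
  have hbil := sum_primitiveChars_bilinear_le (A := 1) (B := L) (N := N) zero_le_one hL.le hα1 hβ1
    hU0 hU0 hα0 hβ0 rfl rfl (R := L ^ (A + 2)) (by positivity) (Q := ⌊Q⌋₊)
  refine le_trans (Finset.sum_le_sum fun r _ => ?_) (hbil.trans ?_)
  · refine mul_le_mul_of_nonneg_left ?_ (by positivity)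
    refine (Finset.sum_le_sum_of_subset_of_nonneg
      (fun ξ hξ => (CharSet.mem_outerPrimitiveChars.1 hξ).1) fun _ _ _ => norm_nonneg _).trans (le_of_eq (Finset.sum_congr rfl fun ξ _ => ?_))
    rw [ArithmeticFunction.restrict_mul hc, twistedSum_mul]
    rfl
  · have hfl : (⌊Q⌋₊ : ℝ) ≤ Q := Nat.floor_le hQ0
    have hk1 := hlogs N hN
    have hk2 := hlogs ⌊Q⌋₊ (hfl.trans hp.level_le_self)
    rw [hsqrtU]
    have hm : L / L ^ (A + 2) = L ^ (-A - 1) := by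
      rw [← Real.rpow_one_sub' hL.le (by linarith)]
      ring_nf
    have t1 : 8 * (N : ℝ) * (Nat.log 2 N + 1 : ℕ) / L ^ (A + 2) ≤ 16 * (x * L ^ (-A - 1)) := by
      rw [← hm]
      calc _ ≤ 8 * x * (2 * L) / L ^ (A + 2) := by gcongr
        _ = _ := by ring
    have t2 : 40 * ((Nat.log 2 ⌊Q⌋₊ + 1 : ℕ) : ℝ) * N * (1 / L ^ (A + 2) + 1 / L ^ (A + 2)) ≤
        160 * (x * L ^ (-A - 1)) := by
      rw [← hm]
      calc _ ≤ 40 * (2 * L) * x * (1 / L ^ (A + 2) + 1 / L ^ (A + 2)) := by gcongr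
        _ = _ := by ring
    have t3 : 16 * ((Nat.log 2 N + 1 : ℕ) : ℝ) ^ 2 * (⌊Q⌋₊ : ℝ) * Real.sqrt N ≤
        64 * (x * L ^ (-A - 1)) := by
      calc _ ≤ 16 * (2 * L) ^ 2 * Q * Real.sqrt x := by gcongr
        _ = 64 * (L ^ 2 * (Q * Real.sqrt x)) := by ring
        _ ≤ 64 * (L ^ 2 * (x * L ^ (-A - 3))) := by
            have := hp.level_mul_sqrt_le (b := -A - 3) (by linarith)
            gcongr
        _ = 64 * (x * (L ^ (2 : ℝ) * L ^ (-A - 3))) := by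
            rw [Real.rpow_two]
            ring
        _ = _ := by
            rw [← Real.rpow_add hL]
            ring_nf
    calc _ ≤ 5 * 1 * L * (16 * (x * L ^ (-A - 1)) + 160 * (x * L ^ (-A - 1)) +
          64 * (x * L ^ (-A - 1))) := by gcongr
      _ = 1200 * (x * (L * L ^ (-A - 1))) := by ring
      _ = 1200 * (x * (L ^ (1 + (-A - 1)))) := by
          rw [Real.rpow_add hL, Real.rpow_one]
      _ = _ := by ring_nf

/-- Even the smallest admissible `N` exceeds `x^0.98`. The drop from `0.49` to `0.48` absorbs the
rounding of the square root. -/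
theorem rpow_le_natSqrt (hp : LevelParams A C x Q) {N : ℕ}
    (hN0 : x / Real.log x ^ (A + C + 2) ≤ N) : x ^ (0.48 : ℝ) ≤ Nat.sqrt N := by
  have hA := hp.hA
  have hC := hp.hC
  have hx := hp.pos
  have hL := hp.log_pos
  have hL8 := hp.le_log
  have h1 : x ^ (0.98 : ℝ) ≤ N := by
    refine le_trans ?_ hN0
    rw [le_div_iff₀ (by positivity), mul_comm]
    have := hp.rpow_log_mul_rpow_le (a := 0.98) (b := A + C + 2) (e := 1) (b' := 0)
      (by norm_num) (by linarith)
    simpa using this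
  have h2 : (N : ℝ) < (Nat.sqrt N + 1) ^ 2 := by
    have := Nat.lt_succ_sqrt N
    rw [← Nat.pow_two] at this
    exact_mod_cast this
  have h3 : x ^ (0.49 : ℝ) ≤ Nat.sqrt N + 1 := by
    refine le_of_lt (lt_of_pow_lt_pow_left₀ 2 (by positivity) (lt_of_le_of_lt ?_ h2))
    rw [← Real.rpow_natCast, ← Real.rpow_mul hx.le]
    refine le_trans (le_of_eq ?_) h1
    norm_num
  have h4 := hp.rpow_log_mul_rpow_le (a := 0.48) (b := 1) (e := 0.49) (b' := 0)
    (by norm_num) (by linarith)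
  rw [Real.rpow_one, Real.rpow_zero, mul_one] at h4
  have h5 : 1 ≤ x ^ (0.48 : ℝ) := Real.one_le_rpow hp.one_le (by norm_num)
  nlinarith

end LevelParams

namespace EquidistributionHyp

/-- Recovering a character sum from the residue classes costs `φ(r) ≤ (log x)^(A+2)`, which lowers
the saving from `14A + 28` to `13A + 26`. -/
theorem norm_twistedSum_le {h : ArithmeticFunction ℂ} (hE : EquidistributionHyp A C ε K x Q Ξ h)
    (hp : LevelParams A C x Q) (hK : 0 ≤ K) {r : ℕ} (hr : 0 < r)
    (hrR : (r : ℝ) ≤ Real.log x ^ (A + 2)) {ξ : DirichletCharacter ℂ r} (hξ : ξ ∉ Ξ.induced r)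
    {k : ℕ} (hk0 : x ^ (0.4 : ℝ) ≤ k) (hk : (k : ℝ) ≤ x) :
    ‖twistedSum h k ξ‖ ≤ k * (K * Real.log x ^ (-(13 * A + 26))) := by
  have : NeZero r := ⟨hr.ne'⟩
  have hL := hp.log_pos
  have h1 := norm_charSum_le_of_norm_deltaXi_le (fun a => hE.norm_deltaXi_le k hk0 hk r hr a) hξ
  rw [charSum_eq_twistedSum, Nat.floor_natCast] at h1
  have h2 : (r.totient : ℝ) ≤ Real.log x ^ (A + 2) :=
    le_trans (by exact_mod_cast Nat.totient_le r) hrR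
  refine h1.trans ?_
  calc _ ≤ Real.log x ^ (A + 2) * (K * (k / Real.log x ^ (14 * A + 28))) := by gcongr
    _ = k * (K * (Real.log x ^ (A + 2) / Real.log x ^ (14 * A + 28))) := by ring
    _ = _ := by
        rw [← Real.rpow_sub hL]
        ring_nf

/-- Cutting at `D ≈ x^0.05` leaves lengths above `x^0.4`. In the tail `4^ω(s)` is `O(x^0.005)`
because `s ≤ √x`, against `√D ≥ x^0.025`, which saves a power of `x`. The rest loses one logarithm.
-/
theorem norm_twistedSum_coprime_le {h k' M : ArithmeticFunction ℂ} {c : ℝ}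
    (hE : EquidistributionHyp A C ε K x Q Ξ h) (hp : LevelParams A C x Q) (hK : 0 ≤ K)
    (hh : LogDerivBounded h M) (hk' : h * k' = 1) (hc0 : 0 ≤ c)
    (hc : ∀ s : ℕ, 0 < s → (4 : ℝ) ^ s.primeFactors.card ≤ c * (s : ℝ) ^ (0.01 : ℝ))
    {r : ℕ} (hr : 0 < r)
    (hrR : (r : ℝ) ≤ Real.log x ^ (A + 2)) {ξ : DirichletCharacter ℂ r} (hξ : ξ ∉ Ξ.induced r)
    {s : ℕ} (hs : 0 < s) (hsQ : (s : ℝ) ≤ Q)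
    {y : ℕ} (hy0 : ⌈x ^ (0.4 : ℝ)⌉₊ * ⌈x ^ (0.05 : ℝ)⌉₊ ≤ y) (hy : (y : ℝ) ≤ x) :
    ‖twistedSum (restrict (fun n => n.Coprime s) h) y ξ‖ ≤
      y * ((2 * K + c + 1) * Real.log x ^ (-(13 * A + 25))) := by
  have hA := hp.hA
  have hC := hp.hC
  have hx := hp.pos
  have hL := hp.log_pos
  have hL1 := hp.one_le_log
  have hD : 0 < x ^ (0.05 : ℝ) := by positivity
  refine (hh.norm_twistedSum_coprime_le hk' hs ξ (Y := ⌈x ^ (0.4 : ℝ)⌉₊)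
    (D := ⌈x ^ (0.05 : ℝ)⌉₊) (η := K * Real.log x ^ (-(13 * A + 26))) (by positivity)
    (Nat.ceil_pos.2 hD)
    (fun k hk hky => hE.norm_twistedSum_le hp hK hr hrR hξ (Nat.ceil_le.1 hk)
      (le_trans (by exact_mod_cast hky) hy)) hy0 le_rfl).trans ?_
  refine mul_le_mul_of_nonneg_left ?_ (Nat.cast_nonneg _)
  have hlog : 1 + Real.log y ≤ 2 * Real.log x := by
    have := hp.log_natCast_le hy
    linarith
  set L := Real.log x with hLdef
  have h1 : K * L ^ (-(13 * A + 26)) * (1 + Real.log y) ≤ 2 * K * L ^ (-(13 * A + 25)) := by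
    calc _ ≤ K * L ^ (-(13 * A + 26)) * (2 * L) := by gcongr
      _ = 2 * K * (L ^ (-(13 * A + 26)) * L) := by ring
      _ = _ := by
          rw [← Real.rpow_add_one hL.ne']
          ring_nf
  have h2 : (4 : ℝ) ^ s.primeFactors.card / Real.sqrt (⌈x ^ (0.05 : ℝ)⌉₊ : ℝ) ≤
      c * L ^ (-(13 * A + 25)) := by
    have e1 : (s : ℝ) ^ (0.01 : ℝ) ≤ x ^ (0.005 : ℝ) := by
      calc (s : ℝ) ^ (0.01 : ℝ) ≤ (x ^ (1 / 2 : ℝ)) ^ (0.01 : ℝ) :=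
            Real.rpow_le_rpow (Nat.cast_nonneg _) (hsQ.trans hp.level_le_sqrt) (by norm_num)
        _ = _ := by
            rw [← Real.rpow_mul hx.le]
            norm_num
    have e2 : x ^ (0.025 : ℝ) ≤ Real.sqrt (⌈x ^ (0.05 : ℝ)⌉₊ : ℝ) := by
      refine Real.le_sqrt_of_sq_le ?_
      rw [← Real.rpow_natCast, ← Real.rpow_mul hx.le]
      refine le_trans (le_of_eq ?_) (Nat.le_ceil _)
      norm_num
    have e3 : x ^ (0.025 : ℝ) > 0 := by positivity
    have e4 := hp.rpow_log_mul_rpow_le (a := -0.02) (b := 0) (e := 0) (b' := -(13 * A + 25))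
      (by norm_num) (by linarith)
    rw [Real.rpow_zero, Real.rpow_zero, one_mul, one_mul] at e4
    calc _ ≤ c * x ^ (0.005 : ℝ) / x ^ (0.025 : ℝ) := by
          refine div_le_div₀ (by positivity) ((hc s hs).trans ?_) e3 e2
          exact mul_le_mul_of_nonneg_left e1 hc0
      _ = c * x ^ (-0.02 : ℝ) := by
          rw [mul_div_assoc, ← Real.rpow_sub hx]
          norm_num
      _ ≤ _ := mul_le_mul_of_nonneg_left e4 hc0
  have h3 : 0 < L ^ (-(13 * A + 25)) := by positivity
  linarith

/-- Bilinear sums twisted by characters of small conductor. -/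
theorem norm_twistedSum_bilinear_le {c : ℝ}
    (hE : EquidistributionHyp A C ε K x Q Ξ f) (hE' : EquidistributionHyp A C ε K x Q Ξ g)
    (hp : LevelParams A C x Q) (hK : 0 ≤ K) (hf : LogDerivBounded f Lam) (hfg : f * g = 1)
    (hc0 : 0 ≤ c)
    (hc : ∀ s : ℕ, 0 < s → (4 : ℝ) ^ s.primeFactors.card ≤ c * (s : ℝ) ^ (0.01 : ℝ))
    {r : ℕ} (hr : 0 < r)
    (hrR : (r : ℝ) ≤ Real.log x ^ (A + 2)) {ξ : DirichletCharacter ℂ r} (hξ : ξ ∉ Ξ.induced r)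
    {s : ℕ} (hs : 0 < s) (hsQ : (s : ℝ) ≤ Q) {N : ℕ}
    (hN0 : x / Real.log x ^ (A + C + 2) ≤ N) (hN : (N : ℝ) ≤ x) :
    ‖twistedSum (restrict (fun n => n.Coprime s)
        (restrict (fun n => ¬ (n : ℝ) ≤ Real.log x ^ (2 * A + 4)) g *
        (restrict (fun n => ¬ (n : ℝ) ≤ Real.log x ^ (2 * A + 4)) Lam * f))) N ξ‖ ≤
      64 * (2 * K + c + 1) * (x * Real.log x ^ (-(13 * A + 22))) := by
  have hA := hp.hA
  have hC := hp.hC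
  have hx := hp.pos
  have hL := hp.log_pos
  have hL1 := hp.one_le_log
  have hL8 := hp.le_log
  have hg := hf.inverse hfg
  have hgf : g * f = 1 := by rw [mul_comm, hfg]
  have hsq := hp.rpow_le_natSqrt hN0
  have hcoef : 1 ≤ 2 * K + c + 1 := by linarith
  have hY : ((⌈x ^ (0.4 : ℝ)⌉₊ * ⌈x ^ (0.05 : ℝ)⌉₊ : ℕ) : ℝ) ≤ Real.log x * x ^ (0.45 : ℝ) := by
    have e1 : ∀ a : ℝ, 0 ≤ a → (⌈x ^ a⌉₊ : ℝ) ≤ 2 * x ^ a := by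
      intro a ha
      have h1 := Real.one_le_rpow hp.one_le ha
      have h2 := Nat.ceil_lt_add_one (Real.rpow_nonneg hx.le a)
      linarith
    push_cast
    calc _ ≤ (2 * x ^ (0.4 : ℝ)) * (2 * x ^ (0.05 : ℝ)) := by
          have h1 := e1 0.4 (by norm_num)
          have h2 := e1 0.05 (by norm_num)
          gcongr
      _ = 4 * (x ^ (0.4 : ℝ) * x ^ (0.05 : ℝ)) := by ring
      _ = 4 * x ^ (0.45 : ℝ) := by
          rw [← Real.rpow_add hx]
          norm_num
      _ ≤ _ := by
          gcongr
          linarith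
  -- Both the cut `U` and the threshold `Y`, about `x^0.45`, lie below `x^0.47`, so this inequality
  -- serves for both.
  have hη : x ^ (0.47 : ℝ) ≤ Nat.sqrt N * ((2 * K + c + 1) * Real.log x ^ (-(13 * A + 25))) := by
    have h1 := hp.rpow_log_mul_rpow_le (a := 0.47) (b := 0) (e := 0.48) (b' := -(13 * A + 25))
      (by norm_num) (by linarith)
    rw [Real.rpow_zero, one_mul] at h1
    refine h1.trans ?_
    have h2 : 0 < Real.log x ^ (-(13 * A + 25)) := by positivity
    have h3 : Real.log x ^ (-(13 * A + 25)) ≤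
        (2 * K + c + 1) * Real.log x ^ (-(13 * A + 25)) := le_mul_of_one_le_left h2.le hcoef
    gcongr
  have hN1 : 0 < N := by
    have : (0 : ℝ) < N := lt_of_lt_of_le (by positivity) hN0
    exact_mod_cast this
  have hkx : ∀ k : ℕ, k ≤ N → (k : ℝ) ≤ x := fun k hk => le_trans (by exact_mod_cast hk) hN
  refine (hf.norm_twistedSum_bilinear_le hfg ξ
    (Y := ⌈x ^ (0.4 : ℝ)⌉₊ * ⌈x ^ (0.05 : ℝ)⌉₊) hN1
    (η := (2 * K + c + 1) * Real.log x ^ (-(13 * A + 25))) (by positivity)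
    (fun k hk hkN => hE.norm_twistedSum_coprime_le hp hK hf hfg hc0 hc hr hrR hξ hs hsQ hk
      (hkx k hkN))
    (fun k hk hkN => hE'.norm_twistedSum_coprime_le hp hK hg hgf hc0 hc hr hrR hξ hs hsQ hk
      (hkx k hkN)) (by positivity) (hp.one_le_rpow_log (by linarith)) ?_ ?_ ?_).trans ?_
  · refine le_trans ?_ hsq
    calc _ ≤ (Real.log x * x ^ (0.45 : ℝ)) * Real.log x ^ (2 * A + 4) :=
          mul_le_mul_of_nonneg_right hY (by positivity)
      _ = Real.log x ^ (2 * A + 4 + 1) * x ^ (0.45 : ℝ) := by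
          rw [Real.rpow_add_one hL.ne']
          ring
      _ ≤ x ^ (0.48 : ℝ) * Real.log x ^ (0 : ℝ) :=
          hp.rpow_log_mul_rpow_le (by norm_num) (by linarith)
      _ = _ := by rw [Real.rpow_zero, mul_one]
  · refine le_trans (hY.trans ?_) hη
    have h1 := hp.rpow_log_mul_rpow_le (a := 0.45) (b := 1) (e := 0.47) (b' := 0)
      (by norm_num) (by linarith)
    rwa [Real.rpow_one, Real.rpow_zero, mul_one] at h1
  · refine le_trans ((hp.rpow_log_le (by linarith)).trans ?_) hη
    exact Real.rpow_le_rpow_of_exponent_le hp.one_le (by norm_num)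
  · have hlog : 1 + Real.log N ≤ 2 * Real.log x := by
      have := hp.log_natCast_le hN
      linarith
    have hlog0 : 0 ≤ Real.log N := Real.log_natCast_nonneg N
    calc _ ≤ 8 * x * (2 * Real.log x) ^ 3 *
          ((2 * K + c + 1) * Real.log x ^ (-(13 * A + 25))) := by gcongr
      _ = 64 * (2 * K + c + 1) * (x * (Real.log x ^ (3 : ℕ) *
          Real.log x ^ (-(13 * A + 25)))) := by ring
      _ = _ := by
          rw [← Real.rpow_natCast, ← Real.rpow_add hL]
          congr 3
          push_cast
          ring

/-- There are at most `φ(r)` characters for each `r`, which cancels the weight, and at most `(log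
x)^(A+2)` conductors. -/
theorem sum_small_conductor_le {c : ℝ}
    (hE : EquidistributionHyp A C ε K x Q Ξ f) (hE' : EquidistributionHyp A C ε K x Q Ξ g)
    (hp : LevelParams A C x Q) (hK : 0 ≤ K) (hf : LogDerivBounded f Lam) (hfg : f * g = 1)
    (hc0 : 0 ≤ c)
    (hc : ∀ s : ℕ, 0 < s → (4 : ℝ) ^ s.primeFactors.card ≤ c * (s : ℝ) ^ (0.01 : ℝ))
    {s : ℕ} (hs : 0 < s) (hsQ : (s : ℝ) ≤ Q) {N : ℕ}
    (hN0 : x / Real.log x ^ (A + C + 2) ≤ N) (hN : (N : ℝ) ≤ x) :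
    ∑ r ∈ Finset.Icc 1 ⌊Q⌋₊ with ¬ Real.log x ^ (A + 2) < ((r : ℕ) : ℝ), 1 / (r.totient : ℝ) *
      ∑ ξ ∈ Ξ.outerPrimitiveChars r, ‖twistedSum (restrict (fun n => n.Coprime s)
        (restrict (fun n => ¬ (n : ℝ) ≤ Real.log x ^ (2 * A + 4)) g *
        (restrict (fun n => ¬ (n : ℝ) ≤ Real.log x ^ (2 * A + 4)) Lam * f))) N ξ‖ ≤
      64 * (2 * K + c + 1) * (x * Real.log x ^ (-A)) := by
  have hA := hp.hA
  have hx := hp.pos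
  have hL := hp.log_pos
  set B := 64 * (2 * K + c + 1) * (x * Real.log x ^ (-(13 * A + 22))) with hB
  have hB0 : 0 ≤ B := by positivity
  have hR0 : 0 ≤ Real.log x ^ (A + 2) := by positivity
  calc _ ≤ ∑ r ∈ Finset.Icc 1 ⌊Q⌋₊ with ¬ Real.log x ^ (A + 2) < ((r : ℕ) : ℝ), B := by
        refine Finset.sum_le_sum fun r hr => ?_
        obtain ⟨h1, h2⟩ := Finset.mem_filter.1 hr
        have hr0 : 0 < r := (Finset.mem_Icc.1 h1).1
        have hφ : (0 : ℝ) < r.totient := by exact_mod_cast Nat.totient_pos.2 hr0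
        rw [div_mul_eq_mul_div, one_mul, div_le_iff₀ hφ]
        refine (Finset.sum_le_card_nsmul _ _ B fun ξ hξ => ?_).trans ?_
        · exact hE.norm_twistedSum_bilinear_le hE' hp hK hf hfg hc0 hc hr0 (not_lt.1 h2)
            (CharSet.mem_outerPrimitiveChars.1 hξ).2 hs hsQ hN0 hN
        · rw [nsmul_eq_mul, mul_comm B]
          refine mul_le_mul_of_nonneg_right ?_ hB0
          exact_mod_cast Ξ.card_outerPrimitiveChars_le hr0
    _ ≤ Real.log x ^ (A + 2) * B := by
        rw [Finset.sum_const, nsmul_eq_mul]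
        refine mul_le_mul_of_nonneg_right ?_ hB0
        have hsub : (Finset.Icc 1 ⌊Q⌋₊).filter
            (fun r => ¬ Real.log x ^ (A + 2) < ((r : ℕ) : ℝ)) ⊆
            Finset.Icc 1 ⌊Real.log x ^ (A + 2)⌋₊ := by
          intro r hr
          obtain ⟨h1, h2⟩ := Finset.mem_filter.1 hr
          exact Finset.mem_Icc.2 ⟨(Finset.mem_Icc.1 h1).1, Nat.le_floor (not_lt.1 h2)⟩
        have h5 := Finset.card_le_card hsub
        rw [Nat.card_Icc, Nat.add_sub_cancel] at h5
        exact le_trans (by exact_mod_cast h5) (Nat.floor_le hR0)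
    _ = 64 * (2 * K + c + 1) * (x * (Real.log x ^ (A + 2) * Real.log x ^ (-(13 * A + 22)))) := by
        rw [hB]
        ring
    _ ≤ _ := by
        rw [← Real.rpow_add hL]
        have := hp.rpow_log_le_rpow_log (show A + 2 + -(13 * A + 22) ≤ -A by linarith)
        gcongr

/-- Conductors are separated at `(log x)^(A+2)`. The outer sum of `1/φ(s)` is at most `6 log x`, the
only loss. -/
theorem sumMaxDelta_bilinear_le {c : ℝ}
    (hE : EquidistributionHyp A C ε K x Q Ξ f) (hE' : EquidistributionHyp A C ε K x Q Ξ g)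
    (hp : LevelParams A C x Q) (hK : 0 ≤ K) (hf : LogDerivBounded f Lam) (hfg : f * g = 1)
    (hc0 : 0 ≤ c)
    (hc : ∀ s : ℕ, 0 < s → (4 : ℝ) ^ s.primeFactors.card ≤ c * (s : ℝ) ^ (0.01 : ℝ)) {N : ℕ}
    (hN0 : x / Real.log x ^ (A + C + 2) ≤ N) (hN : (N : ℝ) ≤ x) :
    sumMaxDelta Ξ ⇑(restrict (fun n => ¬ (n : ℝ) ≤ Real.log x ^ (2 * A + 4)) g *
        (restrict (fun n => ¬ (n : ℝ) ≤ Real.log x ^ (2 * A + 4)) Lam * f)) N Q ≤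
      (7200 + 384 * (2 * K + c + 1)) * (x * Real.log x ^ (1 - A)) := by
  have hx := hp.pos
  have hL := hp.log_pos
  have hL1 := hp.one_le_log
  have hQ0 : 0 ≤ Q := by linarith [hp.two_le]
  have hfl : (⌊Q⌋₊ : ℝ) ≤ Q := Nat.floor_le hQ0
  refine (sumMaxDelta_le_sum_outerPrimitiveChars Ξ _ N Q).trans ?_
  set B := (1200 + 64 * (2 * K + c + 1)) * (x * Real.log x ^ (-A)) with hB
  have hB0 : 0 ≤ B := by positivity
  calc _ ≤ ∑ s ∈ Finset.Icc 1 ⌊Q⌋₊, 1 / (s.totient : ℝ) * B := by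
        refine Finset.sum_le_sum fun s hs => mul_le_mul_of_nonneg_left ?_ (by positivity)
        have hs' := Finset.mem_Icc.1 hs
        rw [← Finset.sum_filter_add_sum_filter_not (Finset.Icc 1 ⌊Q⌋₊)
          (fun r => Real.log x ^ (A + 2) < ((r : ℕ) : ℝ)), hB, add_mul]
        exact add_le_add (hp.sum_large_conductor_le hf (hf.inverse hfg) hN s Ξ)
          (hE.sum_small_conductor_le hE' hp hK hf hfg hc0 hc hs'.1
            (le_trans (by exact_mod_cast hs'.2) hfl) hN0 hN)
    _ ≤ 6 * Real.log x * B := by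
        rw [← Finset.sum_mul]
        refine mul_le_mul_of_nonneg_right ((sum_one_div_totient_le _).trans ?_) hB0
        have := hp.log_natCast_le (hfl.trans hp.level_le_self)
        linarith
    _ = (7200 + 384 * (2 * K + c + 1)) * (x * (Real.log x * Real.log x ^ (-A))) := by
        rw [hB]
        ring
    _ = _ := by rw [sub_eq_add_neg, Real.rpow_add hL, Real.rpow_one]

end EquidistributionHyp

/-! ### Assembling the bound for the logarithmic derivative -/

/-- The constant in the bound for the coefficients of the logarithmic derivative. -/
noncomputable def logDerivConst (A ε K c : ℝ) : ℝ :=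
  2 + (2 * K * (1 + (2 * A + 4) / ε) + 18) + K * (1 + (4 * A + 8) / ε) +
    (7200 + 384 * (2 * K + c + 1))

theorem logDerivConst_nonneg {c : ℝ} (hA : 0 ≤ A) (hε : 0 < ε) (hK : 0 ≤ K) (hc : 0 ≤ c) :
    0 ≤ logDerivConst A ε K c := by
  unfold logDerivConst
  positivity

namespace EquidistributionHyp

theorem sumMaxDelta_logDeriv_le {c : ℝ}
    (hE : EquidistributionHyp A C ε K x Q Ξ f) (hE' : EquidistributionHyp A C ε K x Q Ξ g)
    (hp : LevelParams A C x Q) (hε : 0 < ε) (hK : 0 ≤ K) (hΞ : (Ξ.card : ℝ) ≤ Real.log x ^ C)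
    (hf : LogDerivBounded f Lam) (hfg : f * g = 1) (hc0 : 0 ≤ c)
    (hc : ∀ s : ℕ, 0 < s → (4 : ℝ) ^ s.primeFactors.card ≤ c * (s : ℝ) ^ (0.01 : ℝ)) {N : ℕ}
    (hN0 : x / Real.log x ^ (A + C + 2) ≤ N) (hN : (N : ℝ) ≤ x) :
    sumMaxDelta Ξ Lam N Q ≤ logDerivConst A ε K c * (x * Real.log x ^ (1 - A)) := by
  have hL := hp.log_pos
  have hg := hf.inverse hfg
  set U := Real.log x ^ (2 * A + 4) with hU
  set a := restrict (fun n : ℕ => (n : ℝ) ≤ U) Lam with ha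
  set b := restrict (fun n : ℕ => (n : ℝ) ≤ U) g with hb
  set t := restrict (fun n : ℕ => ¬ (n : ℝ) ≤ U) g *
    (restrict (fun n : ℕ => ¬ (n : ℝ) ≤ U) Lam * f) with ht
  have hv : Lam = a + b * mulLog f - a * b * f + t := hf.vaughan hfg U U
  have hv' : ⇑Lam = ⇑a + ⇑(b * mulLog f) - ⇑(a * b * f) + ⇑t := by
    conv_lhs => rw [hv]
    rfl
  rw [hv']
  have h1 := sumMaxDelta_add_le Ξ (⇑a + ⇑(b * mulLog f) - ⇑(a * b * f)) t N Q
  have h2 := sumMaxDelta_sub_le Ξ (⇑a + ⇑(b * mulLog f)) ⇑(a * b * f) N Q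
  have h3 := sumMaxDelta_add_le Ξ ⇑a ⇑(b * mulLog f) N Q
  have t1 := hf.sumMaxDelta_restrict_le hp hN Ξ
  have t2 := hE.sumMaxDelta_mul_mulLog_le hp hε hK hΞ hf.norm_apply_le_one
    (c := b) (hg.norm_restrict_le_one _)
    (fun m hm => ArithmeticFunction.restrict_of_neg (not_le.2 hm)) hN0 hN
  have t3 := hE.sumMaxDelta_mul_le hp hε hK (c := a * b)
    (ArithmeticFunction.norm_mul_apply_le_log
      (fun n => (ArithmeticFunction.norm_restrict_le _ _ _).trans (hf.norm_le n))
      (hg.norm_restrict_le_one _)) (fun m hm => by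
        rw [ArithmeticFunction.mul_apply]
        refine Finset.sum_eq_zero fun y hy => ?_
        have hy' := (Nat.mem_divisorsAntidiagonal.1 hy).1
        -- Both factors of `a * b` live below `U`, so the product is supported up to `U² = (log
        -- x)^(4A+8)`.
        by_cases h4 : (y.1 : ℝ) ≤ U
        · by_cases h5 : (y.2 : ℝ) ≤ U
          · exfalso
            have h6 := mul_le_mul h4 h5 (Nat.cast_nonneg _) (by positivity)
            rw [← Nat.cast_mul, hy', hU, ← Real.rpow_add hL] at h6
            refine absurd (h6.trans (le_of_eq ?_)) (not_le.2 hm)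
            ring_nf
          · have h6 : b y.2 = 0 := ArithmeticFunction.restrict_of_neg h5
            rw [h6, mul_zero]
        · have h6 : a y.1 = 0 := ArithmeticFunction.restrict_of_neg h4
          rw [h6, zero_mul]) hN0 hN
  have t4 := hE.sumMaxDelta_bilinear_le hE' hp hK hf hfg hc0 hc hN0 hN
  unfold logDerivConst
  rw [add_mul, add_mul, add_mul]
  linarith

end EquidistributionHyp

/-! ### From the logarithmic derivative to the primes -/

theorem LogDerivBounded.logDeriv_prime (hf : LogDerivBounded f Lam) {p : ℕ} (hp : p.Prime) :
    Lam p = f p * (Real.log p : ℂ) := by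
  have h1 : Lam 1 = 0 := norm_le_zero_iff.1 ((hf.norm_le 1).trans (by simp))
  have h2 := congrArg (fun k : ArithmeticFunction ℂ => k p) hf.mul_eq
  simp only [ArithmeticFunction.mul_apply, ArithmeticFunction.mulLog_apply,
    Nat.sum_divisorsAntidiagonal (fun a b => Lam a * f b), hp.divisors] at h2
  rw [Finset.sum_pair hp.one_lt.ne, h1, zero_mul, zero_add, Nat.div_self hp.pos, hf.map_one,
    mul_one] at h2
  exact h2

/-- Off the primes `Lam` is dominated by `Λ`, so the sum is at most `ψ(N) - θ(N)`. -/
theorem LogDerivBounded.sum_norm_not_prime_le (hf : LogDerivBounded f Lam) {N : ℕ} (hN : 1 ≤ N) :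
    ∑ n ∈ Finset.Ioc 0 N, ‖if n.Prime then 0 else Lam n‖ ≤
      2 * Real.sqrt N * Real.log N := by
  refine le_trans ?_ (Chebyshev.psi_sub_theta_le (x := N) (by exact_mod_cast hN))
  rw [Chebyshev.psi_sub_theta_eq_sum_not_prime, Nat.floor_natCast, Finset.sum_filter]
  refine Finset.sum_le_sum fun n _ => ?_
  by_cases h : n.Prime
  · rw [if_pos h, if_neg (not_not.2 h), norm_zero]
  · rw [if_neg h, if_pos h]
    exact hf.norm_le n

namespace EquidistributionHyp

/-- The difference from `Lam` lives on proper prime powers. These are sparse enough for the trivial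
bound `Q √x log x`. -/
theorem sumMaxDelta_onPrimes_mul_log_le {c : ℝ}
    (hE : EquidistributionHyp A C ε K x Q Ξ f) (hE' : EquidistributionHyp A C ε K x Q Ξ g)
    (hp : LevelParams A C x Q) (hε : 0 < ε) (hK : 0 ≤ K) (hΞ : (Ξ.card : ℝ) ≤ Real.log x ^ C)
    (hf : LogDerivBounded f Lam) (hfg : f * g = 1) (hc0 : 0 ≤ c)
    (hc : ∀ s : ℕ, 0 < s → (4 : ℝ) ^ s.primeFactors.card ≤ c * (s : ℝ) ^ (0.01 : ℝ)) {N : ℕ}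
    (hN0 : x / Real.log x ^ (A + C + 2) ≤ N) (hN : (N : ℝ) ≤ x) :
    sumMaxDelta Ξ (fun n => onPrimes f n * (Real.log n : ℂ)) N Q ≤
      (logDerivConst A ε K c + 4) * (x * Real.log x ^ (1 - A)) := by
  have hA := hp.hA
  have hC := hp.hC
  have hx := hp.pos
  have hL := hp.log_pos
  have hQ0 : 0 ≤ Q := by linarith [hp.two_le]
  have hN1 : 1 ≤ N := by
    have : (0 : ℝ) < N := lt_of_lt_of_le (by positivity) hN0
    exact_mod_cast this
  have e : (fun n : ℕ => onPrimes f n * (Real.log n : ℂ)) =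
      ⇑Lam - fun n : ℕ => if n.Prime then 0 else Lam n := by
    funext n
    rw [Pi.sub_apply, onPrimes]
    split_ifs with h
    · rw [hf.logDeriv_prime h, sub_zero]
    · rw [zero_mul, sub_self]
  rw [e, add_mul]
  refine (sumMaxDelta_sub_le _ _ _ _ _).trans (add_le_add
    (hE.sumMaxDelta_logDeriv_le hE' hp hε hK hΞ hf hfg hc0 hc hN0 hN) ?_)
  refine (sumMaxDelta_le_two_mul hQ0 (B := 2 * Real.sqrt N * Real.log N) (by
    rw [Nat.floor_natCast]
    exact hf.sum_norm_not_prime_le hN1)).trans ?_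
  have h1 := hp.level_mul_sqrt_le (b := -A) (by linarith)
  have h2 := hp.log_natCast_le hN
  have h3 : 0 ≤ Real.log N := Real.log_natCast_nonneg N
  calc 2 * Q * (2 * Real.sqrt N * Real.log N) ≤ 2 * Q * (2 * Real.sqrt x * Real.log x) := by
        gcongr
    _ = 4 * ((Q * Real.sqrt x) * Real.log x) := by ring
    _ ≤ 4 * ((x * Real.log x ^ (-A)) * Real.log x) := by gcongr
    _ = _ := by
        rw [mul_assoc x, ← Real.rpow_add_one hL.ne']
        ring_nf

/-- Removal of the logarithmic weight. -/
theorem sumMaxDelta_onPrimes_le {c : ℝ}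
    (hE : EquidistributionHyp A C ε K x Q Ξ f) (hE' : EquidistributionHyp A C ε K x Q Ξ g)
    (hp : LevelParams A C x Q) (hε : 0 < ε) (hK : 0 ≤ K) (hΞ : (Ξ.card : ℝ) ≤ Real.log x ^ C)
    (hf : LogDerivBounded f Lam) (hfg : f * g = 1) (hc0 : 0 ≤ c)
    (hc : ∀ s : ℕ, 0 < s → (4 : ℝ) ^ s.primeFactors.card ≤ c * (s : ℝ) ^ (0.01 : ℝ)) :
    sumMaxDelta Ξ (onPrimes f) x Q ≤
      (2 * (logDerivConst A ε K c + 4) + 17) * (x / Real.log x ^ A) := by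
  have hA := hp.hA
  have hC := hp.hC
  have hx := hp.pos
  have hL := hp.log_pos
  have hL8 := hp.le_log
  have hQ0 : 0 ≤ Q := by linarith [hp.two_le]
  have hM0 := logDerivConst_nonneg (c := c) hA hε hK hc0
  set M₀ := logDerivConst A ε K c with hM₀
  set x₀ := x / Real.log x ^ (A + C + 2) with hx₀
  set k₀ := ⌈x₀⌉₊ with hk₀
  have hx98 : x ^ (0.98 : ℝ) ≤ x₀ := by
    rw [le_div_iff₀ (by positivity), mul_comm]
    have := hp.rpow_log_mul_rpow_le (a := 0.98) (b := A + C + 2) (e := 1) (b' := 0)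
      (by norm_num) (by linarith)
    simpa using this
  have hx1 : 1 ≤ x₀ := (Real.one_le_rpow hp.one_le (by norm_num)).trans hx98
  have hk₀x : x₀ ≤ k₀ := Nat.le_ceil _
  have hk₀2 : (k₀ : ℝ) ≤ 2 * x₀ := by
    have := Nat.ceil_lt_add_one (a := x₀) (by linarith)
    linarith
  have hlogk : Real.log x / 2 ≤ Real.log k₀ := by
    have h1 : Real.log (x ^ (0.98 : ℝ)) ≤ Real.log k₀ :=
      Real.log_le_log (by positivity) (hx98.trans hk₀x)
    rw [Real.log_rpow hx] at h1
    linarith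
  have hlogk0 : 0 < Real.log k₀ := by linarith
  have hk₀1 : 0 < k₀ := Nat.ceil_pos.2 (by linarith)
  have hx₀x : 2 * x₀ ≤ x := by
    have h1 := hp.rpow_log_le_rpow_log (show (1 : ℝ) ≤ A + C + 2 by linarith)
    rw [Real.rpow_one] at h1
    have h2 : x₀ ≤ x / Real.log x := by
      rw [hx₀]
      gcongr
    have h3 : x / Real.log x ≤ x / 8 := by gcongr
    linarith
  have hkN : k₀ ≤ ⌊x⌋₊ := Nat.le_floor (hk₀2.trans hx₀x)
  have hNx : (⌊x⌋₊ : ℝ) ≤ x := Nat.floor_le hx.le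
  -- The weight `1/log n` is frozen below `k₀`, since there is no bound for shorter sums. It then
  -- changes only from `k₀` on, and its total variation is `O(1/log x)`.
  set w : ℕ → ℝ := fun n => 1 / Real.log ((max n k₀ : ℕ) : ℝ) with hw
  have hmono : ∀ n : ℕ, Real.log k₀ ≤ Real.log ((max n k₀ : ℕ) : ℝ) := fun n =>
    Real.log_le_log (by exact_mod_cast hk₀1) (by exact_mod_cast le_max_right n k₀)
  have hwanti : Antitone w := by
    intro m n hmn
    refine one_div_le_one_div_of_le (hlogk0.trans_le (hmono m)) (Real.log_le_log ?_ ?_)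
    · exact_mod_cast lt_of_lt_of_le hk₀1 (le_max_right m k₀)
    · exact_mod_cast max_le_max_right k₀ hmn
  have hw0 : ∀ n, 0 ≤ w n := fun n => one_div_nonneg.2 (hlogk0.trans_le (hmono n)).le
  have hw00 : w 0 ≤ 2 / Real.log x := by
    simp only [hw, Nat.zero_max]
    rw [div_le_div_iff₀ hlogk0 hL]
    linarith
  set h : ℕ → ℂ := fun n => onPrimes f n * (Real.log n : ℂ) with hh
  -- The error of freezing the weight is bounded by one and supported on `n ≤ k₀`. As `k₀` is at
  -- most `2x/(log x)^(A+C+2)`, the trivial bound suffices.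
  set e : ℕ → ℂ := fun n => onPrimes f n - h n * (w n : ℂ) with he
  have hsplit : onPrimes f = (fun n => h n * (w n : ℂ)) + e := by
    funext n
    simp only [he, Pi.add_apply]
    ring
  have he0 : ∀ n, k₀ < n → e n = 0 := by
    intro n hn
    by_cases hpn : n.Prime
    · have h1 : (Real.log n : ℂ) ≠ 0 := by
        have : Real.log n ≠ 0 := (Real.log_pos (by exact_mod_cast hpn.one_lt)).ne'
        exact_mod_cast this
      simp only [he, hh, hw, max_eq_left hn.le]
      rw [Complex.ofReal_div, Complex.ofReal_one, mul_assoc, mul_one_div_cancel h1, mul_one,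
        sub_self]
    · simp [he, hh, onPrimes, hpn]
  have he1 : ∀ n ∈ Finset.Ioc 0 k₀, ‖e n‖ ≤ 1 := by
    intro n hn
    have hn' := Finset.mem_Ioc.1 hn
    have h1 : e n = onPrimes f n * ((1 - Real.log n / Real.log k₀ : ℝ) : ℂ) := by
      simp only [he, hh, hw, max_eq_right hn'.2]
      push_cast
      ring
    have h2 : ‖onPrimes f n‖ ≤ 1 := by
      rw [onPrimes]
      split_ifs
      · exact hf.norm_apply_le_one n
      · simp
    have h3 : 0 ≤ Real.log n / Real.log k₀ := div_nonneg (Real.log_natCast_nonneg n) hlogk0.le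
    have h4 : Real.log n / Real.log k₀ ≤ 1 := by
      rw [div_le_one hlogk0]
      exact Real.log_le_log (by exact_mod_cast hn'.1) (by exact_mod_cast hn'.2)
    rw [h1, norm_mul, Complex.norm_real, Real.norm_of_nonneg (by linarith)]
    exact mul_le_one₀ h2 (by linarith) (by linarith)
  have hmain : sumMaxDelta Ξ (fun n => h n * (w n : ℂ)) ⌊x⌋₊ Q ≤
      w 0 * ((M₀ + 4) * (x * Real.log x ^ (1 - A))) := by
    refine sumMaxDelta_mul_antitone_le hwanti hw0 fun k hk hne => ?_
    refine hE.sumMaxDelta_onPrimes_mul_log_le hE' hp hε hK hΞ hf hfg hc0 hc ?_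
      (le_trans (by exact_mod_cast hk) hNx)
    refine hk₀x.trans ?_
    by_contra hlt
    have hlt' : k < k₀ := by exact_mod_cast not_le.1 hlt
    refine hne (hlt'.trans_le hkN) ?_
    simp only [hw]
    rw [max_eq_right hlt'.le, max_eq_right (Nat.succ_le_of_lt hlt')]
  have herr : sumMaxDelta Ξ e ⌊x⌋₊ Q ≤ 17 * (x * Real.log x ^ (-A)) := by
    rw [sumMaxDelta_eq_of_support hkN he0]
    refine (hp.sumMaxDelta_le_of_bounded hΞ zero_le_one he1).trans ?_
    have h1 : (k₀ : ℝ) * (8 * Real.log x ^ (C + 1)) ≤ 16 * (x * Real.log x ^ (-A)) := by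
      calc _ ≤ 2 * x₀ * (8 * Real.log x ^ (C + 1)) := by gcongr
        _ = 16 * (x * (Real.log x ^ (C + 1) / Real.log x ^ (A + C + 2))) := by
            rw [hx₀]
            ring
        _ ≤ _ := by
            rw [← Real.rpow_sub hL]
            have := hp.rpow_log_le_rpow_log (show C + 1 - (A + C + 2) ≤ -A by linarith)
            gcongr
    have h2 : Q ≤ x * Real.log x ^ (-A) := by
      have := hp.rpow_log_mul_rpow_le (a := 1 / 2) (b := 0) (e := 1) (b' := -A)
        (by norm_num) (by linarith)
      rw [Real.rpow_zero, one_mul, Real.rpow_one] at this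
      exact hp.level_le_sqrt.trans this
    linarith
  rw [sumMaxDelta_congr (X' := ((⌊x⌋₊ : ℕ) : ℝ)) (h' := onPrimes f) (by rw [Nat.floor_natCast])
    fun _ _ => rfl, hsplit]
  refine (sumMaxDelta_add_le _ _ _ _ _).trans ((add_le_add hmain herr).trans ?_)
  have hfin : w 0 * ((M₀ + 4) * (x * Real.log x ^ (1 - A))) ≤
      2 * (M₀ + 4) * (x * Real.log x ^ (-A)) := by
    calc _ ≤ 2 / Real.log x * ((M₀ + 4) * (x * Real.log x ^ (1 - A))) := by gcongr
      _ = 2 * (M₀ + 4) * (x * (Real.log x ^ (1 - A) / Real.log x)) := by ring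
      _ = _ := by
          rw [← Real.rpow_sub_one hL.ne']
          ring_nf
  rw [div_eq_mul_inv, ← Real.rpow_neg hL.le, add_mul]
  linarith

end EquidistributionHyp

end

theorem theorem2p3 (A C ε : ℝ) (hA : 0 ≤ A) (hC : 0 ≤ C) (hε : 0 < ε) :
    ∃ x₀ : ℝ, ∀ K : ℝ, ∃ K' : ℝ,
      ∀ f g : ArithmeticFunction ℂ, ClassC f → f * g = 1 →
      ∀ x : ℝ, x₀ ≤ x →
      ∀ Q : ℝ, 2 ≤ Q → Q ≤ x ^ (1 / 2 : ℝ) / Real.log x ^ (5 * A / 2 + C / 4 + 7 / 2) →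
      ∀ Ξ : CharSet, Ξ.AllPrimitive → (Ξ.card : ℝ) ≤ Real.log x ^ C →
      (∀ h : ArithmeticFunction ℂ, h = f ∨ h = g →
        (∀ X : ℝ, x ^ (0.4 : ℝ) ≤ X → X ≤ x → ∀ q : ℕ, 1 ≤ q → ∀ a : (ZMod q)ˣ,
          ‖deltaXi Ξ h X q a‖ ≤ K * (X / Real.log x ^ (14 * A + 28))) ∧
        (∀ X : ℝ, x / Real.log x ^ (6 * A + C + 10) ≤ X → X ≤ x →
          sumMaxDelta Ξ h X Q ≤ K * (X / Real.log x ^ (A + ε)))) →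
      sumMaxDelta Ξ (onPrimes f) x Q ≤ K' * (x / Real.log x ^ A) ∧
        sumMaxDelta Ξ (onPrimes g) x Q ≤ K' * (x / Real.log x ^ A) := by
  obtain ⟨x₀, hx₀⟩ := exists_forall_large A C
  obtain ⟨c, hc0, hc⟩ := four_pow_card_primeFactors_le (η := 0.01) (by norm_num)
  -- `K` may be negative, so it is replaced by `max K 0` throughout.
  refine ⟨x₀, fun K => ⟨2 * (logDerivConst A ε (max K 0) c + 4) + 17, ?_⟩⟩
  intro f g hf hfg x hx Q hQ2 hQ Ξ _ hΞ hyp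
  obtain ⟨h1, h2, h3⟩ := hx₀ x hx
  obtain ⟨Lam, hLam⟩ := hf.exists_logDerivBounded
  have hp : LevelParams A C x Q := ⟨hA, hC, h1, h2, h3, hQ2, hQ⟩
  have hL := hp.log_pos
  have hE : ∀ h : ArithmeticFunction ℂ, h = f ∨ h = g →
      EquidistributionHyp A C ε (max K 0) x Q Ξ h := by
    intro h hh
    obtain ⟨h4, h5⟩ := hyp h hh
    constructor
    · intro X hX hXx q hq a
      refine (h4 X hX hXx q hq a).trans (mul_le_mul_of_nonneg_right (le_max_left K 0) ?_)
      have : 0 ≤ X := le_trans (by positivity) hX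
      positivity
    · intro X hX hXx
      refine (h5 X hX hXx).trans (mul_le_mul_of_nonneg_right (le_max_left K 0) ?_)
      have hx' := hp.pos
      have : 0 ≤ X := le_trans (by positivity) hX
      positivity
  have hEf := hE f (Or.inl rfl)
  have hEg := hE g (Or.inr rfl)
  -- The bound for `g` is the same argument with `f` and `g` exchanged and `Lam` replaced by `-Lam`.
  exact ⟨hEf.sumMaxDelta_onPrimes_le hEg hp hε (le_max_right K 0) hΞ hLam hfg hc0.le hc,
    hEg.sumMaxDelta_onPrimes_le hEf hp hε (le_max_right K 0) hΞ (hLam.inverse hfg)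
      (by rw [mul_comm, hfg]) hc0.le hc⟩
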